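/- Let $M$ be a complete (connected) Riemannian manifold and $\mathcal F$ a singular Riemannian foliation of $M$ with closed leaves, i.e. a partition of $M$ into connected immersed submanifolds (the leaves) such that every vector tangent to a leaf extends to a smooth vector field tangent to the leaves, and every geodesic perpendicular to one leaf is perpendicular to every leaf it meets. Let $\Sigma\neq M$ be the minimal stratum (the union of the leaves of minimal dimension, or a nonempty union of connected components of it), let $\nu\Sigma$ be its normal bundle, and let $r>0$ be such that the normal exponential map is a diffeomorphism from $\{\xi\in\nu\Sigma:\|\xi\|<r\}$ onto $B=\{x\in M: d(x,\Sigma)<r\}$. The blow-up of $B$ along $\Sigma$ is $\widehat B=\{(x,[\xi])\in B\times\mathbb P(\nu\Sigma): x=\exp(t\xi),\ \|\xi\|=1,\ |t|<r\}$, with its smooth structure, for which $(t,\xi)\mapsto(\exp(t\xi),[\xi])$ is a smooth two-fold covering by $\{(t,\xi):|t|<r,\ \xi\in\nu\Sigma,\ \|\xi\|=1\}$, and with the blow-up map $\hat\rho(x,[\xi])=x$. The lifted foliation $\widehat{\mathcal F}$ has as leaves the preimages of the leaves of $\mathcal F$ outside of $\Sigma$, while over $\Sigma$ the lines $[\xi]$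 and $[\xi']$ are in the same leaf if, for suitable unit vectors $\xi$, $\xi'$ in them, $\exp(s\xi)$ and $\exp(s\xi')$ are in the same leaf of $\mathcal F$ for all $|s|<r$. Give $B/\mathcal F$ and $\widehat B/\widehat{\mathcal F}$ the quotient topologies and $B/\mathcal F$ the quotient metric, and identify functions on these leaf spaces with basic functions (functions constant along the leaves) on $B$ and $\widehat B$. A continuous basic function $h$ on $B$ is a blow-up function, $h\in\mathcal B$, if (a) $h\circ\hat\rho$ is a smooth basic function on $\widehat B$; (b) the restrictions of $h$ to $\Sigma$ and to $B\setminus\Sigma$ are smooth; (c) $X\cdot h=\frac{d}{dt}h(\exp(tX))|_{t=0}$ exists and equals $0$ for each $X\in\nu\Sigma$. Let $I\subset\mathbb R$ be an interval that is a neighbourhood of $0$, and let $\varphi:B/\mathcal F\times I\to B/\mathcal F$ be a flow of isometries: a continuous one-parameter local group of isometries whose integral curves stay in the quotient of a stratum (so that the dimension of the leaves is constant along them). Let $\hat\varphi:\widehat B/\widehat{\mathcal F}\times I\to\widehat B/\widehat{\mathcal F}$ be its lift, the continuous one-parameter local group with $\hat\rho\circ\hat\varphi_t=\varphi_t\circ\hat\rho$.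 Assume that $\hat\varphi$ is smooth: for each smooth basic function $f$ on $\widehat B$, the function $(a,t)\mapsto f(\hat\varphi_t(a))$ is smooth on $\widehat B\times I$. Then for each $h\in\mathcal B$ the derivative $(\bar Y\cdot h)(p)=\frac{d}{dz}h(\varphi_z(p))|_{z=0}$ exists for every $p\in B/\mathcal F$, and for each $s\in I$ the function $\varphi_s^*(\bar Y\cdot h)=(\bar Y\cdot h)\circ\varphi_s$ belongs to $\mathcal B$. -/

import Mathlib

open Set Bundle Topology
open scoped Manifold ContDiff RealInnerProductSpace

set_option linter.unusedSectionVars false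

noncomputable section

namespace SingularFoliation

universe u

variable {n : ℕ} {M : Type u} [MetricSpace M] [ChartedSpace (EuclideanSpace ℝ (Fin n)) M]

/-! ### Geodesics and the exponential map -/

/-- The velocity of a curve. -/
def velocityVec (c : ℝ → M) (t : ℝ) : TangentSpace (𝓡 n) (c t) :=
  mfderiv 𝓘(ℝ, ℝ) (𝓡 n) c t (1 : ℝ)

/-- The velocity of a curve, as a point of the tangent bundle. -/
def velocity (c : ℝ → M) (t : ℝ) : TangentBundle (𝓡 n) M := ⟨c t, velocityVec c t⟩

section Riemannian

variable [IsManifold (𝓡 n) ∞ M] [RiemannianBundle (fun x : M => TangentSpace (𝓡 n) x)]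

/-- The Riemannian metric written in the preferred chart around `p`: the value at the point `y` of
the target of the chart, on the coordinate vectors `a` and `b`. -/
def chartMetric (p : M) (y a b : EuclideanSpace ℝ (Fin n)) : ℝ :=
  ⟪mfderiv 𝓘(ℝ, EuclideanSpace ℝ (Fin n)) (𝓡 n) (extChartAt (𝓡 n) p).symm y a,
    mfderiv 𝓘(ℝ, EuclideanSpace ℝ (Fin n)) (𝓡 n) (extChartAt (𝓡 n) p).symm y b⟫

/-- `γ : ℝ → M` is a geodesic: it is smooth and, in every preferred chart it meets, its coordinate
expression `c` solves the geodesic equation. The latter is written in its Euler-Lagrange form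
`d/dt g(c', w) = 1/2 (∂_w g)(c', c')` for all coordinate vectors `w`, which after inverting the
matrix of `g` becomes `c'' + Γ(c', c') = 0`. -/
def IsGeodesic (γ : ℝ → M) : Prop :=
  ContMDiff 𝓘(ℝ, ℝ) (𝓡 n) ∞ γ ∧
  ∀ (p : M) (t : ℝ), γ t ∈ (extChartAt (𝓡 n) p).source →
    ∀ w : EuclideanSpace ℝ (Fin n),
      HasDerivAt
        (fun τ : ℝ => chartMetric p (extChartAt (𝓡 n) p (γ τ))
          (deriv (fun σ : ℝ => extChartAt (𝓡 n) p (γ σ)) τ) w)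
        ((1 / 2 : ℝ) * fderiv ℝ
          (fun y => chartMetric p y
            (deriv (fun σ : ℝ => extChartAt (𝓡 n) p (γ σ)) t)
            (deriv (fun σ : ℝ => extChartAt (𝓡 n) p (γ σ)) t))
          (extChartAt (𝓡 n) p (γ t)) w) t

open Classical in
/-- The Riemannian exponential map `TM → M`: `exp v = γ 1` for the geodesic `γ` with initial
velocity `v`. (On a complete manifold this geodesic exists and is unique.) -/
def exp (v : TangentBundle (𝓡 n) M) : M :=
  if h : ∃ γ : ℝ → M, IsGeodesic (n := n) γ ∧ velocity γ 0 = v then h.choose 1 else v.proj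

/-- Multiplication of tangent vectors by scalars. -/
def scale (t : ℝ) (v : TangentBundle (𝓡 n) M) : TangentBundle (𝓡 n) M := ⟨v.proj, t • v.2⟩

/-! ### Singular Riemannian foliations -/

variable (n M) in
/-- A singular Riemannian foliation of `M`: a partition into connected immersed submanifolds (the
leaves, i.e. the classes of `leafRel`; `tangent p` is the tangent space at `p` of the leaf through
`p`) which is a singular foliation and a transnormal system. -/
structure SRF where
  /-- Being in the same leaf. -/
  leafRel : Setoid M
  /-- The tangent space of the leaf through a point. -/
  tangent : ∀ p : M, Submodule ℝ (TangentSpace (𝓡 n) p)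
  /-- Each leaf is the image of an injective immersion of a connected manifold, and `tangent` is
  its tangent space. -/
  leaf_immersed : ∀ p : M, ∃ (k : ℕ) (N : Type u) (_ : TopologicalSpace N)
    (_ : ChartedSpace (EuclideanSpace ℝ (Fin k)) N) (_ : IsManifold (𝓡 k) ∞ N) (i : N → M),
    ConnectedSpace N ∧ ContMDiff (𝓡 k) (𝓡 n) ∞ i ∧ Function.Injective i ∧
    range i = {q | leafRel p q} ∧
    ∀ y : N, Function.Injective (mfderiv (𝓡 k) (𝓡 n) i y) ∧
      ∀ w : TangentSpace (𝓡 n) (i y),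
        w ∈ tangent (i y) ↔ ∃ a : TangentSpace (𝓡 k) y, mfderiv (𝓡 k) (𝓡 n) i y a = w
  /-- Every vector tangent to a leaf extends to a smooth vector field tangent to the leaves. -/
  exists_field : ∀ (p : M), ∀ v ∈ tangent p, ∃ X : ∀ q : M, TangentSpace (𝓡 n) q,
    ContMDiff (𝓡 n) (𝓡 n).tangent ∞ (fun q => (⟨q, X q⟩ : TangentBundle (𝓡 n) M)) ∧
    X p = v ∧ ∀ q, X q ∈ tangent q
  /-- A geodesic perpendicular to one leaf is perpendicular to every leaf it meets. -/
  transnormal : ∀ γ : ℝ → M, IsGeodesic (n := n) γ → ∀ s t : ℝ,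
    (∀ w ∈ tangent (γ s), ⟪velocityVec (n := n) γ s, w⟫ = 0) →
    ∀ w ∈ tangent (γ t), ⟪velocityVec (n := n) γ t, w⟫ = 0

/-- The dimension of the leaf through `p`. -/
def SRF.leafDim (F : SRF n M) (p : M) : ℕ := Module.finrank ℝ (F.tangent p)

/-- All leaves are closed subsets of `M`. -/
def SRF.HasClosedLeaves (F : SRF n M) : Prop := ∀ p : M, IsClosed {q | F.leafRel p q}

/-- The union of the leaves of minimal dimension. -/
def SRF.minLocus (F : SRF n M) : Set M := {p | ∀ q, F.leafDim p ≤ F.leafDim q}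

/-- `S` is a minimal stratum: a nonempty union of connected components of the union of the leaves
of minimal dimension. (So `S` may be one connected component, or the whole union.) -/
structure SRF.IsMinimalStratum (F : SRF n M) (S : Set M) : Prop where
  nonempty : S.Nonempty
  subset : S ⊆ F.minLocus
  component : ∀ p ∈ S, connectedComponentIn F.minLocus p ⊆ S

/-! ### Normal bundle and tubular neighbourhood of a subset (submanifold) `S` -/

/-- The normal bundle `νS`: the tangent vectors with foot point in `S` that are orthogonal to the
velocities of all smooth curves in `S` through the foot point. -/
def normalBundle (S : Set M) : Set (TangentBundle (𝓡 n) M) :=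
  {v | v.proj ∈ S ∧ ∀ c : ℝ → M, ContMDiff 𝓘(ℝ, ℝ) (𝓡 n) ∞ c → (∀ t, c t ∈ S) →
    ∀ w : TangentSpace (𝓡 n) (c 0), (⟨c 0, w⟩ : TangentBundle (𝓡 n) M) = v →
      ⟪velocityVec (n := n) c 0, w⟫ = 0}

variable (n) in
/-- `r` is the radius of a tubular neighbourhood of `S`: the normal exponential map is a
diffeomorphism from the normal vectors of length `< r` onto `Tub_r(S) = {x | d(x, S) < r}`. -/
structure IsTubularRadius (S : Set M) (r : ℝ) : Prop where
  pos : 0 < r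
  mapsTo : ∀ v ∈ normalBundle (n := n) S, ‖v.2‖ < r → exp v ∈ Metric.thickening r S
  smooth : ContMDiffOn (𝓡 n).tangent (𝓡 n) ∞ exp {v | v ∈ normalBundle (n := n) S ∧ ‖v.2‖ < r}
  inverse : ∃ log : M → TangentBundle (𝓡 n) M,
    ContMDiffOn (𝓡 n) (𝓡 n).tangent ∞ log (Metric.thickening r S) ∧
    (∀ x ∈ Metric.thickening r S,
      log x ∈ normalBundle S ∧ ‖(log x).2‖ < r ∧ exp (log x) = x) ∧
    ∀ v ∈ normalBundle S, ‖v.2‖ < r → log (exp v) = v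

/-! ### The leaf space of the tube `B = Tub_r(S)` -/

/-- Two points of `B` in the same leaf. -/
def SRF.tubeSetoid (F : SRF n M) (S : Set M) (r : ℝ) : Setoid (Metric.thickening r S) :=
  F.leafRel.comap Subtype.val

/-- The leaf space `B/F` of the tube `B = Tub_r(S)`, with the quotient topology. A function on it
is the same as a basic function on `B`. -/
abbrev SRF.LeafSpace (F : SRF n M) (S : Set M) (r : ℝ) : Type u :=
  Quotient (F.tubeSetoid S r)

/-- The basic function on `B` given by a function on `B/F` (extended by `0` outside of `B`). -/
def SRF.basicFun (F : SRF n M) (S : Set M) (r : ℝ) (h : F.LeafSpace S r → ℝ) : M → ℝ :=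
  Function.extend Subtype.val (fun x : Metric.thickening r S => h (Quotient.mk _ x)) 0

variable (n) in
/-- The Riemannian distance of the open submanifold `B` of `M`: the infimum of the lengths of the
`C¹` curves in `B` joining two points. -/
def intrinsicEDist (B : Set M) (x y : M) : ENNReal :=
  ⨅ (c : ℝ → M) (_ : ContMDiffOn 𝓘(ℝ, ℝ) (𝓡 n) 1 c (Icc 0 1)) (_ : ∀ t ∈ Icc (0 : ℝ) 1, c t ∈ B)
    (_ : c 0 = x) (_ : c 1 = y), Manifold.pathELength (𝓡 n) c 0 1

/-- The quotient metric of `B/F`: the distance between two leaves in the Riemannian manifold `B`. -/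
def SRF.leafEDist (F : SRF n M) (S : Set M) (r : ℝ) (p q : F.LeafSpace S r) : ENNReal :=
  ⨅ (x : Metric.thickening r S) (y : Metric.thickening r S)
    (_ : Quotient.mk (F.tubeSetoid S r) x = p) (_ : Quotient.mk (F.tubeSetoid S r) y = q),
    intrinsicEDist n (Metric.thickening r S) (x : M) (y : M)

/-- `φ` is a one-parameter local group on `X`, with time running in `J` (the values of `φ` at times
outside of `J` are irrelevant), continuous on `X × J`. -/
structure IsLocalGroup {X : Type u} [TopologicalSpace X] (J : Set ℝ) (φ : X → ℝ → X) : Prop where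
  continuousOn : ContinuousOn (fun z : X × ℝ => φ z.1 z.2) (univ ×ˢ J)
  zero_time : ∀ p, φ p 0 = p
  comp_time : ∀ p, ∀ s ∈ J, ∀ t ∈ J, s + t ∈ J → φ (φ p s) t = φ p (s + t)

/-- `φ` is a flow of isometries on `B/F`: a continuous one-parameter local group of isometries
whose integral curves stay in the quotient of a stratum, i.e. (integral curves being connected) the
dimension of the leaves is constant along them. -/
structure SRF.IsIsometricFlow (F : SRF n M) (S : Set M) (r : ℝ) (J : Set ℝ)
    (φ : F.LeafSpace S r → ℝ → F.LeafSpace S r) : Prop where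
  localGroup : IsLocalGroup J φ
  strata : ∀ x y : Metric.thickening r S, ∀ t ∈ J,
    φ (Quotient.mk _ x) t = Quotient.mk _ y → F.leafDim (x : M) = F.leafDim (y : M)
  isometry : ∀ p q, ∀ t ∈ J, F.leafEDist S r (φ p t) (φ q t) = F.leafEDist S r p q

/-- The derivative `Ȳ · h` of a function `h` on `B/F` along the flow `φ`. -/
def SRF.flowDeriv (F : SRF n M) (S : Set M) (r : ℝ)
    (φ : F.LeafSpace S r → ℝ → F.LeafSpace S r) (h : F.LeafSpace S r → ℝ) :
    F.LeafSpace S r → ℝ :=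
  fun p => deriv (fun z : ℝ => h (φ p z)) 0

/-! ### The blow-up of `B` along `S` -/

/-- The set `{(t, ξ) | ξ ∈ νS, ‖ξ‖ = 1, |t| < r}`, an embedded submanifold of `ℝ × TM`. -/
def polarDomain (S : Set M) (r : ℝ) : Set (ℝ × TangentBundle (𝓡 n) M) :=
  {d | |d.1| < r ∧ d.2 ∈ normalBundle S ∧ ‖d.2.2‖ = 1}

variable (n) in
/-- The blow-up `{(x, [ξ]) ∈ B × ℙ(νS) | x = exp(tξ) for some |t| < r}`, where `ξ` is a unit
vector; `line` is the line `[ξ]` in the tangent space at its foot point `base`. -/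
@[ext] structure BlowUp (S : Set M) (r : ℝ) where
  /-- The point of `B`. -/
  point : M
  /-- The foot point of the line. -/
  base : M
  /-- The line. -/
  line : Projectivization ℝ (TangentSpace (𝓡 n) base)
  /-- The line is normal to `S` and the point is the image under the normal exponential map of a
  vector in it of length `< r`. -/
  mem : ∃ (t : ℝ) (w : TangentSpace (𝓡 n) base) (hw : w ≠ 0),
    (t, (⟨base, w⟩ : TangentBundle (𝓡 n) M)) ∈ polarDomain S r ∧
    line = Projectivization.mk ℝ w hw ∧ point = exp (scale t (⟨base, w⟩ : TangentBundle (𝓡 n) M))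

theorem ne_zero_of_mem_polarDomain {S : Set M} {r : ℝ} {d : ℝ × TangentBundle (𝓡 n) M}
    (hd : d ∈ polarDomain S r) : d.2.2 ≠ 0 := by
  intro h
  have h1 : ‖d.2.2‖ = 1 := hd.2.2
  rw [h, norm_zero] at h1
  exact zero_ne_one h1

/-- The map `(t, ξ) ↦ (exp(tξ), [ξ])`: the two-fold covering of the blow-up by `polarDomain`, with
deck transformation `(t, ξ) ↦ (-t, -ξ)`. It is a local diffeomorphism, so it determines the topology
and the smooth structure of the blow-up. -/
def polar {S : Set M} {r : ℝ} (d : polarDomain (n := n) S r) : BlowUp n S r where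
  point := exp (scale d.1.1 d.1.2)
  base := d.1.2.proj
  line := Projectivization.mk ℝ d.1.2.2 (ne_zero_of_mem_polarDomain d.2)
  mem := ⟨d.1.1, d.1.2.2, ne_zero_of_mem_polarDomain d.2, d.2, rfl, rfl⟩

instance (S : Set M) (r : ℝ) : TopologicalSpace (BlowUp n S r) :=
  TopologicalSpace.coinduced polar inferInstance

/-- `u` and `w` are unit vectors spanning the lines of `a` and `b`, respectively, and the points
`exp(su)` and `exp(sw)` are in the same leaf for all `|s| < r`. -/
def SRF.AlignedUnits (F : SRF n M) {S : Set M} {r : ℝ} (a b : BlowUp n S r)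
    (u : TangentSpace (𝓡 n) a.base) (w : TangentSpace (𝓡 n) b.base) : Prop :=
  ‖u‖ = 1 ∧ ‖w‖ = 1 ∧ u ∈ a.line.submodule ∧ w ∈ b.line.submodule ∧
  ∀ s : ℝ, |s| < r → F.leafRel (exp (scale s (⟨a.base, u⟩ : TangentBundle (𝓡 n) M)))
    (exp (scale s (⟨b.base, w⟩ : TangentBundle (𝓡 n) M)))

theorem eq_or_eq_neg_of_line {q : M} (l : Projectivization ℝ (TangentSpace (𝓡 n) q))
    {u w : TangentSpace (𝓡 n) q} (hu : u ∈ l.submodule) (hw : w ∈ l.submodule)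
    (hu1 : ‖u‖ = 1) (hw1 : ‖w‖ = 1) : w = u ∨ w = -u := by
  rw [Projectivization.submodule_eq, Submodule.mem_span_singleton] at hu hw
  obtain ⟨a, rfl⟩ := hu
  obtain ⟨b, rfl⟩ := hw
  rw [norm_smul, Real.norm_eq_abs] at hu1 hw1
  have hr : ‖l.rep‖ ≠ 0 := norm_ne_zero_iff.2 l.rep_nonzero
  have hab : |b| = |a| := mul_right_cancel₀ hr (hw1.trans hu1.symm)
  rcases abs_eq_abs.1 hab with h | h
  · left; rw [h]
  · right; rw [h, neg_smul]

theorem scale_neg_vec (s : ℝ) (q : M) (w : TangentSpace (𝓡 n) q) :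
    scale s (⟨q, -w⟩ : TangentBundle (𝓡 n) M) = scale (-s) ⟨q, w⟩ := by
  simp [scale]

/-- Two points of the blow-up are in the same leaf of the lifted foliation. Off the exceptional
divisor, the leaves are the preimages of the leaves of `F`. On the exceptional divisor `ℙ(νS)`, the
lines `[u]` and `[w]` are in the same leaf if, for a suitable choice of unit vectors `u`, `w`
in them, `exp(su)` and `exp(sw)` are in the same leaf of `F` for all `|s| < r`. -/
def SRF.SameHatLeaf (F : SRF n M) {S : Set M} {r : ℝ} (a b : BlowUp n S r) : Prop :=
  F.leafRel a.point b.point ∧ (a.point ∈ S ↔ b.point ∈ S) ∧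
    (a.point ∈ S → ∃ u w, F.AlignedUnits a b u w)

/-- The lifted foliation of the blow-up. -/
def SRF.hatSetoid (F : SRF n M) (S : Set M) (r : ℝ) : Setoid (BlowUp n S r) where
  r := F.SameHatLeaf
  iseqv := by
    refine ⟨fun a => ⟨F.leafRel.refl _, Iff.rfl, fun _ => ?_⟩, ?_, ?_⟩
    · obtain ⟨t, w, hw, hd, hl, -⟩ := a.mem
      have h1 : w ∈ a.line.submodule := by
        rw [hl, Projectivization.submodule_mk]
        exact Submodule.mem_span_singleton_self w
      exact ⟨w, w, hd.2.2, hd.2.2, h1, h1, fun s _ => F.leafRel.refl _⟩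
    · rintro a b ⟨h1, h2, h3⟩
      refine ⟨F.leafRel.symm h1, h2.symm, fun hb => ?_⟩
      obtain ⟨u, w, hu, hw, hua, hwb, h⟩ := h3 (h2.2 hb)
      exact ⟨w, u, hw, hu, hwb, hua, fun s hs => F.leafRel.symm (h s hs)⟩
    · rintro a b c ⟨h1, h2, h3⟩ ⟨k1, k2, k3⟩
      refine ⟨F.leafRel.trans h1 k1, h2.trans k2, fun ha => ?_⟩
      obtain ⟨u, w, hu, hw, hua, hwb, h⟩ := h3 ha
      obtain ⟨w', v, hw', hv, hwb', hvc, k⟩ := k3 (h2.1 ha)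
      rcases eq_or_eq_neg_of_line b.line hwb hwb' hw hw' with e | e
      · subst e
        exact ⟨u, v, hu, hv, hua, hvc, fun s hs => F.leafRel.trans (h s hs) (k s hs)⟩
      · subst e
        refine ⟨u, -v, hu, by rw [norm_neg]; exact hv, hua, neg_mem hvc, fun s hs => ?_⟩
        have h4 := k (-s) (by rwa [abs_neg])
        rw [scale_neg_vec, neg_neg] at h4
        rw [scale_neg_vec]
        exact F.leafRel.trans (h s hs) h4

/-- The leaf space of the blow-up, with the quotient topology. A function on it is the same as a
basic function on the blow-up. -/
abbrev SRF.HatLeafSpace (F : SRF n M) (S : Set M) (r : ℝ) : Type u :=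
  Quotient (F.hatSetoid S r)

theorem scale_mem_normalBundle {S : Set M} {v : TangentBundle (𝓡 n) M}
    (hv : v ∈ normalBundle S) (t : ℝ) : scale t v ∈ normalBundle S := by
  refine ⟨hv.1, fun c hc hS w hw => ?_⟩
  obtain ⟨q, x⟩ := v
  have hq : c 0 = q := congrArg TotalSpace.proj hw
  subst hq
  have hx : w = t • x := by
    simpa [scale] using hw
  subst hx
  have h := hv.2 c hc hS x rfl
  rw [inner_smul_right, h, mul_zero]

/-- The blow-up map `(x, [ξ]) ↦ x` to the tube `B`. -/
def blowDown {S : Set M} {r : ℝ} (hr : IsTubularRadius n S r) (a : BlowUp n S r) :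
    Metric.thickening r S :=
  ⟨a.point, by
    obtain ⟨t, w, hw, hd, -, hp⟩ := a.mem
    rw [hp]
    refine hr.mapsTo _ (scale_mem_normalBundle hd.2.1 t) ?_
    have h1 : ‖w‖ = 1 := hd.2.2
    change ‖t • w‖ < r
    rw [norm_smul, h1, mul_one, Real.norm_eq_abs]
    exact hd.1⟩

/-- The map between leaf spaces induced by the blow-up map. -/
def SRF.leafBlowDown (F : SRF n M) {S : Set M} {r : ℝ} (hr : IsTubularRadius n S r) :
    F.HatLeafSpace S r → F.LeafSpace S r :=
  Quotient.map (blowDown hr) fun _ _ h => h.1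

/-- The basic function on the blow-up given by a function on its leaf space, in the coordinates
`(t, ξ)` of `polarDomain` (extended by `0` to all of `ℝ × TM`). -/
def SRF.polarFun (F : SRF n M) (S : Set M) (r : ℝ) (f : F.HatLeafSpace S r → ℝ) :
    ℝ × TangentBundle (𝓡 n) M → ℝ :=
  Function.extend Subtype.val
    (fun d : polarDomain (n := n) S r => f (Quotient.mk _ (polar d))) 0

/-- `f` is a smooth basic function on the blow-up. -/
def SRF.IsHatSmooth (F : SRF n M) (S : Set M) (r : ℝ) (f : F.HatLeafSpace S r → ℝ) : Prop :=
  ContMDiffOn (𝓘(ℝ, ℝ).prod (𝓡 n).tangent) 𝓘(ℝ, ℝ) ∞ (F.polarFun S r f) (polarDomain S r)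

/-- `ψ` is a lift of the flow `φ` to the leaf space of the blow-up. (As the blow-up map is bijective
off the exceptional divisor, whose complement is dense, there is at most one lift.) -/
structure SRF.IsLift (F : SRF n M) {S : Set M} {r : ℝ} (hr : IsTubularRadius n S r) (J : Set ℝ)
    (φ : F.LeafSpace S r → ℝ → F.LeafSpace S r)
    (ψ : F.HatLeafSpace S r → ℝ → F.HatLeafSpace S r) : Prop where
  localGroup : IsLocalGroup J ψ
  equivariant : ∀ a, ∀ t ∈ J, F.leafBlowDown hr (ψ a t) = φ (F.leafBlowDown hr a) t

/-- The flow `ψ` on the leaf space of the blow-up is smooth: for each smooth basic function `f` on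
the blow-up, `f (ψ a t)` is a smooth function of `(a, t)`. -/
def SRF.IsHatSmoothFlow (F : SRF n M) (S : Set M) (r : ℝ) (J : Set ℝ)
    (ψ : F.HatLeafSpace S r → ℝ → F.HatLeafSpace S r) : Prop :=
  ∀ f : F.HatLeafSpace S r → ℝ, F.IsHatSmooth S r f →
    ContMDiffOn ((𝓘(ℝ, ℝ).prod (𝓡 n).tangent).prod 𝓘(ℝ, ℝ)) 𝓘(ℝ, ℝ) ∞
      (fun z : (ℝ × TangentBundle (𝓡 n) M) × ℝ => F.polarFun S r (fun a => f (ψ a z.2)) z.1)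
      (polarDomain S r ×ˢ J)

/-! ### Blow-up functions -/

/-- `h`, a continuous basic function on the tube `B`, is a blow-up function. -/
structure SRF.IsBlowUpFunction (F : SRF n M) {S : Set M} {r : ℝ} (hr : IsTubularRadius n S r)
    (h : F.LeafSpace S r → ℝ) : Prop where
  continuous : Continuous h
  /-- The pullback of `h` to the blow-up is smooth. -/
  smooth_lift : F.IsHatSmooth S r (fun a => h (F.leafBlowDown hr a))
  /-- The restriction of `h` to `S` is smooth. -/
  smooth_stratum : ContMDiffOn (𝓡 n) 𝓘(ℝ, ℝ) ∞ (F.basicFun S r h) S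
  /-- The restriction of `h` to `B - S` is smooth. -/
  smooth_compl : ContMDiffOn (𝓡 n) 𝓘(ℝ, ℝ) ∞ (F.basicFun S r h) (Metric.thickening r S \ S)
  /-- The derivative of `h` in the direction of each vector normal to `S` exists and vanishes. -/
  normal_deriv : ∀ v ∈ normalBundle (n := n) S,
    HasDerivAt (fun t : ℝ => F.basicFun S r h (exp (scale t v))) 0 0

end Riemannian

end SingularFoliation

end

/-! Everything is read on the blow-up, in the polar coordinates (t, ξ) with blow-up map (t, ξ) ↦
exp(tξ). The function (a, z) ↦ h(ρ̂(ψ_z a)) is smooth, so its z-derivative at 0 is smooth on the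
blow-up; since ψ lifts φ, this derivative is the lift of Ȳ·h. The blow-up map is onto, so Ȳ·h exists
everywhere, and its lift, also after composition with φ_s, is smooth (`SRF.IsLift.differentiableAt`,
`SRF.IsLift.isHatSmooth_flowDeriv`, `SRF.IsLift.isHatSmooth_comp`).

A smooth lift alone forces continuity and condition (b). The blow-up map has smooth sections off S
(polar coordinates) and, locally, over S (a field of unit normal vectors, at t = 0); continuity at S
from outside follows from the compactness of the set of unit normal vectors at a point
(`SRF.isBlowUpFunction_of_lift`).

The heart is condition (c), which rests on two facts. (1) If k has a smooth lift and vanishing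
normal derivatives, so has k ∘ φ_s (`SRF.IsIsometricFlow.normal_deriv_comp`). Indeed φ_s carries
exp(tξ), ξ normal at p ∈ S, to the leaf of some exp(tη) with η normal at a point q of the leaf
φ_s(p). The vector η may vary with t, but by the mean value theorem and compactness |k(exp(tη)) -
k(q)| ≤ εt for small t, uniformly in η (`SRF.eventually_abs_sub_le`). (2) For a unit normal ξ the
function U(t, z) = h(φ_z(exp(tξ))) is smooth, and (1) gives ∂_t U(0, z) = 0 for all small z. By
symmetry of second derivatives ∂_t ∂_z U(0, 0) = ∂_z ∂_t U(0, 0) = 0, so Ȳ·h has vanishing normal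
derivatives (`SRF.IsLift.normal_deriv_flowDeriv`). Applying (1) again, to Ȳ·h, finishes the proof.

That φ_s respects S and the normal rays comes from metric geometry. Transnormality and the first
variation formula make leaves equidistant (`SRF.infDist_leaf_eq`), so quotient distances can be
measured from any chosen point of a leaf. If φ_z moved a point of S off S, a normal ray running from
the image to the boundary of the tube would pull back to a Cauchy sequence converging inside the
tube, which is absurd (`SRF.IsIsometricFlow.mem_stratum`). Hence the distance to S is preserved, and
a leaf at distance t both from q and from S is reached from q by a normal geodesic
(`SRF.IsIsometricFlow.exists_ray`).

The Riemannian geometry is derived from the geodesic equation in charts: uniqueness, geodesic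
completeness, the Gauss lemma, minimizing geodesics to closed sets and first variation. The Gauss
lemma and first variation both rest on one second order estimate for the energy g(v, v)
(`LocalMetric.abs_energy_sub_le`), so the exponential map is never differentiated in its initial
velocity. -/

/-! ### Riemannian metrics on open subsets of a vector space -/

/-- A smooth Riemannian metric on an open subset of a vector space. -/
structure LocalMetric (E : Type*) [NormedAddCommGroup E] [NormedSpace ℝ E] where
  /-- The coefficients of the metric. -/
  coeff : E → E →L[ℝ] E →L[ℝ] ℝ
  /-- The domain. -/
  dom : Set E
  isOpen_dom : IsOpen dom
  contDiffOn : ContDiffOn ℝ ∞ coeff dom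
  symm : ∀ y ∈ dom, ∀ a b, coeff y a b = coeff y b a
  pos : ∀ y ∈ dom, ∀ a, a ≠ 0 → 0 < coeff y a a

namespace LocalMetric

set_option maxSynthPendingDepth 3

variable {E : Type*} [NormedAddCommGroup E] [NormedSpace ℝ E] (g : LocalMetric E)

/-- The covector that drives the geodesic equation. -/
noncomputable def force (y v : E) : E →L[ℝ] ℝ :=
  (1 / 2 : ℝ) • (((fderiv ℝ g.coeff y).flip v).flip v) - fderiv ℝ g.coeff y v v

/-- The acceleration of the geodesic at `y` with velocity `v`. -/
noncomputable def acc (y v : E) : E := (g.coeff y).inverse (g.force y v)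

/-- The geodesic vector field. -/
noncomputable def spray (z : E × E) : E × E := (z.2, g.acc z.1 z.2)

/-- `(c, v)` solves the first order geodesic system at time `t`. -/
structure IsSolAt (c v : ℝ → E) (t : ℝ) : Prop where
  mem : c t ∈ g.dom
  pos_deriv : HasDerivAt c (v t) t
  vel_deriv : HasDerivAt v (g.acc (c t) (v t)) t

variable {g}

theorem nonneg {y : E} (hy : y ∈ g.dom) (a : E) : 0 ≤ g.coeff y a a := by
  by_cases h : a = 0
  · simp [h]
  · exact (g.pos y hy a h).le

theorem differentiableAt {y : E} (hy : y ∈ g.dom) : DifferentiableAt ℝ g.coeff y :=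
  ((g.contDiffOn.contDiffAt (g.isOpen_dom.mem_nhds hy)).differentiableAt (by simp))

theorem hasDerivAt_coeff {c v ζ : ℝ → E} {t : ℝ} {c' v' ζ' : E} (hc : c t ∈ g.dom)
    (h1 : HasDerivAt c c' t) (h2 : HasDerivAt v v' t) (h3 : HasDerivAt ζ ζ' t) :
    HasDerivAt (fun τ => g.coeff (c τ) (v τ) (ζ τ))
      (fderiv ℝ g.coeff (c t) c' (v t) (ζ t) + g.coeff (c t) v' (ζ t) + g.coeff (c t) (v t) ζ') t := by
  have h4 : HasDerivAt (fun τ => g.coeff (c τ)) (fderiv ℝ g.coeff (c t) c') t :=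
    (differentiableAt hc).hasFDerivAt.comp_hasDerivAt t h1
  have h5 := (h4.clm_apply h2).clm_apply h3
  simpa using h5

theorem fderiv_quadratic {y : E} (hy : y ∈ g.dom) (v w : E) :
    fderiv ℝ (fun z => g.coeff z v v) y w = fderiv ℝ g.coeff y w v v := by
  have := ((differentiableAt hy).hasFDerivAt.clm_apply (hasFDerivAt_const v y)).clm_apply
      (hasFDerivAt_const v y)
  rw [this.fderiv]; simp

/-! ### Solutions of the geodesic equation, Gauss lemma and first variation in coordinates. -/

section FiniteDimensional

variable [FiniteDimensional ℝ E]

/-- Positive definiteness makes the map to the dual space injective, and the dimensions agree. -/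
theorem isInvertible {y : E} (hy : y ∈ g.dom) : (g.coeff y).IsInvertible := by
  have hinj : Function.Injective (g.coeff y : E →ₗ[ℝ] (E →L[ℝ] ℝ)) := by
    rw [← LinearMap.ker_eq_bot, LinearMap.ker_eq_bot']
    intro a ha
    by_contra h
    have := g.pos y hy a h
    have h2 : g.coeff y a = 0 := ha
    rw [h2] at this
    simp at this
  have hdim : Module.finrank ℝ E = Module.finrank ℝ (E →L[ℝ] ℝ) := by
    rw [← (LinearMap.toContinuousLinearMap (𝕜 := ℝ) (E := E) (F' := ℝ)).finrank_eq]
    exact (Subspace.dual_finrank_eq (K := ℝ) (V := E)).symm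
  refine ⟨(LinearEquiv.ofInjectiveOfFinrankEq _ hinj hdim).toContinuousLinearEquiv, ?_⟩
  ext a b
  rfl

theorem coeff_inverse {y : E} (hy : y ∈ g.dom) (α : E →L[ℝ] ℝ) :
    g.coeff y ((g.coeff y).inverse α) = α := by
  obtain ⟨e, he⟩ := isInvertible hy
  rw [← he, ContinuousLinearMap.inverse_equiv]
  simp

theorem contDiffAt_inverse {y : E} (hy : y ∈ g.dom) :
    ContDiffAt ℝ ∞ (fun z => (g.coeff z).inverse) y := by
  obtain ⟨e, he⟩ := isInvertible hy
  have h := contDiffAt_map_inverse (𝕜 := ℝ) (n := ∞) e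
  rw [he] at h
  exact h.comp y (g.contDiffOn.contDiffAt (g.isOpen_dom.mem_nhds hy))

/-- Pairing with `w` removes the inverse of the metric: this is the Euler-Lagrange form, and later
computations use only it, never Christoffel symbols. -/
theorem coeff_acc {y : E} (hy : y ∈ g.dom) (v w : E) :
    g.coeff y (g.acc y v) w =
      1 / 2 * fderiv ℝ g.coeff y w v v - fderiv ℝ g.coeff y v v w := by
  rw [acc, coeff_inverse hy]
  simp [force]

theorem eq_of_coeff_eq {y : E} (hy : y ∈ g.dom) {a b : E}
    (h : ∀ w, g.coeff y a w = g.coeff y b w) : a = b := by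
  by_contra hab
  have := g.pos y hy (a - b) (sub_ne_zero.2 hab)
  simp [h] at this

/-- The acceleration is quadratic in the velocity; this is what makes affine reparametrizations of
solutions solutions. -/
theorem acc_smul {y : E} (hy : y ∈ g.dom) (s : ℝ) (v : E) :
    g.acc y (s • v) = s ^ 2 • g.acc y v := by
  apply eq_of_coeff_eq hy
  intro w
  simp only [coeff_acc hy, map_smul, smul_apply, smul_eq_mul]
  ring

theorem contDiffOn_spray : ContDiffOn ℝ ∞ g.spray (g.dom ×ˢ univ) := by
  rintro ⟨y, v⟩ ⟨hy, -⟩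
  apply ContDiffAt.contDiffWithinAt
  refine contDiffAt_snd.prodMk ?_
  have h1 : ContDiffAt ℝ ∞ (fun z : E × E => (g.coeff z.1).inverse) (y, v) :=
    (contDiffAt_inverse hy).comp (y, v) contDiffAt_fst
  refine h1.clm_apply ?_
  have h2 : ContDiffAt ℝ ∞ (fderiv ℝ g.coeff) y :=
    (g.contDiffOn.contDiffAt (g.isOpen_dom.mem_nhds hy)).fderiv_right (by simp)
  have h3 : ContDiffAt ℝ ∞ (fun z : E × E => fderiv ℝ g.coeff z.1) (y, v) :=
    h2.comp (y, v) contDiffAt_fst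
  have h4 : ContDiffAt ℝ ∞ (fun z : E × E => (fderiv ℝ g.coeff z.1).flip) (y, v) :=
    (ContinuousLinearMap.flipₗᵢ ℝ E E (E →L[ℝ] ℝ)).contDiff.contDiffAt.comp (y, v) h3
  have h5 := h4.clm_apply contDiffAt_snd
  have h6 : ContDiffAt ℝ ∞ (fun z : E × E => ((fderiv ℝ g.coeff z.1).flip z.2).flip) (y, v) :=
    (ContinuousLinearMap.flipₗᵢ ℝ E E ℝ).contDiff.contDiffAt.comp (y, v) h5
  exact ((h6.clm_apply contDiffAt_snd).const_smul _).sub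
    ((h3.clm_apply contDiffAt_snd).clm_apply contDiffAt_snd)

/-- First variation: derivative of the momentum paired with a vector field along a solution. -/
theorem IsSolAt.hasDerivAt_coeff {c v ζ : ℝ → E} {t : ℝ} {ζ' : E} (h : g.IsSolAt c v t)
    (hζ : HasDerivAt ζ ζ' t) :
    HasDerivAt (fun τ => g.coeff (c τ) (v τ) (ζ τ))
      (1 / 2 * fderiv ℝ g.coeff (c t) (ζ t) (v t) (v t) + g.coeff (c t) (v t) ζ') t := by
  convert LocalMetric.hasDerivAt_coeff h.mem h.pos_deriv h.vel_deriv hζ using 1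
  rw [coeff_acc h.mem]
  ring

/-- First variation with the field `v` itself: its two terms are opposite by `coeff_acc`. -/
theorem IsSolAt.hasDerivAt_energy {c v : ℝ → E} {t : ℝ} (h : g.IsSolAt c v t) :
    HasDerivAt (fun τ => g.coeff (c τ) (v τ) (v τ)) 0 t := by
  convert h.hasDerivAt_coeff h.vel_deriv using 1
  rw [g.symm _ h.mem, coeff_acc h.mem]
  ring

theorem IsSolAt.affine {c v : ℝ → E} {t a b : ℝ} (h : g.IsSolAt c v (a * t + b)) :
    g.IsSolAt (fun τ => c (a * τ + b)) (fun τ => a • v (a * τ + b)) t where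
  mem := h.mem
  pos_deriv := by
    have h1 : HasDerivAt (fun τ : ℝ => a * τ + b) a t := by
      simpa using ((hasDerivAt_id t).const_mul a).add_const b
    exact h.pos_deriv.scomp t h1
  vel_deriv := by
    have h1 : HasDerivAt (fun τ : ℝ => a * τ + b) a t := by
      simpa using ((hasDerivAt_id t).const_mul a).add_const b
    rw [acc_smul h.mem, pow_two, ← smul_smul]
    exact (h.vel_deriv.scomp t h1).const_smul a

theorem IsSolAt.hasDerivAt_prod {c v : ℝ → E} {t : ℝ} (h : g.IsSolAt c v t) :
    HasDerivAt (fun τ => (c τ, v τ)) (g.spray (c t, v t)) t :=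
  h.pos_deriv.prodMk h.vel_deriv

theorem eventuallyEq_of_isSolAt {c₁ v₁ c₂ v₂ : ℝ → E} {t : ℝ}
    (h₁ : ∀ᶠ τ in 𝓝 t, g.IsSolAt c₁ v₁ τ) (h₂ : ∀ᶠ τ in 𝓝 t, g.IsSolAt c₂ v₂ τ)
    (hc : c₁ t = c₂ t) (hv : v₁ t = v₂ t) : c₁ =ᶠ[𝓝 t] c₂ := by
  have hmem : (c₁ t, v₁ t) ∈ g.dom ×ˢ (univ : Set E) := ⟨h₁.self_of_nhds.mem, trivial⟩
  have hcd : ContDiffAt ℝ 1 g.spray (c₁ t, v₁ t) :=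
    (contDiffOn_spray.contDiffAt ((g.isOpen_dom.prod isOpen_univ).mem_nhds hmem)).of_le (by simp)
  obtain ⟨K, s, hs, hK⟩ := hcd.exists_lipschitzOnWith
  have e1 : ∀ᶠ τ in 𝓝 t, (c₁ τ, v₁ τ) ∈ s :=
    h₁.self_of_nhds.hasDerivAt_prod.continuousAt.eventually hs
  have e2 : ∀ᶠ τ in 𝓝 t, (c₂ τ, v₂ τ) ∈ s := by
    rw [hc, hv] at hs
    exact h₂.self_of_nhds.hasDerivAt_prod.continuousAt.eventually hs
  have := ODE_solution_unique_of_eventually (v := fun _ => g.spray) (s := fun _ => s) (t₀ := t)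
    (f := fun τ => (c₁ τ, v₁ τ)) (g := fun τ => (c₂ τ, v₂ τ))
    (Filter.Eventually.of_forall fun _ => hK)
    (by filter_upwards [h₁, e1] with τ a b using ⟨a.hasDerivAt_prod, b⟩)
    (by filter_upwards [h₂, e2] with τ a b using ⟨a.hasDerivAt_prod, b⟩) (by simp [hc, hv])
  filter_upwards [this] with τ hτ using congrArg Prod.fst hτ

/-- Local existence of solutions, with uniform time, inside a given neighbourhood. -/
theorem exists_sol {z₀ : E × E} (hz : z₀.1 ∈ g.dom) {V : Set (E × E)} (hV : V ∈ 𝓝 z₀) :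
    ∃ ρ > 0, ∃ T > 0, ∃ c v : E × E → ℝ → E, ∀ z ∈ Metric.closedBall z₀ ρ,
      c z 0 = z.1 ∧ v z 0 = z.2 ∧
      ∀ t ∈ Ioo (-T) T, g.IsSolAt (c z) (v z) t ∧ (c z t, v z t) ∈ V := by
  have hopen : g.dom ×ˢ (univ : Set E) ∈ 𝓝 z₀ :=
    (g.isOpen_dom.prod isOpen_univ).mem_nhds ⟨hz, trivial⟩
  have hcd : ContDiffAt ℝ 1 g.spray z₀ := (contDiffOn_spray.contDiffAt hopen).of_le (by simp)
  obtain ⟨ε, hε, a, r, L, K, hr, hpl⟩ := IsPicardLindelof.of_contDiffAt_one hcd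
  obtain ⟨α, hα1, hα2⟩ :=
    (hpl 0).exists_forall_mem_closedBall_eq_hasDerivWithinAt_continuousOn
  have hz0 : z₀ ∈ Metric.closedBall z₀ (r : ℝ) := Metric.mem_closedBall_self hr.le
  -- Joint continuity of the local flow at the initial point keeps all nearby solutions in `V` and
  -- in the domain for a common time.
  have hcont : ContinuousAt α (z₀, (0 : ℝ)) := by
    refine hα2.continuousAt ?_
    refine prod_mem_nhds (Metric.closedBall_mem_nhds _ hr) (Icc_mem_nhds ?_ ?_) <;> simp [hε]
  have hev : ∀ᶠ p in 𝓝 (z₀, (0 : ℝ)), α p ∈ V ∩ g.dom ×ˢ (univ : Set E) := by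
    apply hcont.eventually
    rw [(hα1 z₀ hz0).1]
    exact Filter.inter_mem hV hopen
  obtain ⟨δ, hδ, hball⟩ := Metric.eventually_nhds_iff.1 hev
  refine ⟨min (δ / 2) r, by positivity, min δ ε, by positivity, fun z t => (α (z, t)).1,
    fun z t => (α (z, t)).2, fun z hzm => ?_⟩
  have hzr : z ∈ Metric.closedBall z₀ (r : ℝ) :=
    Metric.closedBall_subset_closedBall (min_le_right _ _) hzm
  have hz1 : α (z, 0) = z := (hα1 z hzr).1
  refine ⟨congrArg Prod.fst hz1, congrArg Prod.snd hz1, fun t ht => ?_⟩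
  have htδ : |t| < δ := abs_lt.2 ⟨by linarith [ht.1, min_le_left δ ε], ht.2.trans_le (min_le_left _ _)⟩
  have htε : t ∈ Ioo (0 - ε) (0 + ε) :=
    ⟨by linarith [ht.1, min_le_right δ ε], by linarith [ht.2, min_le_right δ ε]⟩
  have hm : α (z, t) ∈ V ∩ g.dom ×ˢ (univ : Set E) := by
    apply hball
    rw [Prod.dist_eq]
    refine max_lt ?_ (by simpa [Real.dist_eq] using htδ)
    have : dist z z₀ ≤ δ / 2 := (Metric.mem_closedBall.1 hzm).trans (min_le_left _ _)
    exact this.trans_lt (by linarith)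
  have hd : HasDerivAt (fun τ => α (z, τ)) (g.spray (α (z, t))) t :=
    ((hα1 z hzr).2 t (Ioo_subset_Icc_self htε)).hasDerivAt (Icc_mem_nhds htε.1 htε.2)
  exact ⟨⟨hm.2.1, hd.fst, hd.snd⟩, hm.1⟩

theorem contDiffAt_of_isSolAt {c v : ℝ → E} {t : ℝ} (h : ∀ᶠ τ in 𝓝 t, g.IsSolAt c v τ) :
    ContDiffAt ℝ ∞ c t := by
  obtain ⟨ε, hε, hb⟩ := Metric.eventually_nhds_iff.1 h
  have hI : ∀ τ ∈ Icc (t - ε / 2) (t + ε / 2), g.IsSolAt c v τ := fun τ hτ => by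
    apply hb
    rw [Real.dist_eq, abs_lt]
    constructor <;> linarith [hτ.1, hτ.2]
  have := ODE.contDiffOn_enat_Icc_of_hasDerivWithinAt (n := ⊤) (f := fun _ => g.spray)
    (α := fun τ => (c τ, v τ)) (u := g.dom ×ˢ univ) (tmin := t - ε / 2) (tmax := t + ε / 2)
    (contDiffOn_spray.comp contDiffOn_snd (fun z hz => hz.2))
    (fun τ hτ => (hI τ hτ).hasDerivAt_prod.hasDerivWithinAt) (fun τ hτ => ⟨(hI τ hτ).mem, trivial⟩)
  have h2 := this.contDiffAt (Icc_mem_nhds (by linarith) (by linarith) : _ ∈ 𝓝 t)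
  exact contDiffAt_fst.comp t h2

/-- Second order Taylor estimate of the energy g_y(v, v) with a locally uniform constant: its
derivative is locally Lipschitz. For increments (ζ, ζ') along a solution the linear term is twice
the derivative of g(v, ζ) given by the first variation, and this match drives both the Gauss lemma
and the variation of length. -/
theorem abs_energy_sub_le {z₀ : E × E} (hz : z₀.1 ∈ g.dom) :
    ∃ V ∈ 𝓝 z₀, ∃ C, 0 ≤ C ∧ ∀ a ∈ V, ∀ b ∈ V,
      |g.coeff b.1 b.2 b.2 - g.coeff a.1 a.2 a.2 - (fderiv ℝ g.coeff a.1 (b.1 - a.1) a.2 a.2 +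
        2 * g.coeff a.1 a.2 (b.2 - a.2))| ≤ C * ‖b - a‖ ^ 2 := by
  set N : E × E → ℝ := fun z => g.coeff z.1 z.2 z.2 with hN
  have hopen : IsOpen (g.dom ×ˢ (univ : Set E)) := g.isOpen_dom.prod isOpen_univ
  have hsm : ∀ z ∈ g.dom ×ˢ (univ : Set E), ContDiffAt ℝ ∞ N z := fun z hz => by
    have h1 : ContDiffAt ℝ ∞ (fun z : E × E => g.coeff z.1) z :=
      (g.contDiffOn.contDiffAt (g.isOpen_dom.mem_nhds hz.1)).comp z contDiffAt_fst
    exact (h1.clm_apply contDiffAt_snd).clm_apply contDiffAt_snd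
  have hfd : ∀ z ∈ g.dom ×ˢ (univ : Set E), ∀ δ : E × E, fderiv ℝ N z δ =
      fderiv ℝ g.coeff z.1 δ.1 z.2 z.2 + 2 * g.coeff z.1 z.2 δ.2 := fun z hz δ => by
    have h1 : HasFDerivAt (fun z : E × E => g.coeff z.1)
        ((fderiv ℝ g.coeff z.1).comp (ContinuousLinearMap.fst ℝ E E)) z :=
      (differentiableAt hz.1).hasFDerivAt.comp z hasFDerivAt_fst
    have h2 := (h1.clm_apply hasFDerivAt_snd).clm_apply hasFDerivAt_snd
    rw [h2.fderiv]
    simp [g.symm _ hz.1 δ.2]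
    ring
  have hmem : z₀ ∈ g.dom ×ˢ (univ : Set E) := ⟨hz, trivial⟩
  obtain ⟨K, s, hs, hK⟩ :=
    (((hsm z₀ hmem).fderiv_right (m := ∞) (by simp)).of_le (by simp)).exists_lipschitzOnWith
  obtain ⟨ε, hε, hball⟩ := Metric.mem_nhds_iff.1 (Filter.inter_mem hs (hopen.mem_nhds hmem))
  refine ⟨Metric.ball z₀ ε, Metric.ball_mem_nhds _ hε, K, K.2, fun a ha b hb => ?_⟩
  have hseg : segment ℝ a b ⊆ Metric.ball z₀ ε := (convex_ball z₀ ε).segment_subset ha hb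
  have := (convex_segment a b).norm_image_sub_le_of_norm_fderiv_le' (𝕜 := ℝ) (f := N)
    (φ := fderiv ℝ N a) (C := K * ‖b - a‖)
    (fun x hx => (hsm x (hball (hseg hx)).2).differentiableAt (by simp))
    (fun x hx => by
      have h1 := hK.dist_le_mul x (hball (hseg hx)).1 a (hball ha).1
      rw [dist_eq_norm, dist_eq_norm] at h1
      refine h1.trans ?_
      gcongr
      obtain ⟨θ, hθ, rfl⟩ := (segment_eq_image' ℝ a b ▸ hx : x ∈ (fun θ : ℝ => a + θ • (b - a)) '' Icc 0 1)
      rw [add_sub_cancel_left, norm_smul, Real.norm_eq_abs, abs_of_nonneg hθ.1]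
      exact mul_le_of_le_one_left (norm_nonneg _) hθ.2)
    (left_mem_segment ℝ a b) (right_mem_segment ℝ a b)
  rw [hfd a (hball ha).2] at this
  rw [← Real.norm_eq_abs, pow_two, ← mul_assoc]
  exact this

/-- The exponential map at a point in coordinates: the solutions starting at `y₀` at a time `T` at
which they depend on the initial velocity in an almost linear way. -/
theorem exists_exp {y₀ : E} (hy : y₀ ∈ g.dom) {V : Set (E × E)} (hV : V ∈ 𝓝 (y₀, (0 : E))) :
    ∃ ρ > 0, ∃ T > 0, ∃ c v : E → ℝ → E, ∃ C, 0 ≤ C ∧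
      (∀ w ∈ Metric.ball (0 : E) ρ, c w 0 = y₀ ∧ v w 0 = w ∧
        ∀ t ∈ Ioo (-(2 * T)) (2 * T), g.IsSolAt (c w) (v w) t ∧ (c w t, v w t) ∈ V) ∧
      (∀ w ∈ Metric.ball (0 : E) ρ, ∀ w' ∈ Metric.ball (0 : E) ρ, ∀ t ∈ Icc 0 T,
        ‖(c w' t, v w' t) - (c w t, v w t)‖ ≤ C * ‖w' - w‖) ∧
      ∀ w ∈ Metric.ball (0 : E) ρ, ∀ w' ∈ Metric.ball (0 : E) ρ,
        ‖c w' T - c w T - T • (w' - w)‖ ≤ T / 2 * ‖w' - w‖ := by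
  have hcd : ContDiffAt ℝ 1 g.spray (y₀, 0) :=
    (contDiffOn_spray.contDiffAt ((g.isOpen_dom.prod isOpen_univ).mem_nhds
      (⟨hy, trivial⟩ : (y₀, (0 : E)) ∈ g.dom ×ˢ (univ : Set E)))).of_le (by simp)
  obtain ⟨K, s, hs, hK⟩ := hcd.exists_lipschitzOnWith
  obtain ⟨ρ, hρ, T₀, hT₀, c, v, hcv⟩ :=
    g.exists_sol (z₀ := (y₀, 0)) hy (Filter.inter_mem hV hs)
  -- `T ≤ 1` bounds the Grönwall factor by exp K. The bound on `K * exp K * T` keeps the difference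
  -- of two velocities within half of `w' - w` of its initial value; integrated up to `T`, this is
  -- the last estimate.
  obtain ⟨T, hT, hT1, hT2, hT3⟩ : ∃ T > 0, T ≤ 1 ∧ 2 * T ≤ T₀ ∧ K * Real.exp K * T ≤ 1 / 2 := by
    have hA : 0 < 2 * (K * Real.exp K + 1) := by positivity
    refine ⟨min 1 (min (T₀ / 2) (1 / (2 * (K * Real.exp K + 1)))), by positivity,
      min_le_left _ _, ?_, ?_⟩
    · have := (min_le_right (1 : ℝ) (min (T₀ / 2) (1 / (2 * (K * Real.exp K + 1))))).trans
        (min_le_left _ _)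
      linarith
    · have h1 := (min_le_right (1 : ℝ) (min (T₀ / 2) (1 / (2 * (K * Real.exp K + 1))))).trans
        (min_le_right _ _)
      calc K * Real.exp K * _ ≤ K * Real.exp K * (1 / (2 * (K * Real.exp K + 1))) := by gcongr
        _ ≤ 1 / 2 := by
          rw [mul_one_div, div_le_div_iff₀ hA two_pos]
          linarith
  have hsol : ∀ w ∈ Metric.ball (0 : E) ρ, c (y₀, w) 0 = y₀ ∧ v (y₀, w) 0 = w ∧
      ∀ t ∈ Ioo (-(2 * T)) (2 * T), g.IsSolAt (c (y₀, w)) (v (y₀, w)) t ∧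
        (c (y₀, w) t, v (y₀, w) t) ∈ V ∩ s := fun w hw => by
    have hm : (y₀, w) ∈ Metric.closedBall (y₀, (0 : E)) ρ := by
      rw [Metric.mem_closedBall, Prod.dist_eq, dist_self]
      exact max_le hρ.le (Metric.mem_ball.1 hw).le
    obtain ⟨h1, h2, h3⟩ := hcv _ hm
    exact ⟨h1, h2, fun t ht => h3 t ⟨by linarith [ht.1], by linarith [ht.2]⟩⟩
  have hsub : ∀ t ∈ Icc 0 T, t ∈ Ioo (-(2 * T)) (2 * T) := fun t ht =>
    ⟨by linarith [ht.1], by linarith [ht.2]⟩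
  have hlip : ∀ w ∈ Metric.ball (0 : E) ρ, ∀ w' ∈ Metric.ball (0 : E) ρ, ∀ t ∈ Icc 0 T,
      ‖(c (y₀, w') t, v (y₀, w') t) - (c (y₀, w) t, v (y₀, w) t)‖ ≤
        Real.exp K * ‖w' - w‖ := fun w hw w' hw' t ht => by
    obtain ⟨a1, a2, a3⟩ := hsol w hw
    obtain ⟨b1, b2, b3⟩ := hsol w' hw'
    have := dist_le_of_trajectories_ODE_of_mem (v := fun _ => g.spray) (s := fun _ => s) (K := K)
      (f := fun τ => (c (y₀, w') τ, v (y₀, w') τ)) (g := fun τ => (c (y₀, w) τ, v (y₀, w) τ))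
      (a := 0) (b := T) (δ := ‖w' - w‖) (fun _ _ => hK)
      (fun τ hτ => (b3 τ (hsub τ hτ)).1.hasDerivAt_prod.continuousAt.continuousWithinAt)
      (fun τ hτ => (b3 τ (hsub τ (Ico_subset_Icc_self hτ))).1.hasDerivAt_prod.hasDerivWithinAt)
      (fun τ hτ => (b3 τ (hsub τ (Ico_subset_Icc_self hτ))).2.2)
      (fun τ hτ => (a3 τ (hsub τ hτ)).1.hasDerivAt_prod.continuousAt.continuousWithinAt)
      (fun τ hτ => (a3 τ (hsub τ (Ico_subset_Icc_self hτ))).1.hasDerivAt_prod.hasDerivWithinAt)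
      (fun τ hτ => (a3 τ (hsub τ (Ico_subset_Icc_self hτ))).2.2)
      (by simp [a1, a2, b1, b2, dist_eq_norm]) t ht
    rw [dist_eq_norm, mul_comm] at this
    refine this.trans ?_
    gcongr
    have : (K : ℝ) * (t - 0) ≤ K * 1 := by gcongr; linarith [ht.2]
    linarith
  refine ⟨ρ, hρ, T, hT, fun w => c (y₀, w), fun w => v (y₀, w), Real.exp K, (Real.exp_pos _).le,
    fun w hw => ⟨(hsol w hw).1, (hsol w hw).2.1, fun t ht =>
      ⟨((hsol w hw).2.2 t ht).1, ((hsol w hw).2.2 t ht).2.1⟩⟩, hlip, fun w hw w' hw' => ?_⟩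
  obtain ⟨a1, a2, a3⟩ := hsol w hw
  obtain ⟨b1, b2, b3⟩ := hsol w' hw'
  have hv : ∀ t ∈ Icc 0 T, ‖v (y₀, w') t - v (y₀, w) t - (w' - w)‖ ≤ 1 / 2 * ‖w' - w‖ := by
    intro t ht
    have := norm_image_sub_le_of_norm_deriv_le_segment' (a := 0) (b := T)
      (f := fun τ => v (y₀, w') τ - v (y₀, w) τ)
      (fun τ hτ => ((b3 τ (hsub τ hτ)).1.vel_deriv.sub
        (a3 τ (hsub τ hτ)).1.vel_deriv).hasDerivWithinAt)
      (C := K * (Real.exp K * ‖w' - w‖))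
      (fun τ hτ => by
        have hτ' := hsub τ (Ico_subset_Icc_self hτ)
        have h1 := hK.dist_le_mul _ (b3 τ hτ').2.2 _ (a3 τ hτ').2.2
        rw [dist_eq_norm, dist_eq_norm] at h1
        refine ((norm_snd_le _).trans h1).trans ?_
        gcongr
        exact hlip w hw w' hw' τ (Ico_subset_Icc_self hτ)) t ht
    simp only [a2, b2] at this
    refine this.trans ?_
    calc K * (Real.exp K * ‖w' - w‖) * (t - 0) ≤ K * (Real.exp K * ‖w' - w‖) * T := by
          gcongr; linarith [ht.2]
      _ = K * Real.exp K * T * ‖w' - w‖ := by ring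
      _ ≤ 1 / 2 * ‖w' - w‖ := by gcongr
  have := norm_image_sub_le_of_norm_deriv_le_segment' (a := 0) (b := T)
      (f := fun τ => c (y₀, w') τ - c (y₀, w) τ - τ • (w' - w))
      (f' := fun τ => v (y₀, w') τ - v (y₀, w) τ - (w' - w))
      (fun τ hτ => by
        have h1 : HasDerivAt (fun τ : ℝ => τ • (w' - w)) (w' - w) τ := by
          simpa using (hasDerivAt_id τ).smul_const (w' - w)
        exact (((b3 τ (hsub τ hτ)).1.pos_deriv.sub
          (a3 τ (hsub τ hτ)).1.pos_deriv).sub h1).hasDerivWithinAt)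
      (fun τ hτ => hv τ (Ico_subset_Icc_self hτ)) T (right_mem_Icc.2 hT.le)
  simp only [a1, b1, sub_self, zero_smul, sub_zero] at this
  linarith

/-- Gauss lemma: in normal coordinates, half the squared distance to the centre is differentiable
and its gradient is the velocity of the radial geodesic. -/
theorem exists_normal_coordinates {y₀ : E} (hy : y₀ ∈ g.dom) :
    ∃ ρ > 0, ∃ T > 0, ∃ (c v : E → ℝ → E) (W : E → E),
      (∀ w ∈ Metric.ball (0 : E) ρ, c w 0 = y₀ ∧ v w 0 = w ∧ W (c w T) = w ∧
        ∀ t ∈ Ioo (-(2 * T)) (2 * T), g.IsSolAt (c w) (v w) t) ∧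
      ContinuousOn (fun w => c w T) (Metric.ball (0 : E) ρ) ∧
      (∀ s ⊆ Metric.ball (0 : E) ρ, IsOpen s → IsOpen ((fun w => c w T) '' s)) ∧
      ∀ w ∈ Metric.ball (0 : E) ρ, HasFDerivAt (fun y => g.coeff y₀ (W y) (W y))
        ((2 / T) • g.coeff (c w T) (v w T)) (c w T) := by
  obtain ⟨V, hV, C₁, hC₁, hN⟩ := g.abs_energy_sub_le (z₀ := (y₀, 0)) hy
  obtain ⟨ρ, hρ, T, hT, c, v, C₂, hC₂, hsol, hlip, happ⟩ := g.exists_exp hy hV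
  -- After rescaling by 1/T, the time-T map is within Lipschitz distance 1/2 of the identity, so it
  -- is invertible on the whole ball; `W` is its inverse, undoing the rescaling.
  set f : E → E := fun w => T⁻¹ • c w T with hf
  have hfa : ApproximatesLinearOn f ((ContinuousLinearEquiv.refl ℝ E : E ≃L[ℝ] E) : E →L[ℝ] E)
      (Metric.ball 0 ρ) (1 / 2) := fun w' hw' w hw => by
    have h1 : f w' - f w - (w' - w) = T⁻¹ • (c w' T - c w T - T • (w' - w)) := by
      simp only [hf, smul_sub, smul_smul, inv_mul_cancel₀ hT.ne', one_smul]
    simp only [ContinuousLinearEquiv.coe_refl, ContinuousLinearMap.coe_id', id_eq]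
    rw [h1, norm_smul, norm_inv, Real.norm_eq_abs, abs_of_pos hT, inv_mul_le_iff₀ hT]
    refine (happ w hw w' hw').trans (le_of_eq ?_)
    push_cast
    ring
  have hc : Subsingleton E ∨
      (1 / 2 : NNReal) < ‖((ContinuousLinearEquiv.refl ℝ E).symm : E →L[ℝ] E)‖₊⁻¹ := by
    rcases subsingleton_or_nontrivial E with h | h
    · exact Or.inl h
    · right
      have : ‖((ContinuousLinearEquiv.refl ℝ E).symm : E →L[ℝ] E)‖₊ = 1 := by
        rw [← NNReal.coe_inj]
        simp
      rw [this, inv_one]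
      exact NNReal.half_lt_self one_ne_zero
  set e := hfa.toOpenPartialHomeomorph f (Metric.ball 0 ρ) hc Metric.isOpen_ball with he
  have hes : e.source = Metric.ball 0 ρ := rfl
  have hef : ∀ w, e w = f w := fun w => rfl
  have hW : ∀ w ∈ Metric.ball (0 : E) ρ, e.symm (T⁻¹ • c w T) = w := fun w hw => e.left_inv hw
  have himg : ∀ s : Set E, (fun w => c w T) '' s = (fun y => T⁻¹ • y) ⁻¹' (e '' s) := fun s => by
    ext y
    constructor
    · rintro ⟨w, hw, rfl⟩
      exact ⟨w, hw, rfl⟩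
    · rintro ⟨w, hw, h⟩
      refine ⟨w, hw, ?_⟩
      exact smul_right_injective E (inv_ne_zero hT.ne') h
  have hopen : ∀ s ⊆ Metric.ball (0 : E) ρ, IsOpen s → IsOpen ((fun w => c w T) '' s) := by
    intro s hs ho
    rw [himg]
    exact (e.isOpen_image_of_subset_source ho hs).preimage (continuous_const_smul T⁻¹)
  have hanti : ∀ w ∈ Metric.ball (0 : E) ρ, ∀ w' ∈ Metric.ball (0 : E) ρ,
      ‖w' - w‖ ≤ 2 / T * ‖c w' T - c w T‖ := fun w hw w' hw' => by
    have h1 := happ w hw w' hw'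
    have h2 : ‖T • (w' - w)‖ = T * ‖w' - w‖ := by rw [norm_smul, Real.norm_eq_abs, abs_of_pos hT]
    have h3 := norm_sub_norm_le (T • (w' - w)) (c w' T - c w T)
    rw [norm_sub_rev (T • (w' - w))] at h3
    rw [div_mul_eq_mul_div, le_div_iff₀ hT]
    linarith
  have hsub : ∀ t ∈ Icc 0 T, t ∈ Ioo (-(2 * T)) (2 * T) := fun t ht =>
    ⟨by linarith [ht.1], by linarith [ht.2]⟩
  -- With ζ the difference of the two solutions, g(v, ζ) - (τ/2)(N(w') - N(w)) vanishes at τ = 0,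
  -- because both solutions start at `y₀`. Its derivative is half the Taylor remainder of the
  -- energy, since both energies are constant in time; so it stays of second order in `w' - w`.
  have hgauss : ∀ w ∈ Metric.ball (0 : E) ρ, ∀ w' ∈ Metric.ball (0 : E) ρ,
      |g.coeff (c w T) (v w T) (c w' T - c w T) -
        1 / 2 * T * (g.coeff y₀ w' w' - g.coeff y₀ w w)| ≤
        1 / 2 * C₁ * (C₂ * ‖w' - w‖) ^ 2 * T := fun w hw w' hw' => by
    obtain ⟨a1, a2, a3⟩ := hsol w hw
    obtain ⟨b1, b2, b3⟩ := hsol w' hw'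
    have hconst : ∀ u ∈ Metric.ball (0 : E) ρ, ∀ t ∈ Icc 0 T,
        g.coeff (c u t) (v u t) (v u t) = g.coeff y₀ u u := fun u hu t ht => by
      obtain ⟨u1, u2, u3⟩ := hsol u hu
      have := norm_image_sub_le_of_norm_deriv_le_segment' (a := 0) (b := T) (C := 0)
        (f := fun τ => g.coeff (c u τ) (v u τ) (v u τ))
        (fun τ hτ => ((u3 τ (hsub τ hτ)).1.hasDerivAt_energy).hasDerivWithinAt)
        (fun τ hτ => by simp) t ht
      simp only [u1, u2, zero_mul, norm_le_zero_iff, sub_eq_zero] at this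
      exact this
    have := norm_image_sub_le_of_norm_deriv_le_segment' (a := 0) (b := T)
      (C := 1 / 2 * C₁ * (C₂ * ‖w' - w‖) ^ 2)
      (f := fun τ => g.coeff (c w τ) (v w τ) (c w' τ - c w τ) -
        1 / 2 * τ * (g.coeff y₀ w' w' - g.coeff y₀ w w))
      (fun τ hτ => (((a3 τ (hsub τ hτ)).1.hasDerivAt_coeff
        ((b3 τ (hsub τ hτ)).1.pos_deriv.sub (a3 τ (hsub τ hτ)).1.pos_deriv)).sub
        (((hasDerivAt_id τ).const_mul (1 / 2)).mul_const _)).hasDerivWithinAt)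
      (fun τ hτ => by
        have hτ' := Ico_subset_Icc_self hτ
        have h1 := hN _ (a3 τ (hsub τ hτ')).2 _ (b3 τ (hsub τ hτ')).2
        have h2 := hlip w hw w' hw' τ hτ'
        have h3 : ‖(c w' τ, v w' τ) - (c w τ, v w τ)‖ ^ 2 ≤ (C₂ * ‖w' - w‖) ^ 2 := by gcongr
        simp only [hconst w hw τ hτ', hconst w' hw' τ hτ'] at h1
        rw [Real.norm_eq_abs]
        have h4 := h1.trans (mul_le_mul_of_nonneg_left h3 hC₁)
        rw [abs_le] at h4 ⊢
        simp only [Pi.sub_apply]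
        constructor <;> nlinarith [h4.1, h4.2]) T (right_mem_Icc.2 hT.le)
    simpa [a1, b1] using this
  refine ⟨ρ, hρ, T, hT, c, v, fun y => e.symm (T⁻¹ • y), fun w hw =>
    ⟨(hsol w hw).1, (hsol w hw).2.1, hW w hw, fun t ht => ((hsol w hw).2.2 t ht).1⟩, ?_, hopen,
    fun w hw => ?_⟩
  · have : (fun w => c w T) = fun w => T • f w := by
      ext w; simp [hf, smul_smul, mul_inv_cancel₀ hT.ne']
    rw [this]
    exact hfa.continuousOn.const_smul T
  · have hnhds : (fun w => c w T) '' Metric.ball 0 ρ ∈ 𝓝 (c w T) :=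
      (hopen _ subset_rfl Metric.isOpen_ball).mem_nhds ⟨w, hw, rfl⟩
    refine HasFDerivAt.of_isLittleO ?_
    have hO : (fun y => g.coeff y₀ (e.symm (T⁻¹ • y)) (e.symm (T⁻¹ • y)) -
        g.coeff y₀ (e.symm (T⁻¹ • c w T)) (e.symm (T⁻¹ • c w T)) -
        ((2 / T) • g.coeff (c w T) (v w T)) (y - c w T)) =O[𝓝 (c w T)]
        fun y => ‖y - c w T‖ ^ 2 := by
      refine Asymptotics.IsBigO.of_bound (C₁ * (C₂ * (2 / T)) ^ 2) ?_
      filter_upwards [hnhds]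
      rintro _ ⟨w', hw', rfl⟩
      have h1 := hgauss w hw w' hw'
      have h2 : (C₂ * ‖w' - w‖) ^ 2 ≤ (C₂ * (2 / T * ‖c w' T - c w T‖)) ^ 2 := by
        gcongr
        exact hanti w hw w' hw'
      simp only [hW w hw, hW w' hw', Real.norm_eq_abs, abs_pow, abs_norm, smul_apply, smul_eq_mul]
      have h3 : g.coeff y₀ w' w' - g.coeff y₀ w w - 2 / T * g.coeff (c w T) (v w T) (c w' T - c w T)
          = -(2 / T) * (g.coeff (c w T) (v w T) (c w' T - c w T) -
            1 / 2 * T * (g.coeff y₀ w' w' - g.coeff y₀ w w)) := by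
        field_simp
        ring
      rw [h3, abs_mul, abs_neg, abs_of_pos (by positivity : 0 < 2 / T)]
      calc 2 / T * _ ≤ 2 / T * (1 / 2 * C₁ * (C₂ * (2 / T * ‖c w' T - c w T‖)) ^ 2 * T) := by
            gcongr
            refine h1.trans ?_
            gcongr
        _ = C₁ * (C₂ * (2 / T)) ^ 2 * ‖c w' T - c w T‖ ^ 2 := by
            field_simp
    refine hO.trans_isLittleO ?_
    simpa using (Asymptotics.isLittleO_pow_sub_sub (c w T) one_lt_two).norm_left

/-- First variation of arc length for the curves `c τ + (1 - τ / s) u`, which move the starting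
point of a unit speed solution by `u`: their speed is bounded by the derivative of a function `K`
whose increment is the length of `c` plus the boundary term. -/
theorem exists_variation_bound {c v : ℝ → E} (h : ∀ᶠ t in 𝓝 0, g.IsSolAt c v t)
    (h1 : ∀ᶠ t in 𝓝 0, g.coeff (c t) (v t) (v t) = 1) :
    ∃ S > 0, ∀ s ∈ Ioo 0 S, ∃ C, ∃ δ > 0, ∀ u : E, ‖u‖ < δ → ∃ K K' : ℝ → ℝ,
      K s - K 0 = s - g.coeff (c 0) (v 0) u + C * ‖u‖ ^ 2 ∧
      ∀ τ ∈ Icc 0 s, g.IsSolAt c v τ ∧ c τ + (1 - τ / s) • u ∈ g.dom ∧ HasDerivAt K (K' τ) τ ∧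
        g.coeff (c τ + (1 - τ / s) • u) (v τ - s⁻¹ • u) (v τ - s⁻¹ • u) ≤ 2 * K' τ - 1 := by
  have hmem := h.self_of_nhds.mem
  obtain ⟨V, hV, C, hC, hN⟩ := g.abs_energy_sub_le (z₀ := (c 0, v 0)) hmem
  have hopen : g.dom ×ˢ (univ : Set E) ∈ 𝓝 (c 0, v 0) :=
    (g.isOpen_dom.prod isOpen_univ).mem_nhds ⟨hmem, trivial⟩
  obtain ⟨ε, hε, hball⟩ := Metric.mem_nhds_iff.1 (Filter.inter_mem hV hopen)
  have hcont : ∀ᶠ t in 𝓝 (0 : ℝ), (c t, v t) ∈ Metric.ball (c 0, v 0) (ε / 2) :=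
    h.self_of_nhds.hasDerivAt_prod.continuousAt.eventually (Metric.ball_mem_nhds _ (half_pos hε))
  obtain ⟨S, hS, hSb⟩ := Metric.eventually_nhds_iff.1 (hcont.and (h.and h1))
  refine ⟨S, hS, fun s hs => ?_⟩
  have hs0 : 0 < s := hs.1
  refine ⟨1 / 2 * C * (1 + s⁻¹) ^ 2 * s, ε / 2 / (1 + s⁻¹), by positivity, fun u hu => ?_⟩
  -- The function `K` integrates the bound (1 + speed²)/2 for the speed: the solution has speed 1,
  -- the linear change of the energy integrates to g(v, (1 - τ/s)u), which vanishes at τ = s, and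
  -- the last term absorbs the Taylor remainder.
  refine ⟨fun τ => τ + g.coeff (c τ) (v τ) ((1 - τ / s) • u) +
      1 / 2 * C * ((1 + s⁻¹) * ‖u‖) ^ 2 * τ,
    fun τ => 1 + (1 / 2 * fderiv ℝ g.coeff (c τ) ((1 - τ / s) • u) (v τ) (v τ) +
      g.coeff (c τ) (v τ) (-(s⁻¹ • u))) + 1 / 2 * C * ((1 + s⁻¹) * ‖u‖) ^ 2, ?_, fun τ hτ => ?_⟩
  · simp only [div_self hs0.ne', sub_self, zero_smul, map_zero, zero_div, sub_zero, one_smul,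
      mul_zero, zero_add, add_zero]
    ring
  · obtain ⟨b1, b2, b3⟩ := hSb (y := τ) (by
      rw [Real.dist_eq, sub_zero, abs_of_nonneg hτ.1]; exact hτ.2.trans_lt hs.2)
    have hζ : HasDerivAt (fun τ : ℝ => (1 - τ / s) • u) (-(s⁻¹ • u)) τ := by
      have := (((hasDerivAt_id τ).div_const s).const_sub 1).smul_const u
      simpa [neg_smul] using this
    have hδ : ‖((1 - τ / s) • u, -(s⁻¹ • u))‖ ≤ (1 + s⁻¹) * ‖u‖ := by
      rw [Prod.norm_def]
      refine max_le ?_ ?_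
      · rw [norm_smul, Real.norm_eq_abs]
        gcongr
        have h2 : τ / s ≤ 1 := (div_le_one hs0).2 hτ.2
        have h3 : 0 ≤ τ / s := div_nonneg hτ.1 hs0.le
        have h4 : 0 < s⁻¹ := inv_pos.2 hs0
        rw [abs_le]; constructor <;> linarith
      · rw [norm_neg, norm_smul, norm_inv, Real.norm_eq_abs, abs_of_pos hs0]
        gcongr
        linarith
    have hδ2 : (1 + s⁻¹) * ‖u‖ < ε / 2 := by
      rw [lt_div_iff₀ (by positivity)] at hu
      linarith
    have hin : (c τ + (1 - τ / s) • u, v τ - s⁻¹ • u) ∈ Metric.ball (c 0, v 0) ε := by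
      have e1 : (c τ + (1 - τ / s) • u, v τ - s⁻¹ • u) =
          (c τ, v τ) + ((1 - τ / s) • u, -(s⁻¹ • u)) := by simp [sub_eq_add_neg]
      rw [e1, Metric.mem_ball, dist_eq_norm, add_sub_right_comm]
      refine (norm_add_le _ _).trans_lt ?_
      rw [Metric.mem_ball, dist_eq_norm] at b1
      linarith
    have hin0 : (c τ, v τ) ∈ Metric.ball (c 0, v 0) ε :=
      Metric.ball_subset_ball (by linarith) b1
    refine ⟨b2, (hball hin).2.1, ?_, ?_⟩
    · refine ((hasDerivAt_id τ).add (b2.hasDerivAt_coeff hζ)).add ?_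
      simpa using (hasDerivAt_id τ).const_mul (1 / 2 * C * ((1 + s⁻¹) * ‖u‖) ^ 2)
    · have h2 := (abs_le.1 (hN _ (hball hin0).1 _ (hball hin).1)).2
      simp only [Prod.mk_sub_mk, add_sub_cancel_left, sub_sub_cancel_left, b3] at h2
      have h3 : C * ‖((1 - τ / s) • u, -(s⁻¹ • u))‖ ^ 2 ≤ C * ((1 + s⁻¹) * ‖u‖) ^ 2 := by gcongr
      nlinarith

end FiniteDimensional

end LocalMetric

/-! ### The metric in a chart -/

namespace SingularFoliation

set_option maxSynthPendingDepth 3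

variable {n : ℕ} {M : Type*} [MetricSpace M] [ChartedSpace (EuclideanSpace ℝ (Fin n)) M]

local notation "𝔼" => EuclideanSpace ℝ (Fin n)

/-! ### Tangent vectors and velocities in coordinates. -/

section Charts

variable [IsManifold (𝓡 n) ∞ M]

theorem contMDiffAt_chart {p x : M} (hx : x ∈ (extChartAt (𝓡 n) p).source) :
    ContMDiffAt (𝓡 n) 𝓘(ℝ, 𝔼) ∞ (extChartAt (𝓡 n) p) x :=
  contMDiffAt_extChartAt' (by rwa [← extChartAt_source (𝓡 n)])

theorem contMDiffAt_chart_symm {p : M} {y : 𝔼} (hy : y ∈ (extChartAt (𝓡 n) p).target) :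
    ContMDiffAt 𝓘(ℝ, 𝔼) (𝓡 n) ∞ (extChartAt (𝓡 n) p).symm y :=
  (contMDiffOn_extChartAt_symm p).contMDiffAt ((isOpen_extChartAt_target p).mem_nhds hy)

theorem mfderiv_chart_symm_apply {p : M} {y : 𝔼} (hy : y ∈ (extChartAt (𝓡 n) p).target) (a : 𝔼) :
    (mfderiv (𝓡 n) 𝓘(ℝ, 𝔼) (extChartAt (𝓡 n) p) ((extChartAt (𝓡 n) p).symm y)
      (mfderiv 𝓘(ℝ, 𝔼) (𝓡 n) (extChartAt (𝓡 n) p).symm y a : TangentSpace (𝓡 n) _) : 𝔼) = a := by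
  have h := mfderiv_extChartAt_comp_mfderivWithin_extChartAt_symm (I := 𝓡 n) hy
  have h2 : range (𝓡 n) = univ := by simp
  rw [h2, mfderivWithin_univ] at h
  exact congrArg (fun L : 𝔼 →L[ℝ] 𝔼 => L a) h

theorem mfderiv_symm_chart_apply {p : M} {y : 𝔼} (hy : y ∈ (extChartAt (𝓡 n) p).target)
    (a : TangentSpace (𝓡 n) ((extChartAt (𝓡 n) p).symm y)) :
    mfderiv 𝓘(ℝ, 𝔼) (𝓡 n) (extChartAt (𝓡 n) p).symm y
      (mfderiv (𝓡 n) 𝓘(ℝ, 𝔼) (extChartAt (𝓡 n) p) ((extChartAt (𝓡 n) p).symm y) a : 𝔼) = a := by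
  have h := mfderivWithin_extChartAt_symm_comp_mfderiv_extChartAt (I := 𝓡 n) hy
  have h2 : range (𝓡 n) = univ := by simp
  rw [h2, mfderivWithin_univ] at h
  exact congrArg (fun L : TangentSpace (𝓡 n) ((extChartAt (𝓡 n) p).symm y) →L[ℝ]
    TangentSpace (𝓡 n) ((extChartAt (𝓡 n) p).symm y) => L a) h

theorem mfderiv_chart_symm_injective {p : M} {y : 𝔼} (hy : y ∈ (extChartAt (𝓡 n) p).target) {a : 𝔼}
    (h : (mfderiv 𝓘(ℝ, 𝔼) (𝓡 n) (extChartAt (𝓡 n) p).symm y a :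
      TangentSpace (𝓡 n) ((extChartAt (𝓡 n) p).symm y)) = 0) : a = 0 := by
  rw [← mfderiv_chart_symm_apply hy a, h]
  exact map_zero _

/-- The tangent vector with given coordinates. -/
noncomputable def chartVec (p : M) (y a : 𝔼) : TangentBundle (𝓡 n) M :=
  ⟨(extChartAt (𝓡 n) p).symm y, mfderiv 𝓘(ℝ, 𝔼) (𝓡 n) (extChartAt (𝓡 n) p).symm y a⟩

/-- The coordinates of a tangent vector. -/
noncomputable def tangentCoord (p x : M) : TangentSpace (𝓡 n) x →L[ℝ] 𝔼 :=
  mfderiv (𝓡 n) 𝓘(ℝ, 𝔼) (extChartAt (𝓡 n) p) x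

theorem tangentCoord_chartVec {p : M} {y : 𝔼} (hy : y ∈ (extChartAt (𝓡 n) p).target) (a : 𝔼) :
    tangentCoord p (chartVec p y a).proj (chartVec p y a).2 = a :=
  mfderiv_chart_symm_apply hy a

theorem chartVec_tangentCoord {p x : M} (hx : x ∈ (extChartAt (𝓡 n) p).source)
    (a : TangentSpace (𝓡 n) x) :
    chartVec p (extChartAt (𝓡 n) p x) (tangentCoord p x a) = ⟨x, a⟩ := by
  obtain ⟨y, hy, rfl⟩ : ∃ y ∈ (extChartAt (𝓡 n) p).target, (extChartAt (𝓡 n) p).symm y = x :=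
    ⟨_, (extChartAt (𝓡 n) p).map_source hx, (extChartAt (𝓡 n) p).left_inv hx⟩
  rw [(extChartAt (𝓡 n) p).right_inv hy]
  exact congrArg (TotalSpace.mk _) (mfderiv_symm_chart_apply hy a)

/-- This is the tangent map of the inverse chart, with the tangent bundle of the model space
identified with a product. -/
theorem contMDiffOn_chartVec (p : M) : ContMDiffOn (𝓘(ℝ, 𝔼).prod 𝓘(ℝ, 𝔼)) (𝓡 n).tangent ∞
    (fun z : 𝔼 × 𝔼 => chartVec p z.1 z.2) ((extChartAt (𝓡 n) p).target ×ˢ univ) := by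
  have h1 := (contMDiffOn_extChartAt_symm (I := 𝓡 n) (n := ∞) p).contMDiffOn_tangentMapWithin
    (m := ∞) (by simp) (isOpen_extChartAt_target p).uniqueMDiffOn
  have h2 : ContMDiff (𝓘(ℝ, 𝔼).prod 𝓘(ℝ, 𝔼)) 𝓘(ℝ, 𝔼).tangent ∞
      (fun z : 𝔼 × 𝔼 => (⟨z.1, z.2⟩ : TangentBundle 𝓘(ℝ, 𝔼) 𝔼)) := by
    erw [chartedSpaceSelf_prod]
    exact contMDiff_tangentBundleModelSpaceHomeomorph_symm (I := 𝓘(ℝ, 𝔼))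
  refine (h1.comp h2.contMDiffOn (fun z hz => hz.1)).congr fun z hz => ?_
  simp only [chartVec, Function.comp, tangentMapWithin]
  rw [mfderivWithin_of_isOpen (isOpen_extChartAt_target p) hz.1]

/-- The bridge between manifold derivatives of curves and the coordinate derivatives occurring in
the geodesic equation. -/
theorem velocity_eq_chartVec {γ : ℝ → M} {p : M} {t : ℝ} {v : 𝔼} (hγ : ContinuousAt γ t)
    (hp : γ t ∈ (extChartAt (𝓡 n) p).source)
    (hv : HasDerivAt (fun σ => extChartAt (𝓡 n) p (γ σ)) v t) :
    velocity γ t = chartVec p (extChartAt (𝓡 n) p (γ t)) v := by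
  have h1 : HasMFDerivAt 𝓘(ℝ, ℝ) 𝓘(ℝ, 𝔼) (fun σ => extChartAt (𝓡 n) p (γ σ)) t
    (ContinuousLinearMap.toSpanSingleton ℝ v) := hv.hasFDerivAt.hasMFDerivAt
  have h2 := (contMDiffAt_chart_symm ((extChartAt (𝓡 n) p).map_source hp)).mdifferentiableAt
    (by simp)
  have h3 := h2.hasMFDerivAt.comp t h1
  have h4 : γ =ᶠ[𝓝 t] (extChartAt (𝓡 n) p).symm ∘ fun σ => extChartAt (𝓡 n) p (γ σ) := by
    filter_upwards [hγ.eventually ((isOpen_extChartAt_source (I := 𝓡 n) p).mem_nhds hp)] with σ hσ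
    exact ((extChartAt (𝓡 n) p).left_inv hσ).symm
  have h5 := h3.congr_of_eventuallyEq h4
  have h6 := h5.mfderiv
  have h7 : (extChartAt (𝓡 n) p).symm (extChartAt (𝓡 n) p (γ t)) = γ t :=
    (extChartAt (𝓡 n) p).left_inv hp
  simp only [velocity, chartVec, velocityVec]
  rw [TotalSpace.mk.injEq]
  refine ⟨h7.symm, ?_⟩
  refine heq_of_eq ?_
  erw [h6]
  exact congrArg (mfderiv 𝓘(ℝ, 𝔼) (𝓡 n) (extChartAt (𝓡 n) p).symm (extChartAt (𝓡 n) p (γ t)))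
    (one_smul ℝ v)

end Charts

/-! ### The coordinate expression of the Riemannian metric. -/

section Metric

variable [IsManifold (𝓡 n) ∞ M] [RiemannianBundle (fun x : M => TangentSpace (𝓡 n) x)]
  [IsContMDiffRiemannianBundle (𝓡 n) ∞ (EuclideanSpace ℝ (Fin n))
    (fun x : M => TangentSpace (𝓡 n) x)]

/-- The coefficients of the Riemannian metric in the preferred chart around `p`. -/
noncomputable def chartCoeff (p : M) (y : 𝔼) : 𝔼 →L[ℝ] 𝔼 →L[ℝ] ℝ :=
  (innerSL ℝ (E := TangentSpace (𝓡 n) ((extChartAt (𝓡 n) p).symm y))).bilinearComp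
    (mfderiv 𝓘(ℝ, 𝔼) (𝓡 n) (extChartAt (𝓡 n) p).symm y : 𝔼 →L[ℝ] _)
    (mfderiv 𝓘(ℝ, 𝔼) (𝓡 n) (extChartAt (𝓡 n) p).symm y : 𝔼 →L[ℝ] _)

theorem chartCoeff_eq_inner (p : M) (y a b : 𝔼) :
    chartCoeff p y a b = ⟪(chartVec p y a).2, (chartVec p y b).2⟫ := by
  unfold chartCoeff
  exact ContinuousLinearMap.bilinearComp_apply ..

/-- The Riemannian metric in the preferred chart around `p`. -/
noncomputable def chartLM (p : M) : LocalMetric 𝔼 where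
  coeff := chartCoeff p
  dom := (extChartAt (𝓡 n) p).target
  isOpen_dom := isOpen_extChartAt_target p
  contDiffOn := by
    rw [contDiffOn_clm_apply]
    intro a
    rw [contDiffOn_clm_apply]
    intro b
    rw [← contMDiffOn_iff_contDiffOn]
    have h := fun a : 𝔼 => (contMDiffOn_chartVec p).comp (s := (extChartAt (𝓡 n) p).target)
      (f := fun y : 𝔼 => (y, a)) (I := 𝓘(ℝ, 𝔼))
      (contMDiffOn_id.prodMk contMDiffOn_const) (fun y hy => ⟨hy, trivial⟩)
    exact ((h a).inner_bundle (h b)).congr fun y hy => chartCoeff_eq_inner p y a b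
  symm y hy a b := by
    rw [chartCoeff_eq_inner, chartCoeff_eq_inner]
    exact real_inner_comm _ _
  pos y hy a ha := by
    rw [chartCoeff_eq_inner]
    refine lt_of_le_of_ne real_inner_self_nonneg fun h0 => ha ?_
    exact mfderiv_chart_symm_injective hy (inner_self_eq_zero.1 h0.symm)

theorem coeff_eq_inner (p : M) (y a b : 𝔼) :
    (chartLM p).coeff y a b = ⟪(chartVec p y a).2, (chartVec p y b).2⟫ :=
  chartCoeff_eq_inner p y a b

theorem chartMetric_eq (p : M) (y a b : 𝔼) : chartMetric p y a b = (chartLM p).coeff y a b :=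
  (chartCoeff_eq_inner p y a b).symm

theorem norm_chartVec_sq (p : M) (y a : 𝔼) :
    ‖(chartVec p y a).2‖ ^ 2 = (chartLM p).coeff y a a := by
  rw [coeff_eq_inner, real_inner_self_eq_norm_sq]

theorem inner_eq_coeff {p x : M} (hx : x ∈ (extChartAt (𝓡 n) p).source)
    (a b : TangentSpace (𝓡 n) x) : ⟪a, b⟫ = (chartLM p).coeff (extChartAt (𝓡 n) p x)
      (tangentCoord p x a) (tangentCoord p x b) := by
  rw [coeff_eq_inner, chartVec_tangentCoord hx, chartVec_tangentCoord hx]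

theorem norm_sq_eq_coeff {p x : M} (hx : x ∈ (extChartAt (𝓡 n) p).source)
    (a : TangentSpace (𝓡 n) x) : ‖a‖ ^ 2 = (chartLM p).coeff (extChartAt (𝓡 n) p x)
      (tangentCoord p x a) (tangentCoord p x a) := by
  rw [← inner_eq_coeff hx, real_inner_self_eq_norm_sq]

end Metric

end SingularFoliation

/-! ### The geodesic equation and its invariance -/

namespace LocalMetric

set_option maxSynthPendingDepth 3

variable {E : Type*} [NormedAddCommGroup E] [NormedSpace ℝ E] [FiniteDimensional ℝ E]
  {g g' : LocalMetric E}

/-- Nondegeneracy turns the Euler-Lagrange form, tested on constant vectors, into the equation for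
the acceleration. -/
theorem isSolAt_of_hasDerivAt_momentum {c v : ℝ → E} {t : ℝ} {a : E} (hc : c t ∈ g.dom)
    (h1 : HasDerivAt c (v t) t) (h2 : HasDerivAt v a t)
    (h3 : ∀ w, HasDerivAt (fun τ => g.coeff (c τ) (v τ) w)
      (1 / 2 * fderiv ℝ g.coeff (c t) w (v t) (v t)) t) : g.IsSolAt c v t := by
  refine ⟨hc, h1, ?_⟩
  have : a = g.acc (c t) (v t) := by
    refine eq_of_coeff_eq hc fun w => ?_
    have h4 := (LocalMetric.hasDerivAt_coeff hc h1 h2 (hasDerivAt_const t w)).unique (h3 w)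
    rw [coeff_acc hc]
    simp only [map_zero, add_zero] at h4
    linarith
  rwa [← this]

/-- The geodesic equation is invariant under isometries. -/
theorem IsSolAt.of_isometry {U : Set E} (hU : IsOpen U) {χ : E → E} (hχ : ContDiffOn ℝ ∞ χ U)
    (hmaps : MapsTo χ U g.dom) (hdom : U ⊆ g'.dom)
    (hiso : ∀ y ∈ U, ∀ a b, g'.coeff y a b = g.coeff (χ y) (fderiv ℝ χ y a) (fderiv ℝ χ y b))
    {c v : ℝ → E} {t : ℝ} {a : E} (hc : c t ∈ U) (h1 : HasDerivAt c (v t) t)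
    (h2 : HasDerivAt v a t)
    (h : g.IsSolAt (fun τ => χ (c τ)) (fun τ => fderiv ℝ χ (c τ) (v τ)) t) : g'.IsSolAt c v t := by
  have hχt : ContDiffAt ℝ ∞ χ (c t) := hχ.contDiffAt (hU.mem_nhds hc)
  have hχ' : ContDiffAt ℝ ∞ (fderiv ℝ χ) (c t) := hχt.fderiv_right (by simp)
  have hd' : HasFDerivAt (fderiv ℝ χ) (fderiv ℝ (fderiv ℝ χ) (c t)) (c t) :=
    (hχ'.differentiableAt (by simp)).hasFDerivAt
  have hd : HasFDerivAt χ (fderiv ℝ χ (c t)) (c t) := (hχt.differentiableAt (by simp)).hasFDerivAt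
  have hsymm : IsSymmSndFDerivAt ℝ χ (c t) := hχt.isSymmSndFDerivAt (by simpa using WithTop.coe_le_coe.2 (le_top (a := (2 : ℕ∞))))
  refine isSolAt_of_hasDerivAt_momentum (hdom hc) h1 h2 fun w => ?_
  have h3 : HasDerivAt (fun τ => fderiv ℝ χ (c τ) w)
      (fderiv ℝ (fderiv ℝ χ) (c t) (v t) w) t := by
    have := (hd'.comp_hasDerivAt t h1).clm_apply (hasDerivAt_const t w)
    simpa using this
  have h4 := h.hasDerivAt_coeff h3
  have h5 : (fun τ => g'.coeff (c τ) (v τ) w) =ᶠ[𝓝 t] fun τ =>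
      g.coeff (χ (c τ)) (fderiv ℝ χ (c τ) (v τ)) (fderiv ℝ χ (c τ) w) := by
    filter_upwards [h1.continuousAt.eventually (hU.mem_nhds hc)] with τ hτ using hiso _ hτ _ _
  refine (h4.congr_of_eventuallyEq h5).congr_deriv ?_
  -- Two expressions have to agree. The first variation of the image curve with the field Dχ(w)
  -- produces the term g(Dχ v, D²χ(v, w)), while differentiating the isometry identity in the
  -- direction `w` produces 2 g(D²χ(w, v), Dχ v), halved in the equation. Symmetry of D²χ identifies
  -- them.
  have hline : HasDerivAt (fun s : ℝ => c t + s • w) w 0 := by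
    simpa using ((hasDerivAt_id (0 : ℝ)).smul_const w).const_add (c t)
  have e0 : c t + (0 : ℝ) • w = c t := by simp
  have k1 : HasDerivAt (fun s : ℝ => g'.coeff (c t + s • w) (v t) (v t))
      (fderiv ℝ g'.coeff (c t) w (v t) (v t)) 0 := by
    have := LocalMetric.hasDerivAt_coeff (g := g') (c := fun s : ℝ => c t + s • w)
      (v := fun _ => v t) (ζ := fun _ => v t) (by rw [e0]; exact hdom hc) hline
      (hasDerivAt_const (0 : ℝ) (v t)) (hasDerivAt_const (0 : ℝ) (v t))
    rw [e0] at this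
    simpa only [map_zero, add_zero, zero_apply] using this
  have k2 : HasDerivAt (fun s : ℝ => χ (c t + s • w)) (fderiv ℝ χ (c t) w) 0 :=
    hd.hasLineDerivAt w
  have k3 : HasDerivAt (fun s : ℝ => fderiv ℝ χ (c t + s • w) (v t))
      (fderiv ℝ (fderiv ℝ χ) (c t) w (v t)) 0 := by
    have k : HasDerivAt (fun s : ℝ => fderiv ℝ χ (c t + s • w))
      (fderiv ℝ (fderiv ℝ χ) (c t) w) 0 := hd'.hasLineDerivAt w
    have := k.clm_apply (hasDerivAt_const (0 : ℝ) (v t))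
    rwa [map_zero, add_zero] at this
  have k4 := LocalMetric.hasDerivAt_coeff (g := g) (c := fun s : ℝ => χ (c t + s • w))
    (v := fun s : ℝ => fderiv ℝ χ (c t + s • w) (v t))
    (ζ := fun s : ℝ => fderiv ℝ χ (c t + s • w) (v t)) (by rw [e0]; exact hmaps hc) k2 k3 k3
  have k5 : (fun s : ℝ => g'.coeff (c t + s • w) (v t) (v t)) =ᶠ[𝓝 0] fun s =>
      g.coeff (χ (c t + s • w)) (fderiv ℝ χ (c t + s • w) (v t))
        (fderiv ℝ χ (c t + s • w) (v t)) := by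
    have : ∀ᶠ s : ℝ in 𝓝 0, c t + s • w ∈ U :=
      hline.continuousAt.eventually (by simpa only [e0] using hU.eventually_mem hc)
    filter_upwards [this] with s hs using hiso _ hs _ _
  have k6 := k1.unique (k4.congr_of_eventuallyEq k5)
  rw [k6]
  simp only [e0]
  rw [hsymm.eq w (v t), g.symm _ h.mem (fderiv ℝ (fderiv ℝ χ) (c t) (v t) w)]
  ring

end LocalMetric

namespace SingularFoliation

set_option maxSynthPendingDepth 3

variable {n : ℕ} {M : Type*} [MetricSpace M] [ChartedSpace (EuclideanSpace ℝ (Fin n)) M]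

local notation "𝔼" => EuclideanSpace ℝ (Fin n)

variable [IsManifold (𝓡 n) ∞ M] [RiemannianBundle (fun x : M => TangentSpace (𝓡 n) x)]
  [IsContMDiffRiemannianBundle (𝓡 n) ∞ (EuclideanSpace ℝ (Fin n))
    (fun x : M => TangentSpace (𝓡 n) x)]

theorem contDiffAt_deriv {E : Type*} [NormedAddCommGroup E] [NormedSpace ℝ E] {f : ℝ → E} {t : ℝ}
    (h : ContDiffAt ℝ ∞ f t) : ContDiffAt ℝ ∞ (deriv f) t :=
  (h.fderiv_right (m := ∞) (by simp)).clm_apply contDiffAt_const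

/-- Near `t`, the curve `γ` solves the geodesic equation in the preferred chart around `p`. -/
def IsSolIn (p : M) (γ : ℝ → M) (t : ℝ) : Prop :=
  ∀ᶠ τ in 𝓝 t, ContinuousAt γ τ ∧ γ τ ∈ (extChartAt (𝓡 n) p).source ∧
    (chartLM p).IsSolAt (fun σ => extChartAt (𝓡 n) p (γ σ))
      (deriv fun σ => extChartAt (𝓡 n) p (γ σ)) τ

/-- The position equation forces `v` to be the derivative of the coordinate expression on a whole
neighbourhood, so any convenient velocity function may be used. -/
theorem isSolIn_of_eventually {p : M} {γ : ℝ → M} {v : ℝ → 𝔼} {t : ℝ}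
    (h : ∀ᶠ τ in 𝓝 t, ContinuousAt γ τ ∧ γ τ ∈ (extChartAt (𝓡 n) p).source ∧
      (chartLM p).IsSolAt (fun σ => extChartAt (𝓡 n) p (γ σ)) v τ) : IsSolIn (n := n) p γ t := by
  filter_upwards [h.eventually_nhds] with τ hτ
  refine ⟨hτ.self_of_nhds.1, hτ.self_of_nhds.2.1, hτ.self_of_nhds.2.2.mem, ?_, ?_⟩
  · exact hτ.self_of_nhds.2.2.pos_deriv.differentiableAt.hasDerivAt
  · have : (deriv fun σ => extChartAt (𝓡 n) p (γ σ)) =ᶠ[𝓝 τ] v := by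
      filter_upwards [hτ] with σ hσ using hσ.2.2.pos_deriv.deriv
    rw [this.eq_of_nhds]
    exact hτ.self_of_nhds.2.2.vel_deriv.congr_of_eventuallyEq this

theorem IsSolIn.contMDiffAt {p : M} {γ : ℝ → M} {t : ℝ} (h : IsSolIn (n := n) p γ t) :
    ContMDiffAt 𝓘(ℝ, ℝ) (𝓡 n) ∞ γ t := by
  have h1 : ContDiffAt ℝ ∞ (fun σ => extChartAt (𝓡 n) p (γ σ)) t :=
    LocalMetric.contDiffAt_of_isSolAt (g := chartLM p) (h.mono fun τ hτ => hτ.2.2)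
  have h2 := (contMDiffAt_chart_symm
    ((extChartAt (𝓡 n) p).map_source h.self_of_nhds.2.1)).comp t h1.contMDiffAt
  refine h2.congr_of_eventuallyEq ?_
  filter_upwards [h] with σ hσ using ((extChartAt (𝓡 n) p).left_inv hσ.2.1).symm

theorem IsSolIn.eventually {p : M} {γ : ℝ → M} {t : ℝ} (h : IsSolIn (n := n) p γ t) :
    ∀ᶠ τ in 𝓝 t, IsSolIn (n := n) p γ τ := Filter.Eventually.eventually_nhds h

theorem IsSolIn.congr {p : M} {γ γ' : ℝ → M} {t : ℝ} (h : IsSolIn (n := n) p γ t)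
    (he : γ' =ᶠ[𝓝 t] γ) : IsSolIn (n := n) p γ' t := by
  refine isSolIn_of_eventually (v := deriv fun σ => extChartAt (𝓡 n) p (γ σ)) ?_
  filter_upwards [h, he.eventuallyEq_nhds] with τ h1 h2
  refine ⟨h1.1.congr h2.symm, h2.eq_of_nhds ▸ h1.2.1, ?_⟩
  have h3 : (fun σ => extChartAt (𝓡 n) p (γ' σ)) =ᶠ[𝓝 τ] fun σ => extChartAt (𝓡 n) p (γ σ) := by
    filter_upwards [h2] with σ hσ; rw [hσ]
  obtain ⟨k1, k2, k3⟩ := h1.2.2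
  refine ⟨?_, k2.congr_of_eventuallyEq h3, ?_⟩
  · rw [h3.eq_of_nhds]; exact k1
  · rw [h3.eq_of_nhds]; exact k3

theorem tangentCoord_chartVec_eq_fderiv {p q : M} {y : 𝔼}
    (hy : y ∈ (extChartAt (𝓡 n) q).target)
    (hp : (extChartAt (𝓡 n) q).symm y ∈ (extChartAt (𝓡 n) p).source) (a : 𝔼) :
    tangentCoord p ((extChartAt (𝓡 n) q).symm y) (chartVec q y a).2 =
      fderiv ℝ (fun z => extChartAt (𝓡 n) p ((extChartAt (𝓡 n) q).symm z)) y a := by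
  have h1 := ((contMDiffAt_chart hp).mdifferentiableAt (by simp)).hasMFDerivAt
  have h2 := ((contMDiffAt_chart_symm hy).mdifferentiableAt (by simp)).hasMFDerivAt
  have h3 := (h1.comp y h2).mfderiv
  rw [mfderiv_eq_fderiv] at h3
  exact (congrArg (fun L : 𝔼 →L[ℝ] 𝔼 => L a) h3).symm

/-- The transition map is an isometry between the two coordinate metrics, so
`LocalMetric.IsSolAt.of_isometry` applies to it. -/
theorem IsSolIn.changeChart {p q : M} {γ : ℝ → M} {t : ℝ} (h : IsSolIn (n := n) p γ t)
    (hq : γ t ∈ (extChartAt (𝓡 n) q).source) : IsSolIn (n := n) q γ t := by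
  set U : Set 𝔼 := (extChartAt (𝓡 n) q).target ∩
    (extChartAt (𝓡 n) q).symm ⁻¹' (extChartAt (𝓡 n) p).source with hUdef
  have hU : IsOpen U := (continuousOn_extChartAt_symm q).isOpen_inter_preimage
    (isOpen_extChartAt_target q) (isOpen_extChartAt_source p)
  set χ : 𝔼 → 𝔼 := fun z => extChartAt (𝓡 n) p ((extChartAt (𝓡 n) q).symm z) with hχdef
  have hχ : ContDiffOn ℝ ∞ χ U := fun y hy => by
    have := (contMDiffAt_chart hy.2).comp y (contMDiffAt_chart_symm hy.1)
    exact (contMDiffAt_iff_contDiffAt.1 this).contDiffWithinAt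
  have hev : ∀ᶠ τ in 𝓝 t, γ τ ∈ (extChartAt (𝓡 n) q).source :=
    h.self_of_nhds.1.eventually ((isOpen_extChartAt_source (I := 𝓡 n) q).mem_nhds hq)
  refine isSolIn_of_eventually (v := deriv fun σ => extChartAt (𝓡 n) q (γ σ)) ?_
  filter_upwards [h.eventually, hev.eventually_nhds] with τ h1 h2
  have hqτ := h2.self_of_nhds
  obtain ⟨k1, k2, k3⟩ := h1.self_of_nhds
  refine ⟨k1, hqτ, ?_⟩
  have hinv : ∀ σ, γ σ ∈ (extChartAt (𝓡 n) q).source →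
      (extChartAt (𝓡 n) q).symm (extChartAt (𝓡 n) q (γ σ)) = γ σ :=
    fun σ hσ => (extChartAt (𝓡 n) q).left_inv hσ
  have hcU : extChartAt (𝓡 n) q (γ τ) ∈ U :=
    ⟨(extChartAt (𝓡 n) q).map_source hqτ, by rw [mem_preimage, hinv _ hqτ]; exact k2⟩
  have hsm : ContDiffAt ℝ ∞ (fun σ => extChartAt (𝓡 n) q (γ σ)) τ :=
    contMDiffAt_iff_contDiffAt.1 ((contMDiffAt_chart hqτ).comp τ h1.contMDiffAt)
  have hsm' : ContDiffAt ℝ ∞ (deriv fun σ => extChartAt (𝓡 n) q (γ σ)) τ :=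
    contDiffAt_deriv hsm
  have hsm1 := hsm.differentiableAt (by simp)
  refine LocalMetric.IsSolAt.of_isometry (g := chartLM p) hU hχ
    (fun y hy => (extChartAt (𝓡 n) p).map_source hy.2) (fun y hy => hy.1) (fun y hy a b => ?_) hcU
    hsm1.hasDerivAt (hsm'.differentiableAt (by simp)).hasDerivAt ?_
  · rw [coeff_eq_inner, ← tangentCoord_chartVec_eq_fderiv hy.1 hy.2,
      ← tangentCoord_chartVec_eq_fderiv hy.1 hy.2]
    exact inner_eq_coeff hy.2 _ _
  · have e1 : (fun σ => χ (extChartAt (𝓡 n) q (γ σ))) =ᶠ[𝓝 τ]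
        fun σ => extChartAt (𝓡 n) p (γ σ) := by
      filter_upwards [h2] with σ hσ
      simp only [hχdef, hinv σ hσ]
    have e2 : (fun σ => fderiv ℝ χ (extChartAt (𝓡 n) q (γ σ))
        (deriv (fun σ => extChartAt (𝓡 n) q (γ σ)) σ)) =ᶠ[𝓝 τ]
        deriv fun σ => extChartAt (𝓡 n) p (γ σ) := by
      filter_upwards [e1.eventuallyEq_nhds, (hsm.of_le (m := 1) (by simp)).eventually (by simp),
        hsm.continuousAt.eventually (hU.mem_nhds hcU)] with σ a1 a2 a3
      rw [← a1.deriv_eq]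
      exact (((hχ.contDiffAt (hU.mem_nhds a3)).differentiableAt (by simp)).hasFDerivAt.comp_hasDerivAt
        σ (a2.differentiableAt (by simp)).hasDerivAt).deriv.symm
    obtain ⟨b1, b2, b3⟩ := k3
    refine ⟨?_, ?_, ?_⟩
    · rw [e1.eq_of_nhds]; exact b1
    · rw [e2.eq_of_nhds]; exact b2.congr_of_eventuallyEq e1
    · rw [e2.eq_of_nhds, e1.eq_of_nhds]; exact b3.congr_of_eventuallyEq e2

/-- By invariance under changes of charts, one chart at each time suffices for the equation in all
charts. -/
theorem isGeodesic_of_forall {γ : ℝ → M} (h : ∀ t, ∃ p, IsSolIn (n := n) p γ t) :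
    IsGeodesic (n := n) γ := by
  refine ⟨fun t => (h t).choose_spec.contMDiffAt, fun p t hp w => ?_⟩
  have h1 : IsSolIn (n := n) p γ t := (h t).choose_spec.changeChart hp
  have h2 := h1.self_of_nhds.2.2
  have h3 := h2.hasDerivAt_coeff (hasDerivAt_const t w)
  have h4 := LocalMetric.fderiv_quadratic h2.mem (deriv (fun σ => extChartAt (𝓡 n) p (γ σ)) t) w
  simp only [chartMetric_eq]
  rw [h4]
  simpa using h3

theorem IsGeodesic.isSolIn {γ : ℝ → M} (h : IsGeodesic (n := n) γ) {p : M} {t : ℝ}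
    (hp : γ t ∈ (extChartAt (𝓡 n) p).source) : IsSolIn (n := n) p γ t := by
  refine isSolIn_of_eventually (v := deriv fun σ => extChartAt (𝓡 n) p (γ σ)) ?_
  have hcont : Continuous γ := h.1.continuous
  filter_upwards [hcont.continuousAt.eventually
    ((isOpen_extChartAt_source (I := 𝓡 n) p).mem_nhds hp)] with τ hτ
  refine ⟨hcont.continuousAt, hτ, ?_⟩
  have hsm : ContDiffAt ℝ ∞ (fun σ => extChartAt (𝓡 n) p (γ σ)) τ :=
    contMDiffAt_iff_contDiffAt.1 ((contMDiffAt_chart hτ).comp τ (h.1 τ))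
  have hsm' : ContDiffAt ℝ ∞ (deriv fun σ => extChartAt (𝓡 n) p (γ σ)) τ :=
    contDiffAt_deriv hsm
  have hmem : extChartAt (𝓡 n) p (γ τ) ∈ (chartLM p).dom := (extChartAt (𝓡 n) p).map_source hτ
  refine LocalMetric.isSolAt_of_hasDerivAt_momentum hmem
    (hsm.differentiableAt (by simp)).hasDerivAt (hsm'.differentiableAt (by simp)).hasDerivAt
    fun w => ?_
  have h1 := h.2 p τ hτ w
  simp only [chartMetric_eq] at h1
  rwa [LocalMetric.fderiv_quadratic hmem] at h1

end SingularFoliation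

/-! ### Geodesics on intervals -/

namespace SingularFoliation

set_option maxSynthPendingDepth 3

variable {n : ℕ} {M : Type*} [MetricSpace M] [ChartedSpace (EuclideanSpace ℝ (Fin n)) M]

local notation "𝔼" => EuclideanSpace ℝ (Fin n)

variable [IsManifold (𝓡 n) ∞ M] [RiemannianBundle (fun x : M => TangentSpace (𝓡 n) x)]
  [IsContMDiffRiemannianBundle (𝓡 n) ∞ (EuclideanSpace ℝ (Fin n))
    (fun x : M => TangentSpace (𝓡 n) x)]

theorem IsSolIn.hasDerivAt {p : M} {γ : ℝ → M} {t : ℝ} (h : IsSolIn (n := n) p γ t) :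
    HasDerivAt (fun σ => extChartAt (𝓡 n) p (γ σ)) (deriv (fun σ => extChartAt (𝓡 n) p (γ σ)) t) t :=
  h.self_of_nhds.2.2.pos_deriv

theorem IsSolIn.velocity_eq {p : M} {γ : ℝ → M} {t : ℝ} (h : IsSolIn (n := n) p γ t) :
    velocity γ t = chartVec p (extChartAt (𝓡 n) p (γ t))
      (deriv (fun σ => extChartAt (𝓡 n) p (γ σ)) t) :=
  velocity_eq_chartVec h.self_of_nhds.1 h.self_of_nhds.2.1 h.hasDerivAt

theorem chartVec_injective {p : M} {y a y' a' : 𝔼} (hy : y ∈ (extChartAt (𝓡 n) p).target)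
    (hy' : y' ∈ (extChartAt (𝓡 n) p).target) (h : chartVec p y a = chartVec p y' a') :
    y = y' ∧ a = a' := by
  have h1 : y = y' := by
    rw [← (extChartAt (𝓡 n) p).right_inv hy, ← (extChartAt (𝓡 n) p).right_inv hy']
    exact congrArg (fun v : TangentBundle (𝓡 n) M => extChartAt (𝓡 n) p v.proj) h
  subst h1
  refine ⟨rfl, ?_⟩
  rw [← tangentCoord_chartVec hy a, ← tangentCoord_chartVec hy a']
  rw [h]

theorem IsSolIn.eventuallyEq {p : M} {γ₁ γ₂ : ℝ → M} {t : ℝ} (h₁ : IsSolIn (n := n) p γ₁ t)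
    (h₂ : IsSolIn (n := n) p γ₂ t)
    (h : extChartAt (𝓡 n) p (γ₁ t) = extChartAt (𝓡 n) p (γ₂ t))
    (h' : deriv (fun σ => extChartAt (𝓡 n) p (γ₁ σ)) t = deriv (fun σ => extChartAt (𝓡 n) p (γ₂ σ)) t) :
    γ₁ =ᶠ[𝓝 t] γ₂ := by
  have := LocalMetric.eventuallyEq_of_isSolAt (g := chartLM p) (h₁.mono fun τ hτ => hτ.2.2)
    (h₂.mono fun τ hτ => hτ.2.2) h h'
  filter_upwards [this, h₁, h₂] with τ h3 h4 h5
  exact (extChartAt (𝓡 n) p).injOn h4.2.1 h5.2.1 h3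

/-- `γ` solves the geodesic equation on `s`. -/
def IsGeodesicOn (n : ℕ) {M : Type*} [MetricSpace M] [ChartedSpace (EuclideanSpace ℝ (Fin n)) M]
    [IsManifold (𝓡 n) ∞ M] [RiemannianBundle (fun x : M => TangentSpace (𝓡 n) x)]
    [IsContMDiffRiemannianBundle (𝓡 n) ∞ (EuclideanSpace ℝ (Fin n))
      (fun x : M => TangentSpace (𝓡 n) x)] (γ : ℝ → M) (s : Set ℝ) : Prop :=
  ∀ t ∈ s, IsSolIn (n := n) (γ t) γ t

theorem IsSolIn.toPreferred {p : M} {γ : ℝ → M} {t : ℝ} (h : IsSolIn (n := n) p γ t) :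
    IsSolIn (n := n) (γ t) γ t := h.changeChart (mem_extChartAt_source _)

theorem IsGeodesic.isGeodesicOn {γ : ℝ → M} (h : IsGeodesic (n := n) γ) (s : Set ℝ) :
    IsGeodesicOn n γ s := fun _ _ => h.isSolIn (mem_extChartAt_source _)

theorem IsGeodesicOn.isGeodesic {γ : ℝ → M} (h : IsGeodesicOn n γ univ) :
    IsGeodesic (n := n) γ := isGeodesic_of_forall fun t => ⟨_, h t trivial⟩

/-- The set of times at which the germs agree is open by definition. It is relatively closed because
positions and velocities pass to the limit, where local uniqueness applies. -/
theorem IsGeodesicOn.eqOn {γ₁ γ₂ : ℝ → M} {s : Set ℝ} (h₁ : IsGeodesicOn n γ₁ s)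
    (h₂ : IsGeodesicOn n γ₂ s) (hs : IsPreconnected s) {t₀ : ℝ} (ht₀ : t₀ ∈ s)
    (h : velocity (n := n) γ₁ t₀ = velocity γ₂ t₀) : ∀ t ∈ s, γ₁ =ᶠ[𝓝 t] γ₂ := by
  set A : Set ℝ := {t | γ₁ =ᶠ[𝓝 t] γ₂} with hA
  have hAo : IsOpen A := isOpen_setOfPred_eventually_nhds
  have h0 : γ₁ t₀ = γ₂ t₀ := congrArg TotalSpace.proj h
  refine hs.subset_of_closure_inter_subset hAo ⟨t₀, ht₀, ?_⟩ ?_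
  · have k2 : IsSolIn (n := n) (γ₁ t₀) γ₂ t₀ := by rw [h0]; exact h₂ t₀ ht₀
    rw [(h₁ t₀ ht₀).velocity_eq, k2.velocity_eq] at h
    have := chartVec_injective (h₁ t₀ ht₀).self_of_nhds.2.2.mem k2.self_of_nhds.2.2.mem h
    exact (h₁ t₀ ht₀).eventuallyEq k2 this.1 this.2
  · rintro t ⟨htA, hts⟩
    have hfr : ∃ᶠ τ in 𝓝 t, τ ∈ A := mem_closure_iff_frequently.1 htA
    have e1 : γ₁ t = γ₂ t := by
      by_contra hne
      have := ((h₁ t hts).self_of_nhds.1.prodMk (h₂ t hts).self_of_nhds.1).eventually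
        (isOpen_ne_fun continuous_fst continuous_snd |>.mem_nhds hne)
      obtain ⟨τ, a, b⟩ := (hfr.and_eventually this).exists
      exact b a.self_of_nhds
    have k2 : IsSolIn (n := n) (γ₁ t) γ₂ t := by rw [e1]; exact h₂ t hts
    refine (h₁ t hts).eventuallyEq k2 (by rw [e1]) ?_
    by_contra hne
    have := ((h₁ t hts).self_of_nhds.2.2.vel_deriv.continuousAt.prodMk
      k2.self_of_nhds.2.2.vel_deriv.continuousAt).eventually
        (isOpen_ne_fun continuous_fst continuous_snd |>.mem_nhds hne)
    obtain ⟨τ, a, b⟩ := (hfr.and_eventually this).exists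
    refine b (Filter.EventuallyEq.deriv_eq ?_)
    filter_upwards [(show γ₁ =ᶠ[𝓝 τ] γ₂ from a)] with σ hσ
    rw [hσ]

theorem velocity_congr {γ γ' : ℝ → M} {t : ℝ} (h : γ =ᶠ[𝓝 t] γ') :
    velocity (n := n) γ t = velocity γ' t := by
  have h1 : γ t = γ' t := h.self_of_nhds
  have h2 : (mfderiv 𝓘(ℝ, ℝ) (𝓡 n) γ t : ℝ →L[ℝ] 𝔼) = mfderiv 𝓘(ℝ, ℝ) (𝓡 n) γ' t := h.mfderiv_eq
  simp only [velocity, velocityVec]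
  rw [TotalSpace.mk.injEq]
  exact ⟨h1, heq_of_eq (congrArg (fun L : ℝ →L[ℝ] 𝔼 => L 1) h2)⟩

theorem IsSolIn.affine {p : M} {γ : ℝ → M} {t a b : ℝ} (h : IsSolIn (n := n) p γ (a * t + b)) :
    IsSolIn (n := n) p (fun τ => γ (a * τ + b)) t := by
  have hc : ContinuousAt (fun τ : ℝ => a * τ + b) t := by fun_prop
  refine isSolIn_of_eventually (v := fun τ =>
    a • deriv (fun σ => extChartAt (𝓡 n) p (γ σ)) (a * τ + b)) ?_
  filter_upwards [hc.eventually h] with τ hτ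
  refine ⟨ContinuousAt.comp (f := fun τ : ℝ => a * τ + b) hτ.1 (by fun_prop), hτ.2.1, ?_⟩
  exact hτ.2.2.affine

theorem IsSolIn.velocity_affine {p : M} {γ : ℝ → M} {t a b : ℝ}
    (h : IsSolIn (n := n) p γ (a * t + b)) :
    velocity (n := n) (fun τ => γ (a * τ + b)) t = scale a (velocity γ (a * t + b)) := by
  have h1 : HasDerivAt (fun τ : ℝ => a * τ + b) a t := by
    simpa using ((hasDerivAt_id t).const_mul a).add_const b
  have h2 := h.hasDerivAt.scomp t h1
  rw [velocity_eq_chartVec h.affine.self_of_nhds.1 h.self_of_nhds.2.1 h2, h.velocity_eq]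
  simp only [scale, chartVec]
  exact congrArg (TotalSpace.mk _) (map_smul (mfderiv 𝓘(ℝ, 𝔼) (𝓡 n) (extChartAt (𝓡 n) p).symm
    (extChartAt (𝓡 n) p (γ (a * t + b)))) a _)

theorem IsGeodesicOn.affine {γ : ℝ → M} {s : Set ℝ} (h : IsGeodesicOn n γ s) (a b : ℝ) :
    IsGeodesicOn n (fun τ => γ (a * τ + b)) ((fun τ => a * τ + b) ⁻¹' s) :=
  fun t ht => (h (a * t + b) ht).affine.toPreferred

theorem IsGeodesicOn.velocity_affine {γ : ℝ → M} {s : Set ℝ} (h : IsGeodesicOn n γ s) {a b t : ℝ}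
    (ht : a * t + b ∈ s) :
    velocity (n := n) (fun τ => γ (a * τ + b)) t = scale a (velocity γ (a * t + b)) :=
  (h _ ht).velocity_affine

theorem IsSolIn.hasDerivAt_norm_sq {p : M} {γ : ℝ → M} {t : ℝ} (h : IsSolIn (n := n) p γ t) :
    HasDerivAt (fun τ => ‖velocityVec (n := n) γ τ‖ ^ 2) 0 t := by
  refine h.self_of_nhds.2.2.hasDerivAt_energy.congr_of_eventuallyEq ?_
  filter_upwards [h.eventually] with τ hτ
  exact (congrArg (fun v : TangentBundle (𝓡 n) M => ‖v.2‖ ^ 2) hτ.velocity_eq).trans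
    (norm_chartVec_sq ..)

theorem IsGeodesicOn.norm_velocity_eq {γ : ℝ → M} {s : Set ℝ} (h : IsGeodesicOn n γ s)
    (hs : IsPreconnected s) (ho : IsOpen s) {t t' : ℝ} (ht : t ∈ s) (ht' : t' ∈ s) :
    ‖velocityVec (n := n) γ t‖ = ‖velocityVec (n := n) γ t'‖ := by
  have := ho.is_const_of_deriv_eq_zero (f := fun τ => ‖velocityVec (n := n) γ τ‖ ^ 2) hs
    (fun τ hτ => (h τ hτ).hasDerivAt_norm_sq.differentiableAt.differentiableWithinAt)
    (fun τ hτ => (h τ hτ).hasDerivAt_norm_sq.deriv) ht ht'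
  exact (sq_eq_sq₀ (norm_nonneg _) (norm_nonneg _)).1 this

variable (n M) in
theorem isContinuousRiemannianBundle :
    IsContinuousRiemannianBundle 𝔼 (fun x : M => TangentSpace (𝓡 n) x) := by
  obtain ⟨g, hg, h⟩ := IsContMDiffRiemannianBundle.exists_contMDiff (IB := 𝓡 n) (n := ∞) (F := 𝔼)
    (E := fun x : M => TangentSpace (𝓡 n) x)
  exact ⟨g, hg.continuous, h⟩

/-- Compares coordinate norms with Riemannian norms uniformly near `p`, so that the existence time
of the differential equation is uniform over Riemannian balls of velocities. -/
theorem eventually_norm_tangentCoord_le (p : M) :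
    ∃ C > 0, ∀ᶠ x in 𝓝 p, ∀ a : TangentSpace (𝓡 n) x, ‖tangentCoord p x a‖ ≤ C * ‖a‖ := by
  have := isContinuousRiemannianBundle n M
  have : IsManifold (𝓡 n) 1 M := IsManifold.of_le (n := ∞) (by simp)
  obtain ⟨C, hC, h⟩ := eventually_norm_mfderiv_extChartAt_lt (𝓡 n) p
  refine ⟨C, hC, h.mono fun x hx a => ?_⟩
  refine ((tangentCoord p x).le_opNorm a).trans ?_
  gcongr
  exact hx.le

theorem velocity_chart_symm {p : M} {b : ℝ → 𝔼} {b' : 𝔼} {t : ℝ}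
    (hb : b t ∈ (extChartAt (𝓡 n) p).target) (h : HasDerivAt b b' t) :
    velocity (n := n) (fun τ => (extChartAt (𝓡 n) p).symm (b τ)) t = chartVec p (b t) b' := by
  have hc : ContinuousAt (fun τ => (extChartAt (𝓡 n) p).symm (b τ)) t :=
    ContinuousAt.comp (f := b) (continuousAt_extChartAt_symm'' hb) h.continuousAt
  have he : (fun σ => extChartAt (𝓡 n) p ((extChartAt (𝓡 n) p).symm (b σ))) =ᶠ[𝓝 t] b := by
    filter_upwards [h.continuousAt.eventually ((isOpen_extChartAt_target p).mem_nhds hb)] with σ hσ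
    exact (extChartAt (𝓡 n) p).right_inv hσ
  rw [velocity_eq_chartVec hc ((extChartAt (𝓡 n) p).map_target hb) (h.congr_of_eventuallyEq he),
    (extChartAt (𝓡 n) p).right_inv hb]

theorem isGeodesicOn_chart_symm {p : M} {c v : ℝ → 𝔼} {s : Set ℝ} (hs : IsOpen s)
    (h : ∀ t ∈ s, (chartLM p).IsSolAt c v t) :
    IsGeodesicOn n (fun τ => (extChartAt (𝓡 n) p).symm (c τ)) s := by
  intro t ht
  refine IsSolIn.toPreferred (p := p) (isSolIn_of_eventually (v := v) ?_)
  filter_upwards [hs.mem_nhds ht] with τ hτ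
  have hm : c τ ∈ (extChartAt (𝓡 n) p).target := (h τ hτ).mem
  have he : (fun σ => extChartAt (𝓡 n) p ((extChartAt (𝓡 n) p).symm (c σ))) =ᶠ[𝓝 τ] c := by
    filter_upwards [hs.mem_nhds hτ] with σ hσ using (extChartAt (𝓡 n) p).right_inv (h σ hσ).mem
  refine ⟨?_, (extChartAt (𝓡 n) p).map_target hm, ?_, ?_, ?_⟩
  · exact ContinuousAt.comp (f := c) (continuousAt_extChartAt_symm'' hm)
      (h τ hτ).pos_deriv.continuousAt
  · rw [he.eq_of_nhds]; exact hm
  · exact (h τ hτ).pos_deriv.congr_of_eventuallyEq he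
  · rw [he.eq_of_nhds]; exact (h τ hτ).vel_deriv

/-- Local existence of geodesics, with uniform time. -/
theorem exists_local_geodesic (p : M) : ∃ ρ > 0, ∃ T > 0, ∀ᶠ x in 𝓝 p,
    ∀ a : TangentSpace (𝓡 n) x, ‖a‖ ≤ ρ → ∃ γ : ℝ → M,
      IsGeodesicOn n γ (Ioo (-T) T) ∧ velocity γ 0 = ⟨x, a⟩ := by
  have hp : extChartAt (𝓡 n) p p ∈ (chartLM p).dom :=
    (extChartAt (𝓡 n) p).map_source (mem_extChartAt_source _)
  obtain ⟨ρ, hρ, T, hT, c, v, hcv⟩ := (chartLM p).exists_sol (z₀ := (extChartAt (𝓡 n) p p, 0)) hp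
    Filter.univ_mem
  obtain ⟨C, hC, hev⟩ := eventually_norm_tangentCoord_le (n := n) p
  have h1 : ∀ᶠ x in 𝓝 p, dist (extChartAt (𝓡 n) p x) (extChartAt (𝓡 n) p p) < ρ :=
    (continuousAt_extChartAt p).eventually (Metric.ball_mem_nhds _ hρ)
  refine ⟨ρ / C, by positivity, T, hT, ?_⟩
  filter_upwards [hev, h1, extChartAt_source_mem_nhds (I := 𝓡 n) p] with x hx1 hx2 hx3 a ha
  set z : 𝔼 × 𝔼 := (extChartAt (𝓡 n) p x, tangentCoord p x a) with hz
  have hzm : z ∈ Metric.closedBall (extChartAt (𝓡 n) p p, (0 : 𝔼)) ρ := by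
    rw [Metric.mem_closedBall, Prod.dist_eq]
    refine max_le hx2.le ?_
    rw [dist_zero_right]
    refine (hx1 a).trans ?_
    rw [le_div_iff₀ hC] at ha
    linarith
  obtain ⟨h0, h0', hsol⟩ := hcv z hzm
  have hT0 : (0 : ℝ) ∈ Ioo (-T) T := ⟨by linarith, hT⟩
  refine ⟨fun τ => (extChartAt (𝓡 n) p).symm (c z τ),
    isGeodesicOn_chart_symm isOpen_Ioo fun t ht => (hsol t ht).1, ?_⟩
  rw [velocity_chart_symm (hsol 0 hT0).1.mem (hsol 0 hT0).1.pos_deriv, h0, h0']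
  exact chartVec_tangentCoord hx3 a

/-- The length of a curve is bounded by the increment of a function whose derivative dominates the
speed. -/
theorem pathELength_le {c : ℝ → M} {a b : ℝ} (hab : a ≤ b) {K K' : ℝ → ℝ}
    (hK : ∀ t ∈ Icc a b, HasDerivAt K (K' t) t)
    (hv : ∀ t ∈ Ioo a b, ‖velocityVec (n := n) c t‖ ≤ K' t) :
    Manifold.pathELength (𝓡 n) c a b ≤ ENNReal.ofReal (K b - K a) := by
  have hcont : ContinuousOn K (Icc a b) := fun t ht => (hK t ht).continuousAt.continuousWithinAt
  have hpos : ∀ t ∈ Ioo a b, 0 ≤ K' t := fun t ht => (norm_nonneg _).trans (hv t ht)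
  have hint : MeasureTheory.IntegrableOn K' (Ioc a b) :=
    intervalIntegral.integrableOn_deriv_of_nonneg hcont
      (fun t ht => hK t (Ioo_subset_Icc_self ht)) hpos
  have hI := intervalIntegral.integral_eq_sub_of_hasDerivAt_of_le hab hcont
    (fun t ht => hK t (Ioo_subset_Icc_self ht))
    ((intervalIntegrable_iff_integrableOn_Ioc_of_le hab).2 hint)
  rw [intervalIntegral.integral_of_le hab, MeasureTheory.integral_Ioc_eq_integral_Ioo] at hI
  rw [Manifold.pathELength_eq_lintegral_mfderiv_Ioo, ← hI,
    MeasureTheory.ofReal_integral_eq_lintegral_ofReal (hint.mono_set Ioo_subset_Ioc_self)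
      (MeasureTheory.ae_restrict_of_forall_mem measurableSet_Ioo hpos)]
  refine MeasureTheory.setLIntegral_mono' measurableSet_Ioo fun t ht => ?_
  rw [← ofReal_norm]
  exact ENNReal.ofReal_le_ofReal (hv t ht)

/-! ### Distance bounds from speed bounds. -/

section Distance

variable [IsRiemannianManifold (𝓡 n) M]

theorem dist_le_of_norm_velocity_le {c : ℝ → M} {a b : ℝ} (hab : a ≤ b) {K K' : ℝ → ℝ}
    (hc : ContMDiffOn 𝓘(ℝ, ℝ) (𝓡 n) 1 c (Icc a b))
    (hK : ∀ t ∈ Icc a b, HasDerivAt K (K' t) t)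
    (hv : ∀ t ∈ Ioo a b, ‖velocityVec (n := n) c t‖ ≤ K' t) :
    dist (c a) (c b) ≤ K b - K a := by
  -- The sign is needed because `ENNReal.ofReal` truncates at zero.
  have h0 : K a ≤ K b := monotoneOn_of_hasDerivWithinAt_nonneg (convex_Icc a b)
    (fun t ht => (hK t ht).continuousAt.continuousWithinAt)
    (fun t ht => (hK t (interior_subset ht)).hasDerivWithinAt)
    (fun t ht => (norm_nonneg _).trans (hv t (by rwa [interior_Icc] at ht)))
    (left_mem_Icc.2 hab) (right_mem_Icc.2 hab) hab
  have h1 : edist (c a) (c b) ≤ ENNReal.ofReal (K b - K a) := by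
    rw [IsRiemannianManifold.out (I := 𝓡 n) (c a) (c b)]
    exact (Manifold.riemannianEDist_le_pathELength hc rfl rfl hab).trans
      (pathELength_le hab hK hv)
  rw [edist_dist] at h1
  exact (ENNReal.ofReal_le_ofReal_iff (by linarith)).1 h1

theorem IsGeodesicOn.dist_le {γ : ℝ → M} {s : Set ℝ} (h : IsGeodesicOn n γ s)
    (hs : OrdConnected s) {σ : ℝ} (hσ : ∀ t ∈ s, ‖velocityVec (n := n) γ t‖ ≤ σ) {a b : ℝ}
    (ha : a ∈ s) (hb : b ∈ s) : dist (γ a) (γ b) ≤ σ * |b - a| := by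
  have hσ0 : 0 ≤ σ := (norm_nonneg _).trans (hσ a ha)
  have key : ∀ a b, a ∈ s → b ∈ s → a ≤ b → dist (γ a) (γ b) ≤ σ * |b - a| := by
    intro a b ha hb hab
    have hsub : Icc a b ⊆ s := hs.out ha hb
    have := dist_le_of_norm_velocity_le (n := n) (c := γ) (K := fun t => σ * t) (K' := fun _ => σ) hab
      (fun t ht => ((h t (hsub ht)).contMDiffAt.of_le (by simp)).contMDiffWithinAt)
      (fun t _ => by simpa using (hasDerivAt_id t).const_mul σ)
      (fun t ht => hσ t (hsub (Ioo_subset_Icc_self ht)))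
    rw [abs_of_nonneg (by linarith)]
    linarith
  rcases le_total a b with hab | hab
  · exact key a b ha hb hab
  · rw [dist_comm, abs_sub_comm]; exact key b a hb ha hab

end Distance

end SingularFoliation

/-! ### Completeness of geodesics -/

namespace SingularFoliation

set_option maxSynthPendingDepth 3

variable {n : ℕ} {M : Type*} [MetricSpace M] [ChartedSpace (EuclideanSpace ℝ (Fin n)) M]

local notation "𝔼" => EuclideanSpace ℝ (Fin n)

variable [IsManifold (𝓡 n) ∞ M] [RiemannianBundle (fun x : M => TangentSpace (𝓡 n) x)]

theorem scale_scale (a b : ℝ) (v : TangentBundle (𝓡 n) M) : scale a (scale b v) = scale (a * b) v := by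
  exact congrArg (TotalSpace.mk _) (smul_smul a b v.2)

theorem scale_one (v : TangentBundle (𝓡 n) M) : scale 1 v = v := by
  obtain ⟨x, a⟩ := v
  simp [scale]

variable [IsContMDiffRiemannianBundle (𝓡 n) ∞ (EuclideanSpace ℝ (Fin n))
    (fun x : M => TangentSpace (𝓡 n) x)]

theorem IsGeodesicOn.mono {γ : ℝ → M} {s s' : Set ℝ} (h : IsGeodesicOn n γ s) (hs : s' ⊆ s) :
    IsGeodesicOn n γ s' := fun t ht => h t (hs ht)

theorem IsGeodesicOn.glue {γ η : ℝ → M} {a b a' b' t₁ : ℝ} (hγ : IsGeodesicOn n γ (Ioo a b))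
    (hη : IsGeodesicOn n η (Ioo a' b')) (h1 : t₁ ∈ Ioo a b) (h2 : t₁ ∈ Ioo a' b')
    (hv : velocity (n := n) γ t₁ = velocity η t₁) :
    ∃ ζ : ℝ → M, IsGeodesicOn n ζ (Ioo a b') ∧ ∀ t < t₁, ζ =ᶠ[𝓝 t] γ := by
  classical
  set ζ : ℝ → M := fun t => if t < t₁ then γ t else η t with hζ
  have e1 : ∀ t < t₁, ζ =ᶠ[𝓝 t] γ := fun t ht => by
    filter_upwards [isOpen_Iio.mem_nhds ht] with σ hσ
    simp [hζ, mem_Iio.1 hσ]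
  have e2 : ∀ t > t₁, ζ =ᶠ[𝓝 t] η := fun t ht => by
    filter_upwards [isOpen_Ioi.mem_nhds ht] with σ hσ
    simp [hζ, (mem_Ioi.1 hσ).le]
  have e3 : γ =ᶠ[𝓝 t₁] η :=
    (hγ.mono (inter_subset_left (t := Ioo a' b'))).eqOn (hη.mono inter_subset_right)
      (by rw [Ioo_inter_Ioo]; exact isPreconnected_Ioo) ⟨h1, h2⟩ hv t₁ ⟨h1, h2⟩
  refine ⟨ζ, fun t ht => ?_, e1⟩
  rcases lt_trichotomy t t₁ with h | h | h
  · exact ((hγ t ⟨ht.1, h.trans h1.2⟩).congr (e1 t h)).toPreferred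
  · subst h
    refine ((hη t h2).congr ?_).toPreferred
    filter_upwards [e3] with σ hσ
    simp only [hζ]
    split_ifs <;> simp [hσ]
  · exact ((hη t ⟨h2.1.trans h, ht.2⟩).congr (e2 t h)).toPreferred

theorem IsGeodesicOn.reverse {γ : ℝ → M} {a b : ℝ} (h : IsGeodesicOn n γ (Ioo a b)) :
    IsGeodesicOn n (fun t => γ (-1 * t + 0)) (Ioo (-b) (-a)) :=
  (h.affine (-1) 0).mono fun t ht => ⟨by linarith [ht.2], by linarith [ht.1]⟩

theorem IsGeodesic.ext {γ γ' : ℝ → M} (h : IsGeodesic (n := n) γ) (h' : IsGeodesic (n := n) γ')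
    {t : ℝ} (hv : velocity (n := n) γ t = velocity γ' t) : γ = γ' :=
  funext fun s => ((h.isGeodesicOn univ).eqOn (h'.isGeodesicOn univ) isPreconnected_univ trivial hv
    s trivial).self_of_nhds

theorem IsGeodesic.affine {γ : ℝ → M} (h : IsGeodesic (n := n) γ) (a b : ℝ) :
    IsGeodesic (n := n) fun t => γ (a * t + b) :=
  IsGeodesicOn.isGeodesic ((h.isGeodesicOn univ).affine a b)

theorem IsGeodesic.velocity_affine {γ : ℝ → M} (h : IsGeodesic (n := n) γ) (a b t : ℝ) :
    velocity (n := n) (fun t => γ (a * t + b)) t = scale a (velocity γ (a * t + b)) :=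
  (h.isGeodesicOn univ).velocity_affine trivial

/-- Uniqueness of geodesics removes the choice in the definition of `exp`. -/
theorem IsGeodesic.exp_eq {γ : ℝ → M} (h : IsGeodesic (n := n) γ) :
    exp (velocity (n := n) γ 0) = γ 1 := by
  have hex : ∃ γ' : ℝ → M, IsGeodesic (n := n) γ' ∧
      velocity (n := n) γ' 0 = velocity γ 0 := ⟨γ, h, rfl⟩
  rw [exp, dif_pos hex, hex.choose_spec.1.ext h hex.choose_spec.2]

theorem IsGeodesic.exp_scale {γ : ℝ → M} (h : IsGeodesic (n := n) γ) (t : ℝ) :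
    exp (scale t (velocity (n := n) γ 0)) = γ t := by
  have h1 := (h.affine t 0).exp_eq
  rw [h.velocity_affine] at h1
  simpa using h1

theorem IsGeodesic.norm_velocity {γ : ℝ → M} (h : IsGeodesic (n := n) γ) (t t' : ℝ) :
    ‖velocityVec (n := n) γ t‖ = ‖velocityVec (n := n) γ t'‖ :=
  (h.isGeodesicOn univ).norm_velocity_eq isPreconnected_univ isOpen_univ trivial trivial

variable [IsRiemannianManifold (𝓡 n) M] [CompleteSpace M]

/-- Constant speed makes the points at times tending to `b` a Cauchy sequence, which converges by
completeness. Near the limit geodesics exist for a uniform time, so one restarted close enough to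
`b` passes it. -/
theorem IsGeodesicOn.extend_right {γ : ℝ → M} {a b : ℝ} (h : IsGeodesicOn n γ (Ioo a b))
    (ha : a < 0) (hb : 0 < b) : ∃ δ > 0, ∃ ζ : ℝ → M, IsGeodesicOn n ζ (Ioo a (b + δ)) ∧
      velocity (n := n) ζ 0 = velocity γ 0 := by
  set σ := ‖velocityVec (n := n) γ 0‖ with hσdef
  have h0 : (0 : ℝ) ∈ Ioo a b := ⟨ha, hb⟩
  have hσ : ∀ t ∈ Ioo a b, ‖velocityVec (n := n) γ t‖ = σ := fun t ht =>
    h.norm_velocity_eq isPreconnected_Ioo isOpen_Ioo ht h0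
  set u : ℕ → ℝ := fun k => b - b / 2 * (1 / ((k : ℝ) + 1)) with hu
  have hlim : Filter.Tendsto u Filter.atTop (𝓝 b) := by
    have := (tendsto_one_div_add_atTop_nhds_zero_nat (𝕜 := ℝ)).const_mul (b / 2) |>.const_sub b
    simpa [hu] using this
  have hmem : ∀ k, 0 < u k ∧ u k < b := fun k => by
    have h1 : (0 : ℝ) < 1 / ((k : ℝ) + 1) := by positivity
    have h2 : 1 / ((k : ℝ) + 1) ≤ 1 := by
      rw [div_le_one (by positivity)]; linarith [Nat.cast_nonneg (α := ℝ) k]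
    constructor <;> simp only [hu] <;> nlinarith
  have hmem' : ∀ k, u k ∈ Ioo a b := fun k => ⟨ha.trans (hmem k).1, (hmem k).2⟩
  have hcau : CauchySeq fun k => γ (u k) := by
    rw [Metric.cauchySeq_iff]
    intro ε hε
    obtain ⟨N, hN⟩ := Metric.cauchySeq_iff.1 hlim.cauchySeq (ε / (σ + 1)) (by positivity)
    refine ⟨N, fun k hk l hl => ?_⟩
    have h1 := h.dist_le ordConnected_Ioo (fun t ht => (hσ t ht).le) (hmem' k) (hmem' l)
    have h2 := hN l hl k hk
    rw [Real.dist_eq, lt_div_iff₀ (by positivity)] at h2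
    nlinarith [abs_nonneg (u l - u k)]
  obtain ⟨x, hx⟩ := cauchySeq_tendsto_of_complete hcau
  obtain ⟨ρ, hρ, T, hT, hloc⟩ := exists_local_geodesic (n := n) x
  -- The velocity is shortened by κ to have length at most ρ; after undoing the rescaling the new
  -- piece lasts a time κT on both sides of its start, independently of the starting time `u k`.
  set κ := ρ / (σ + 1) with hκ
  have hσ0 : 0 ≤ σ := norm_nonneg _
  have hκ0 : 0 < κ := by positivity
  have hev : ∀ᶠ k in Filter.atTop, b - κ * T < u k :=
    hlim.eventually (lt_mem_nhds (by linarith [mul_pos hκ0 hT]))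
  obtain ⟨k, hk1, hk2⟩ := ((hx.eventually hloc).and hev).exists
  obtain ⟨η, hη, hηv⟩ := hk1 (κ • velocityVec (n := n) γ (u k)) (by
    rw [norm_smul, hσ _ (hmem' k), Real.norm_eq_abs, abs_of_pos hκ0, hκ, div_mul_eq_mul_div,
      div_le_iff₀ (by positivity)]
    nlinarith)
  have hηv' : velocity (n := n) η 0 = scale κ (velocity γ (u k)) := hηv
  have hη2 : IsGeodesicOn n (fun τ => η (κ⁻¹ * τ + -(κ⁻¹ * u k))) (Ioo (u k - κ * T) (u k + κ * T)) := by
    refine (hη.affine κ⁻¹ (-(κ⁻¹ * u k))).mono fun τ hτ => ?_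
    have e : κ⁻¹ * τ + -(κ⁻¹ * u k) = (τ - u k) / κ := by field_simp; ring
    simp only [mem_preimage, e, mem_Ioo, lt_div_iff₀ hκ0, div_lt_iff₀ hκ0]
    constructor <;> nlinarith [hτ.1, hτ.2]
  have e0 : κ⁻¹ * u k + -(κ⁻¹ * u k) = 0 := by ring
  have hv : velocity (n := n) γ (u k) = velocity (fun τ => η (κ⁻¹ * τ + -(κ⁻¹ * u k))) (u k) := by
    rw [hη.velocity_affine (by rw [e0]; exact ⟨by linarith, hT⟩), e0, hηv', scale_scale,
      inv_mul_cancel₀ hκ0.ne', scale_one]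
  have hκT := mul_pos hκ0 hT
  obtain ⟨ζ, hζ1, hζ2⟩ := h.glue hη2 (hmem' k) ⟨by linarith, by linarith⟩ hv
  refine ⟨u k + κ * T - b, by linarith, ζ, ?_, velocity_congr (hζ2 0 (hmem k).1)⟩
  rwa [add_sub_cancel]

theorem IsGeodesicOn.extend {γ : ℝ → M} {T : ℝ} (h : IsGeodesicOn n γ (Ioo (-T) T)) (hT : 0 < T) :
    ∃ δ > 0, ∃ ζ : ℝ → M, IsGeodesicOn n ζ (Ioo (-(T + δ)) (T + δ)) ∧
      velocity (n := n) ζ 0 = velocity γ 0 := by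
  obtain ⟨δ₁, hδ₁, ζ, hζ, hζv⟩ := h.extend_right (by linarith) hT
  obtain ⟨δ₂, hδ₂, ξ, hξ, hξv⟩ := (hζ.reverse).extend_right (by linarith) (by linarith)
  refine ⟨min δ₁ δ₂, lt_min hδ₁ hδ₂, fun t => ξ (-1 * t + 0), hξ.reverse.mono ?_, ?_⟩
  · refine Ioo_subset_Ioo ?_ ?_
    · linarith [min_le_right δ₁ δ₂]
    · linarith [min_le_left δ₁ δ₂]
  · have e : (-1 : ℝ) * 0 + 0 = 0 := by ring
    rw [hξ.velocity_affine (by rw [e]; constructor <;> linarith), e, hξv,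
      hζ.velocity_affine (by rw [e]; constructor <;> linarith), e, hζv, scale_scale]
    norm_num [scale_one]

/-- Hopf-Rinow: if the existence times were bounded, a solution would exist up to their supremum by
gluing, and the extension lemma would carry it further. -/
theorem exists_geodesic (v : TangentBundle (𝓡 n) M) :
    ∃ γ : ℝ → M, IsGeodesic (n := n) γ ∧ velocity γ 0 = v := by
  set D : ℝ → Prop := fun T => ∃ γ : ℝ → M, IsGeodesicOn n γ (Ioo (-T) T) ∧ velocity γ 0 = v with hD
  have hmono : ∀ T T', T' ≤ T → D T → D T' := fun T T' hT ⟨γ, h1, h2⟩ =>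
    ⟨γ, h1.mono (Ioo_subset_Ioo (by linarith) hT), h2⟩
  -- Solutions with initial velocity `v` agree on common intervals, so at each time the value may be
  -- taken from any solution that reaches it.
  have hglue : ∀ (s : Set ℝ) (τ : ℝ → ℝ), IsOpen s → 0 ∈ s → (∀ t ∈ s, |t| < τ t ∧ D (τ t)) →
      ∃ γ : ℝ → M, IsGeodesicOn n γ s ∧ velocity γ 0 = v := by
    intro s τ hs h0 hτ
    have hch : ∀ T, ∃ γ : ℝ → M, D T → IsGeodesicOn n γ (Ioo (-T) T) ∧ velocity γ 0 = v := fun T => by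
      by_cases h : D T
      · obtain ⟨γ, hγ⟩ := h
        exact ⟨γ, fun _ => hγ⟩
      · exact ⟨fun _ => v.proj, fun h' => absurd h' h⟩
    choose G hG using hch
    have hI : ∀ t ∈ s, t ∈ Ioo (-(τ t)) (τ t) := fun t ht => abs_lt.1 (hτ t ht).1
    have heq : ∀ t ∈ s, (fun σ => G (τ σ) σ) =ᶠ[𝓝 t] G (τ t) := fun t ht => by
      filter_upwards [hs.mem_nhds ht, isOpen_Ioo.mem_nhds (hI t ht)] with σ hσ hσ'
      obtain ⟨a1, a2⟩ := hG _ (hτ σ hσ).2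
      obtain ⟨b1, b2⟩ := hG _ (hτ t ht).2
      have hz : (0 : ℝ) ∈ Ioo (-(τ σ)) (τ σ) ∩ Ioo (-(τ t)) (τ t) := by
        have h1 := (abs_nonneg σ).trans_lt (hτ σ hσ).1
        have h2 := (abs_nonneg t).trans_lt (hτ t ht).1
        exact ⟨⟨by linarith, h1⟩, by linarith, h2⟩
      exact ((a1.mono inter_subset_left).eqOn (b1.mono inter_subset_right)
        (by rw [Ioo_inter_Ioo]; exact isPreconnected_Ioo) hz (by rw [a2, b2]) σ
        ⟨hI σ hσ, hσ'⟩).self_of_nhds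
    refine ⟨fun σ => G (τ σ) σ, fun t ht => ?_, ?_⟩
    · exact (((hG _ (hτ t ht).2).1 t (hI t ht)).congr (heq t ht)).toPreferred
    · rw [velocity_congr (heq 0 h0)]
      exact (hG _ (hτ 0 h0).2).2
  have hall : ∀ T, D T := by
    by_contra hne
    push Not at hne
    obtain ⟨T₀, hT₀⟩ := hne
    obtain ⟨ρ, hρ, T₁, hT₁, hloc⟩ := exists_local_geodesic (n := n) v.proj
    have hD₁ : ∃ T > 0, D T := by
      set κ := ρ / (‖v.2‖ + 1)
      have hκ0 : 0 < κ := by positivity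
      obtain ⟨γ, hγ, hγv⟩ := hloc.self_of_nhds (κ • v.2) (by
        rw [norm_smul, Real.norm_eq_abs, abs_of_pos hκ0, div_mul_eq_mul_div,
          div_le_iff₀ (by positivity)]
        nlinarith [norm_nonneg v.2])
      have hγv' : velocity (n := n) γ 0 = scale κ v := hγv
      refine ⟨κ * T₁, by positivity, fun t => γ (κ⁻¹ * t + 0), (hγ.affine κ⁻¹ 0).mono fun t ht => ?_, ?_⟩
      · have e : κ⁻¹ * t + 0 = t / κ := by field_simp; ring
        simp only [mem_preimage, e, mem_Ioo, lt_div_iff₀ hκ0, div_lt_iff₀ hκ0]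
        constructor <;> nlinarith [ht.1, ht.2]
      · have e : κ⁻¹ * 0 + 0 = 0 := by ring
        rw [hγ.velocity_affine (by rw [e]; constructor <;> linarith), e, hγv', scale_scale,
          inv_mul_cancel₀ hκ0.ne', scale_one]
    obtain ⟨T₂, hT₂, hDT₂⟩ := hD₁
    have hbdd : BddAbove {T | D T} :=
      ⟨T₀, fun T hT => le_of_not_ge fun h => hT₀ (hmono _ _ h hT)⟩
    set s := sSup {T | D T} with hsdef
    have hs2 : T₂ ≤ s := le_csSup hbdd hDT₂
    have hs0 : 0 < s := hT₂.trans_le hs2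
    have hDs : D s := by
      refine hglue (Ioo (-s) s) (fun t => (|t| + s) / 2) isOpen_Ioo ⟨by linarith, hs0⟩ fun t ht => ?_
      have ht' : |t| < s := abs_lt.2 ht
      refine ⟨by linarith, ?_⟩
      obtain ⟨T, hT, hlt⟩ := exists_lt_of_lt_csSup ⟨T₂, hDT₂⟩ (show (|t| + s) / 2 < s by linarith)
      exact hmono _ _ hlt.le hT
    obtain ⟨γ, hγ, hγv⟩ := hDs
    obtain ⟨δ, hδ, ζ, hζ, hζv⟩ := hγ.extend hs0
    have : s + δ ≤ s := le_csSup hbdd ⟨ζ, hζ, hζv.trans hγv⟩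
    linarith
  obtain ⟨γ, h1, h2⟩ := hglue univ (fun t => |t| + 1) isOpen_univ trivial
    fun t _ => ⟨by linarith, hall _⟩
  exact ⟨γ, h1.isGeodesic, h2⟩

theorem isGeodesic_exp (v : TangentBundle (𝓡 n) M) :
    IsGeodesic (n := n) (fun t => exp (scale t v)) ∧
      velocity (n := n) (fun t => exp (scale t v)) 0 = v := by
  obtain ⟨γ, h1, h2⟩ := exists_geodesic v
  have : (fun t => exp (scale t v)) = γ := funext fun t => by rw [← h2, h1.exp_scale]
  rw [this]
  exact ⟨h1, h2⟩

theorem exp_scale_zero (v : TangentBundle (𝓡 n) M) : exp (scale 0 v) = v.proj :=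
  congrArg TotalSpace.proj (isGeodesic_exp v).2

end SingularFoliation

/-! ### Minimizing geodesics -/

namespace SingularFoliation

set_option maxSynthPendingDepth 3

variable {n : ℕ} {M : Type*} [MetricSpace M] [ChartedSpace (EuclideanSpace ℝ (Fin n)) M]

local notation "𝔼" => EuclideanSpace ℝ (Fin n)

variable [IsManifold (𝓡 n) ∞ M] [RiemannianBundle (fun x : M => TangentSpace (𝓡 n) x)]
  [IsContMDiffRiemannianBundle (𝓡 n) ∞ (EuclideanSpace ℝ (Fin n))
    (fun x : M => TangentSpace (𝓡 n) x)]

theorem continuous_norm_velocity {c : ℝ → M} (hc : ContMDiff 𝓘(ℝ, ℝ) (𝓡 n) 1 c) :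
    Continuous fun t => ‖velocityVec (n := n) c t‖ := by
  have := isContinuousRiemannianBundle n M
  have h1 : Continuous (tangentMap 𝓘(ℝ, ℝ) (𝓡 n) c) := hc.continuous_tangentMap le_rfl
  have h2 : Continuous (fun t : ℝ => (⟨t, (1 : ℝ)⟩ : TangentBundle 𝓘(ℝ, ℝ) ℝ)) :=
    (tangentBundleModelSpaceHomeomorph 𝓘(ℝ, ℝ)).symm.continuous.comp
      (continuous_id.prodMk continuous_const : Continuous fun t : ℝ => ((t, (1 : ℝ)) : ℝ × ℝ))
  have h3 : Continuous (fun t => velocity (n := n) c t) := h1.comp h2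
  have h4 : Continuous fun t => ⟪velocityVec (n := n) c t, velocityVec (n := n) c t⟫ :=
    Continuous.inner_bundle h3 h3
  simp only [real_inner_self_eq_norm_sq] at h4
  simpa [Real.sqrt_sq (norm_nonneg _)] using h4.sqrt

/-- A continuous function whose upper right derivatives along `C¹` curves are bounded by the speed
is 1-Lipschitz. -/
theorem sub_le_dist_of_slope [IsRiemannianManifold (𝓡 n) M] {f : M → ℝ} (hf : Continuous f)
    (h : ∀ c : ℝ → M, ContMDiff 𝓘(ℝ, ℝ) (𝓡 n) 1 c → ∀ t r, ‖velocityVec (n := n) c t‖ < r →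
      ∃ᶠ z in 𝓝[>] t, slope (f ∘ c) t z < r) (x y : M) : f y - f x ≤ dist x y := by
  refine le_of_forall_gt_imp_ge_of_dense fun d hd => ?_
  have hlt : Manifold.riemannianEDist (𝓡 n) x y < ENNReal.ofReal d := by
    rw [← IsRiemannianManifold.out (I := 𝓡 n) x y, edist_dist]
    exact (ENNReal.ofReal_lt_ofReal_iff (dist_nonneg.trans_lt hd)).2 hd
  obtain ⟨c, h0, h1, hc, hlen, -⟩ :=
    Manifold.exists_lt_locally_constant_of_riemannianEDist_lt hlt zero_lt_one
  have hcont := continuous_norm_velocity hc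
  have hint : Manifold.pathELength (𝓡 n) c 0 1 =
      ENNReal.ofReal (∫ t in (0 : ℝ)..1, ‖velocityVec (n := n) c t‖) := by
    rw [intervalIntegral.integral_of_le zero_le_one, MeasureTheory.ofReal_integral_eq_lintegral_ofReal
      (hcont.integrableOn_Ioc) (Filter.Eventually.of_forall fun t => norm_nonneg _),
      Manifold.pathELength, MeasureTheory.restrict_Ioc_eq_restrict_Icc]
    refine MeasureTheory.lintegral_congr fun t => ?_
    exact (ofReal_norm _).symm
  rw [hint, ENNReal.ofReal_lt_ofReal_iff (dist_nonneg.trans_lt hd)] at hlen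
  have := image_le_of_liminf_slope_right_le_deriv_boundary (f := f ∘ c) (a := 0) (b := 1)
    (B := fun s => f x + ∫ t in (0 : ℝ)..s, ‖velocityVec (n := n) c t‖)
    (B' := fun s => ‖velocityVec (n := n) c s‖)
    (hf.comp hc.continuous).continuousOn (by simp [h0])
    (continuous_const.add (intervalIntegral.continuous_primitive
      (fun a b => hcont.intervalIntegrable a b) 0)).continuousOn
    (fun s _ => ((hcont.integral_hasStrictDerivAt 0 s).hasDerivAt.const_add (f x)).hasDerivWithinAt)
    (fun s _ r hr => h c hc s r hr) (right_mem_Icc.2 zero_le_one)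
  simp only [Function.comp, h1] at this
  linarith

theorem coeff_mul_self_le (p : M) (y a b : 𝔼) :
    (chartLM p).coeff y a b ≤ √((chartLM p).coeff y a a) * √((chartLM p).coeff y b b) := by
  rw [coeff_eq_inner p y a b, ← norm_chartVec_sq, ← norm_chartVec_sq, Real.sqrt_sq (norm_nonneg _),
    Real.sqrt_sq (norm_nonneg _)]
  exact real_inner_le_norm _ _

theorem hasDerivAt_chart_comp {c : ℝ → M} {t : ℝ} {p : M}
    (hc : MDifferentiableAt 𝓘(ℝ, ℝ) (𝓡 n) c t) (hp : c t ∈ (extChartAt (𝓡 n) p).source) :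
    HasDerivAt (fun τ => extChartAt (𝓡 n) p (c τ)) (tangentCoord p (c t) (velocityVec c t)) t := by
  have h1 := ((contMDiffAt_chart hp).mdifferentiableAt (by simp)).hasMFDerivAt.comp t hc.hasMFDerivAt
  have h2 : HasFDerivAt (fun τ => extChartAt (𝓡 n) p (c τ)) ((tangentCoord p (c t)).comp
    (mfderiv 𝓘(ℝ, ℝ) (𝓡 n) c t : ℝ →L[ℝ] TangentSpace (𝓡 n) (c t)) : ℝ →L[ℝ] 𝔼) t :=
    h1.hasFDerivAt
  exact h2.hasDerivAt

/-- Truncation by a constant keeps right slopes below a positive bound; this allows a radial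
function to be continued by a constant outside a normal ball. -/
theorem slope_min_const_lt {G : ℝ → ℝ} {G' t r : ℝ} (cap : ℝ) (hG : HasDerivAt G G' t)
    (hr : G' < r) (hr0 : 0 < r) : ∀ᶠ z in 𝓝[>] t, slope (fun τ => min (G τ) cap) t z < r := by
  rcases le_or_gt cap (G t) with h | h
  · filter_upwards [self_mem_nhdsWithin] with z hz
    have hz' : 0 < z - t := sub_pos.2 hz
    rw [slope_def_field, div_lt_iff₀ hz', min_eq_right h]
    have := min_le_right (G z) cap
    nlinarith
  · have h1 := hG.hasDerivWithinAt (s := Ioi t) |>.limsup_slope_le' (by simp) hr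
    filter_upwards [h1, self_mem_nhdsWithin] with z hz1 hz
    have hz' : 0 < z - t := sub_pos.2 hz
    rw [slope_def_field, div_lt_iff₀ hz'] at hz1 ⊢
    rw [min_eq_left h.le]
    have := min_le_left (G z) cap
    linarith

variable [IsRiemannianManifold (𝓡 n) M] [CompleteSpace M]

/-- Nearby points are joined by minimizing geodesics. -/
theorem exists_minimizing_geodesic (x : M) : ∃ ε > 0, ∀ z, 0 < dist x z → dist x z < ε →
    ∃ γ : ℝ → M, IsGeodesic (n := n) γ ∧ ‖velocityVec (n := n) γ 0‖ = 1 ∧ γ 0 = x ∧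
      γ (dist x z) = z := by
  set y₀ := extChartAt (𝓡 n) x x with hy₀
  have hxs : x ∈ (extChartAt (𝓡 n) x).source := mem_extChartAt_source _
  have hy : y₀ ∈ (chartLM x).dom := (extChartAt (𝓡 n) x).map_source hxs
  obtain ⟨ρ, hρ, T, hT, c, v, W, hsol, hcont, hopen, hder⟩ := (chartLM x).exists_normal_coordinates hy
  set N : 𝔼 → ℝ := fun w => (chartLM x).coeff y₀ w w with hN
  have hN0 : ∀ w, 0 ≤ N w := fun w => LocalMetric.nonneg hy w
  -- The quadratic form has a positive minimum on the sphere of radius ρ/2; by homogeneity smaller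
  -- values occur only inside it.
  obtain ⟨s, hs, hNs⟩ : ∃ s > 0, ∀ w, N w < s ^ 2 → ‖w‖ < ρ / 2 := by
    have hNc : Continuous N :=
      ((chartLM x).coeff y₀).continuous.clm_apply continuous_id
    rcases (Metric.sphere (0 : 𝔼) (ρ / 2)).eq_empty_or_nonempty with he | hne
    -- The sphere is empty only in dimension zero.
    · refine ⟨1, one_pos, fun w _ => ?_⟩
      by_contra! hw
      have hw0 : 0 < ‖w‖ := (half_pos hρ).trans_le hw
      have : (ρ / 2 / ‖w‖) • w ∈ Metric.sphere (0 : 𝔼) (ρ / 2) := by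
        rw [mem_sphere_zero_iff_norm, norm_smul, Real.norm_eq_abs, abs_of_pos (by positivity)]
        field_simp
      rw [he] at this
      exact this
    · obtain ⟨w₀, hw₀, hmin⟩ := (isCompact_sphere (0 : 𝔼) (ρ / 2)).exists_isMinOn hne hNc.continuousOn
      have hw₀' : w₀ ≠ 0 := by
        rintro rfl
        simp at hw₀
        linarith
      refine ⟨√(N w₀), Real.sqrt_pos.2 ((chartLM x).pos _ hy _ hw₀'), fun w hw => ?_⟩
      rw [Real.sq_sqrt (hN0 _)] at hw
      by_contra! hw'
      have hw0 : 0 < ‖w‖ := (half_pos hρ).trans_le hw'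
      set k := ρ / 2 / ‖w‖ with hk
      have hk0 : 0 < k := by positivity
      have hk1 : k ≤ 1 := (div_le_one hw0).2 hw'
      have : k • w ∈ Metric.sphere (0 : 𝔼) (ρ / 2) := by
        rw [mem_sphere_zero_iff_norm, norm_smul, Real.norm_eq_abs, abs_of_pos hk0, hk]
        field_simp
      have h1 : N w₀ ≤ N (k • w) := hmin this
      have h2 : N (k • w) = k * (k * N w) := by simp [hN]
      have h3 : k * (k * N w) ≤ 1 * (1 * N w) := by
        have := hN0 w
        gcongr
      linarith
  set O : Set M := (extChartAt (𝓡 n) x).source ∩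
    extChartAt (𝓡 n) x ⁻¹' ((fun w => c w T) '' Metric.ball 0 ρ) with hO
  have hOo : IsOpen O := (continuousOn_extChartAt x).isOpen_inter_preimage
    (isOpen_extChartAt_source x) (hopen _ subset_rfl Metric.isOpen_ball)
  have hTmem : T ∈ Ioo (-(2 * T)) (2 * T) := ⟨by linarith, by linarith⟩
  have h0mem : (0 : ℝ) ∈ Ioo (-(2 * T)) (2 * T) := ⟨by linarith, by linarith⟩
  have htgt : ∀ w ∈ Metric.ball (0 : 𝔼) ρ, c w T ∈ (extChartAt (𝓡 n) x).target := fun w hw =>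
    ((hsol w hw).2.2.2 T hTmem).mem
  have henergy : ∀ w ∈ Metric.ball (0 : 𝔼) ρ,
      (chartLM x).coeff (c w T) (v w T) (v w T) = N w := fun w hw => by
    obtain ⟨a1, a2, -, a3⟩ := hsol w hw
    have := isOpen_Ioo.is_const_of_deriv_eq_zero (s := Ioo (-(2 * T)) (2 * T))
      (f := fun t => (chartLM x).coeff (c w t) (v w t) (v w t)) isPreconnected_Ioo
      (fun t ht => (a3 t ht).hasDerivAt_energy.differentiableAt.differentiableWithinAt)
      (fun t ht => (a3 t ht).hasDerivAt_energy.deriv) hTmem h0mem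
    simpa [a1, a2] using this
  set K : Set M := (fun w => (extChartAt (𝓡 n) x).symm (c w T)) '' Metric.closedBall 0 (ρ / 2)
  have hKc : IsClosed K := by
    refine ((isCompact_closedBall (0 : 𝔼) (ρ / 2)).image_of_continuousOn ?_).isClosed
    have hsub : Metric.closedBall (0 : 𝔼) (ρ / 2) ⊆ Metric.ball 0 ρ :=
      Metric.closedBall_subset_ball (by linarith)
    exact (continuousOn_extChartAt_symm x).comp (hcont.mono hsub) fun w hw => htgt w (hsub hw)
  set cap := T * s with hcap
  have hcap0 : 0 < cap := by positivity
  classical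
  set Q : M → ℝ := fun z => N (W (extChartAt (𝓡 n) x z)) with hQ
  have hQO : ∀ z ∈ O, ∃ w ∈ Metric.ball (0 : 𝔼) ρ, extChartAt (𝓡 n) x z = c w T ∧
      z = (extChartAt (𝓡 n) x).symm (c w T) ∧ Q z = N w := by
    rintro z ⟨hz, w, hw, hwz⟩
    refine ⟨w, hw, hwz.symm, ?_, ?_⟩
    · rw [show c w T = _ from hwz, (extChartAt (𝓡 n) x).left_inv hz]
    · simp only [hQ]
      rw [← hwz, (hsol w hw).2.2.1]
  have hgeo : ∀ w ∈ Metric.ball (0 : 𝔼) ρ, ∃ γ : ℝ → M, IsGeodesic (n := n) γ ∧ γ 0 = x ∧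
      γ T = (extChartAt (𝓡 n) x).symm (c w T) ∧ ‖velocityVec (n := n) γ 0‖ = √(N w) ∧
      dist x ((extChartAt (𝓡 n) x).symm (c w T)) ≤ T * √(N w) := fun w hw => by
    obtain ⟨a1, a2, a3, a4⟩ := hsol w hw
    obtain ⟨hγ, hγv⟩ := isGeodesic_exp (chartVec x y₀ w : TangentBundle (𝓡 n) M)
    set γ : ℝ → M := fun t => exp (scale t (chartVec x y₀ w : TangentBundle (𝓡 n) M)) with hγdef
    have hγT : γ T = (extChartAt (𝓡 n) x).symm (c w T) := by
      have h1 := isGeodesicOn_chart_symm (n := n) isOpen_Ioo a4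
      have h2 := h1.eqOn (hγ.isGeodesicOn _) isPreconnected_Ioo h0mem (by
        rw [hγv, velocity_chart_symm (a4 0 h0mem).mem (a4 0 h0mem).pos_deriv, a1, a2]) T hTmem
      exact h2.self_of_nhds.symm
    have hγ0 : γ 0 = x := by
      have : γ 0 = (chartVec x y₀ w : TangentBundle (𝓡 n) M).proj := exp_scale_zero _
      rw [this]
      exact (extChartAt (𝓡 n) x).left_inv hxs
    have hspeed : ‖velocityVec (n := n) γ 0‖ = √(N w) := by
      rw [← Real.sqrt_sq (norm_nonneg (velocityVec (n := n) γ 0))]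
      congr 1
      exact (congrArg (fun v : TangentBundle (𝓡 n) M => ‖v.2‖ ^ 2) hγv).trans (norm_chartVec_sq ..)
    refine ⟨γ, hγ, hγ0, hγT, hspeed, ?_⟩
    have := (hγ.isGeodesicOn univ).dist_le ordConnected_univ
      (fun t _ => ((hγ.norm_velocity t 0).trans hspeed).le) (mem_univ 0) (mem_univ T)
    rw [hγ0, hγT, sub_zero, abs_of_pos hT] at this
    linarith
  have h0ρ : (0 : 𝔼) ∈ Metric.ball (0 : 𝔼) ρ := Metric.mem_ball_self hρ
  have hN00 : N 0 = 0 := by simp [hN]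
  have hx0 : x = (extChartAt (𝓡 n) x).symm (c 0 T) := by
    obtain ⟨-, -, -, -, -, h⟩ := hgeo 0 h0ρ
    rw [hN00, Real.sqrt_zero, mul_zero] at h
    exact dist_le_zero.1 h
  have hx0' : c 0 T = extChartAt (𝓡 n) x x := by
    have h := (extChartAt (𝓡 n) x).right_inv (htgt 0 h0ρ)
    rw [← hx0] at h
    exact h.symm
  have hxO : x ∈ O := ⟨hxs, 0, h0ρ, hx0'⟩
  have hQx : Q x = 0 := by
    simp only [hQ]
    rw [← hx0', (hsol 0 h0ρ).2.2.1, hN00]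
  have hKO : K ⊆ O := by
    rintro _ ⟨w, hw, rfl⟩
    have hw' : w ∈ Metric.ball (0 : 𝔼) ρ := Metric.closedBall_subset_ball (by linarith) hw
    exact ⟨(extChartAt (𝓡 n) x).map_target (htgt w hw'), w, hw',
      ((extChartAt (𝓡 n) x).right_inv (htgt w hw')).symm⟩
  -- The candidate for the distance from `x` is T√Q, where √Q is the length of the initial velocity.
  -- The term η² makes the square root differentiable at the centre. The truncation makes the
  -- function constant off the compact set `K`, hence defined and continuous on all of `M`. It is
  -- 1-Lipschitz, so geodesics leaving the chart need no separate treatment.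
  have hkey : ∀ η > 0, ∀ z, (if z ∈ O then min (√(T ^ 2 * Q z + η ^ 2)) cap else cap) ≤
      dist x z + η := by
    intro η hη
    set F : M → ℝ := fun z => if z ∈ O then min (√(T ^ 2 * Q z + η ^ 2)) cap else cap with hF
    have hFO : ∀ z ∈ O, F =ᶠ[𝓝 z] fun z => min (√(T ^ 2 * Q z + η ^ 2)) cap := fun z hz => by
      filter_upwards [hOo.mem_nhds hz] with z' hz'
      simp [hF, hz']
    have hFK : ∀ z ∉ K, F z = cap := fun z hz => by
      by_cases hzO : z ∈ O
      · obtain ⟨w, hw, hw1, hw2, hw3⟩ := hQO z hzO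
        have h1 : ρ / 2 ≤ ‖w‖ := by
          by_contra! h
          exact hz ⟨w, mem_closedBall_zero_iff.2 h.le, hw2.symm⟩
        have h2 : s ^ 2 ≤ N w := not_lt.1 fun h => absurd (hNs w h) (not_lt.2 h1)
        simp only [hF, hzO, if_true, hw3]
        refine min_eq_right (Real.le_sqrt_of_sq_le ?_)
        have : T ^ 2 * s ^ 2 ≤ T ^ 2 * N w := by gcongr
        nlinarith [sq_nonneg η]
      · simp [hF, hzO]
    have hFK' : ∀ z ∉ O, F =ᶠ[𝓝 z] fun _ => cap := fun z hz => by
      filter_upwards [hKc.isOpen_compl.mem_nhds fun h => hz (hKO h)] with z' hz' using hFK z' hz'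
    have hcontF : Continuous F := continuous_iff_continuousAt.2 fun z => by
      by_cases hz : z ∈ O
      · refine ContinuousAt.congr ?_ (hFO z hz).symm
        obtain ⟨w, hw, hw1, hw2, hw3⟩ := hQO z hz
        have h1 : ContinuousAt (fun y => N (W y)) (extChartAt (𝓡 n) x z) := by
          rw [hw1]
          exact (hder w hw).continuousAt
        have h2 : ContinuousAt Q z :=
          ContinuousAt.comp (f := extChartAt (𝓡 n) x) h1 (continuousAt_extChartAt' hz.1)
        exact (((h2.const_mul _).add_const _).sqrt).min continuousAt_const
      · exact continuousAt_const.congr (hFK' z hz).symm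
    have hslope : ∀ C : ℝ → M, ContMDiff 𝓘(ℝ, ℝ) (𝓡 n) 1 C → ∀ t r,
        ‖velocityVec (n := n) C t‖ < r → ∃ᶠ z in 𝓝[>] t, slope (F ∘ C) t z < r := by
      intro C hC t r hr
      have hr0 : 0 < r := (norm_nonneg _).trans_lt hr
      have hCt : ContinuousAt C t := hC.continuous.continuousAt
      refine Filter.Eventually.frequently ?_
      by_cases hz : C t ∈ O
      · obtain ⟨w, hw, hw1, hw2, hw3⟩ := hQO _ hz
        have h1 := hasDerivAt_chart_comp ((hC t).mdifferentiableAt one_ne_zero) hz.1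
        set a := tangentCoord x (C t) (velocityVec (n := n) C t) with ha
        have h2 : HasDerivAt (fun τ => Q (C τ))
            (((2 / T) • (chartLM x).coeff (c w T) (v w T)) a) t := by
          have h3 := hder w hw
          rw [← hw1] at h3
          rw [← hw1]
          exact h3.comp_hasDerivAt t h1
        have hpos : 0 < T ^ 2 * Q (C t) + η ^ 2 := by
          rw [hw3]
          have := hN0 w
          positivity
        have h4 := (((h2.const_mul (T ^ 2)).add_const (η ^ 2)).sqrt hpos.ne')
        refine (Filter.Eventually.and (slope_min_const_lt cap h4 (r := r) ?_ hr0)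
          (nhdsWithin_le_nhds (hCt.eventually (hFO _ hz)))).mono fun τ hτ => ?_
        · have h5 := coeff_mul_self_le x (c w T) (v w T) a
          rw [henergy w hw, ← hw1, ha, ← norm_sq_eq_coeff hz.1, Real.sqrt_sq (norm_nonneg _),
            ← ha, hw1] at h5
          have h6 : T * √(N w) ≤ √(T ^ 2 * Q (C t) + η ^ 2) := by
            refine Real.le_sqrt_of_sq_le ?_
            rw [mul_pow, Real.sq_sqrt (hN0 w), hw3]
            nlinarith [sq_nonneg η]
          have h7 : 0 < √(T ^ 2 * Q (C t) + η ^ 2) := Real.sqrt_pos.2 hpos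
          refine lt_of_le_of_lt ?_ hr
          rw [div_le_iff₀ (by positivity), smul_apply, smul_eq_mul]
          calc T ^ 2 * (2 / T * (chartLM x).coeff (c w T) (v w T) a)
              = 2 * T * (chartLM x).coeff (c w T) (v w T) a := by field_simp
            _ ≤ 2 * T * (√(N w) * ‖velocityVec (n := n) C t‖) := by gcongr
            _ = 2 * ‖velocityVec (n := n) C t‖ * (T * √(N w)) := by ring
            _ ≤ 2 * ‖velocityVec (n := n) C t‖ * √(T ^ 2 * Q (C t) + η ^ 2) := by gcongr
            _ = _ := by ring
        · have h8 := (hFO _ hz).self_of_nhds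
          have h9 := hτ.1
          rw [slope_def_field] at h9 ⊢
          simp only [Function.comp]
          rw [hτ.2, h8]
          exact h9
      · filter_upwards [nhdsWithin_le_nhds (hCt.eventually (hFK' _ hz))] with τ hτ
        rw [slope_def_field]
        simp only [Function.comp]
        rw [hτ, (hFK' _ hz).self_of_nhds, sub_self, zero_div]
        exact hr0
    intro z
    have h1 := sub_le_dist_of_slope hcontF hslope x z
    have h2 : F x ≤ η := by
      simp only [hF, hxO, if_true, hQx]
      refine (min_le_left _ _).trans ?_
      rw [mul_zero, zero_add, Real.sqrt_sq hη.le]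
    linarith
  have hbound : ∀ z, dist x z < cap → z ∈ O ∧ T * √(Q z) ≤ dist x z := by
    intro z hz
    have hzO : z ∈ O := by
      by_contra hzO
      have := hkey ((cap - dist x z) / 2) (by linarith) z
      rw [if_neg hzO] at this
      linarith
    refine ⟨hzO, le_of_forall_pos_lt_add fun η hη => ?_⟩
    -- Besides tending to zero, the parameter is kept below half the gap to `cap`, which excludes
    -- the truncated value.
    have h1 := hkey (min (η / 2) ((cap - dist x z) / 2)) (lt_min (by linarith) (by linarith)) z
    rw [if_pos hzO] at h1
    have h2 := min_le_left (η / 2) ((cap - dist x z) / 2)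
    have h3 := min_le_right (η / 2) ((cap - dist x z) / 2)
    rcases min_le_iff.1 h1 with h4 | h4
    · have h5 : T * √(Q z) ≤ √(T ^ 2 * Q z + min (η / 2) ((cap - dist x z) / 2) ^ 2) := by
        obtain ⟨w, hw, hw1, hw2, hw3⟩ := hQO z hzO
        refine Real.le_sqrt_of_sq_le ?_
        rw [mul_pow, Real.sq_sqrt (hw3 ▸ hN0 w)]
        exact le_add_of_nonneg_right (sq_nonneg _)
      linarith
    · linarith
  refine ⟨cap, hcap0, fun z hz0 hz => ?_⟩
  obtain ⟨hzO, hzQ⟩ := hbound z hz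
  obtain ⟨w, hw, hw1, hw2, hw3⟩ := hQO z hzO
  obtain ⟨a1, a2, a3, a4⟩ := hsol w hw
  obtain ⟨γ, hγ, hγ0, hγT, hspeed, hle⟩ := hgeo w hw
  rw [← hw2] at hγT hle
  rw [hw3] at hzQ
  have heq : dist x z = T * √(N w) := le_antisymm hle hzQ
  have hk : 0 < √(N w) := by
    by_contra hk
    have : √(N w) = 0 := le_antisymm (not_lt.1 hk) (Real.sqrt_nonneg _)
    rw [this] at heq
    linarith
  refine ⟨fun t => γ ((√(N w))⁻¹ * t + 0), hγ.affine _ _, ?_, ?_, ?_⟩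
  · have h1 := hγ.velocity_affine (√(N w))⁻¹ 0 0
    have h2 : (√(N w))⁻¹ * 0 + 0 = 0 := by ring
    rw [h2] at h1
    refine (congrArg (fun v : TangentBundle (𝓡 n) M => ‖v.2‖) h1).trans ?_
    change ‖(√(N w))⁻¹ • velocityVec (n := n) γ 0‖ = 1
    rw [norm_smul, hspeed, norm_inv, Real.norm_eq_abs, abs_of_pos hk, inv_mul_cancel₀ hk.ne']
  · simp [hγ0]
  · rw [heq]
    have : (√(N w))⁻¹ * (T * √(N w)) + 0 = T := by field_simp; ring
    simp only [this, hγT]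

end SingularFoliation

/-! ### First variation of the distance -/

namespace SingularFoliation

set_option maxSynthPendingDepth 3

variable {n : ℕ} {M : Type*} [MetricSpace M] [ChartedSpace (EuclideanSpace ℝ (Fin n)) M]

local notation "𝔼" => EuclideanSpace ℝ (Fin n)

variable [IsManifold (𝓡 n) ∞ M] [RiemannianBundle (fun x : M => TangentSpace (𝓡 n) x)]
  [IsContMDiffRiemannianBundle (𝓡 n) ∞ (EuclideanSpace ℝ (Fin n))
    (fun x : M => TangentSpace (𝓡 n) x)]

/-- Points of the sphere of radius `ε` almost realize the distance. -/
theorem exists_dist_eq_of_lt (hR : IsRiemannianManifold (𝓡 n) M) {x y : M} {ε d : ℝ} (hε : 0 ≤ ε) (hεd : ε ≤ dist x y)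
    (hd : dist x y < d) : ∃ z, dist x z = ε ∧ dist z y < d - ε := by
  have hlt : Manifold.riemannianEDist (𝓡 n) x y < ENNReal.ofReal d := by
    rw [← IsRiemannianManifold.out (I := 𝓡 n) x y, edist_dist]
    exact (ENNReal.ofReal_lt_ofReal_iff (dist_nonneg.trans_lt hd)).2 hd
  obtain ⟨c, h0, h1, hc, hlen, -⟩ :=
    Manifold.exists_lt_locally_constant_of_riemannianEDist_lt hlt zero_lt_one
  have hcont : ContinuousOn (fun t => dist x (c t)) (Icc 0 1) :=
    (continuous_const.dist hc.continuous).continuousOn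
  obtain ⟨t, ht, htε⟩ := intermediate_value_Icc zero_le_one hcont
    (show ε ∈ Icc (dist x (c 0)) (dist x (c 1)) by rw [h0, h1, dist_self]; exact ⟨hε, hεd⟩)
  refine ⟨c t, htε, ?_⟩
  have k1 : edist x (c t) ≤ Manifold.pathELength (𝓡 n) c 0 t := by
    rw [IsRiemannianManifold.out (I := 𝓡 n)]
    exact Manifold.riemannianEDist_le_pathELength hc.contMDiffOn h0 rfl ht.1
  have k2 : edist (c t) y ≤ Manifold.pathELength (𝓡 n) c t 1 := by
    rw [IsRiemannianManifold.out (I := 𝓡 n)]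
    exact Manifold.riemannianEDist_le_pathELength hc.contMDiffOn rfl h1 ht.2
  have k3 := (add_le_add k1 k2).trans_lt
    ((Manifold.pathELength_add ht.1 ht.2).trans_lt hlen)
  rw [edist_dist, edist_dist, ← ENNReal.ofReal_add dist_nonneg dist_nonneg,
    ENNReal.ofReal_lt_ofReal_iff (dist_nonneg.trans_lt hd)] at k3
  have htε' : dist x (c t) = ε := htε
  linarith

variable [IsRiemannianManifold (𝓡 n) M]

theorem IsGeodesic.dist_le {γ : ℝ → M} (h : IsGeodesic (n := n) γ)
    (h1 : ‖velocityVec (n := n) γ 0‖ = 1) (a b : ℝ) : dist (γ a) (γ b) ≤ |b - a| := by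
  simpa using (h.isGeodesicOn univ).dist_le ordConnected_univ
    (fun t _ => ((h.norm_velocity t 0).trans h1).le) (mem_univ a) (mem_univ b)

theorem eventually_le_mul_of_hasDerivAt {f : ℝ → ℝ} {f' r : ℝ} (h : HasDerivAt f f' 0)
    (h0 : f 0 = 0) (hr : f' < r) : ∀ᶠ δ in 𝓝[>] (0 : ℝ), f δ ≤ r * δ := by
  have h1 := h.hasDerivWithinAt (s := Ioi 0) |>.limsup_slope_le' (by simp) hr
  filter_upwards [h1, self_mem_nhdsWithin] with z hz1 hz
  have hz' : 0 < z := hz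
  rw [slope_def_field, h0, sub_zero, sub_zero, div_lt_iff₀ hz'] at hz1
  exact hz1.le

/-- First variation inequality for the distance to a point on a unit speed geodesic. -/
theorem eventually_dist_le_of_variation {γ : ℝ → M} (hγ : IsGeodesic (n := n) γ)
    (h1 : ‖velocityVec (n := n) γ 0‖ = 1) {ℓ : ℝ} (hℓ : 0 < ℓ) {σ : ℝ → M}
    (hσ : MDifferentiableAt 𝓘(ℝ, ℝ) (𝓡 n) σ 0) {w : TangentSpace (𝓡 n) (γ 0)}
    (hw : velocity σ 0 = (⟨γ 0, w⟩ : TangentBundle (𝓡 n) M)) {r : ℝ}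
    (hr : -⟪velocityVec γ 0, w⟫ < r) :
    ∀ᶠ δ in 𝓝[>] (0 : ℝ), dist (σ δ) (γ ℓ) ≤ ℓ + r * δ := by
  obtain ⟨p, hp⟩ : ∃ p, p = γ 0 := ⟨_, rfl⟩
  have hps : γ 0 ∈ (extChartAt (𝓡 n) p).source := by rw [hp]; exact mem_extChartAt_source _
  have hsol : IsSolIn (n := n) p γ 0 := hγ.isSolIn hps
  set c : ℝ → 𝔼 := fun τ => extChartAt (𝓡 n) p (γ τ) with hc
  set v := deriv c with hv
  have hunit : ∀ᶠ t in 𝓝 (0 : ℝ), (chartLM p).coeff (c t) (v t) (v t) = 1 := by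
    filter_upwards [hsol.eventually] with t ht
    rw [← norm_chartVec_sq]
    have h2 := congrArg (fun v : TangentBundle (𝓡 n) M => ‖v.2‖ ^ 2) ht.velocity_eq
    refine h2.symm.trans ?_
    have : ‖(velocity (n := n) γ t).2‖ = 1 := (hγ.norm_velocity t 0).trans h1
    rw [this, one_pow]
  obtain ⟨S, hS, hvar⟩ := LocalMetric.exists_variation_bound (g := chartLM p) (c := c) (v := v)
    (hsol.mono fun t ht => ht.2.2) hunit
  obtain ⟨ε, hε, hball⟩ := Metric.eventually_nhds_iff.1 hsol
  -- Only an initial piece of the geodesic, inside the chart and the range of the coordinate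
  -- estimate, is moved; the remaining piece is added by the triangle inequality.
  set s := min S (min ε ℓ) / 2 with hs
  have hm : 0 < min S (min ε ℓ) := lt_min hS (lt_min hε hℓ)
  have hs0 : 0 < s := half_pos hm
  have hsS : s < S := (half_lt_self hm).trans_le (min_le_left _ _)
  have hsε : s < ε := (half_lt_self hm).trans_le ((min_le_right _ _).trans (min_le_left _ _))
  have hsℓ : s < ℓ := (half_lt_self hm).trans_le ((min_le_right _ _).trans (min_le_right _ _))
  obtain ⟨C, δ₀, hδ₀, hu⟩ := hvar s ⟨hs0, hsS⟩
  have hσ0 : σ 0 = γ 0 := congrArg TotalSpace.proj hw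
  have hσs : σ 0 ∈ (extChartAt (𝓡 n) p).source := by rw [hσ0]; exact hps
  have hσd := hasDerivAt_chart_comp hσ hσs
  have ha : tangentCoord p (σ 0) (velocityVec σ 0) = tangentCoord p (γ 0) w :=
    congrArg (fun v : TangentBundle (𝓡 n) M => tangentCoord p v.proj v.2) hw
  rw [ha] at hσd
  have hv0 : v 0 = tangentCoord p (γ 0) (velocityVec (n := n) γ 0) :=
    (hasDerivAt_chart_comp ((hγ.1 0).mdifferentiableAt (by simp)) hps).deriv
  have hinner : (chartLM p).coeff (c 0) (v 0) (tangentCoord p (γ 0) w) =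
      ⟪velocityVec (n := n) γ 0, w⟫ := by
    rw [hv0]
    exact (inner_eq_coeff hps _ _).symm
  set u : ℝ → 𝔼 := fun δ => extChartAt (𝓡 n) p (σ δ) - c 0 with hudef
  have hud : HasDerivAt u (tangentCoord p (γ 0) w) 0 := hσd.sub_const _
  have hu0 : u 0 = 0 := by simp only [hudef, hc, hσ0]; exact sub_self _
  have hfd : HasDerivAt (fun δ => -(chartLM p).coeff (c 0) (v 0) (u δ) + C * ‖u δ‖ ^ 2)
      (-⟪velocityVec (n := n) γ 0, w⟫) 0 := by
    have e1 := (((chartLM p).coeff (c 0) (v 0)).hasFDerivAt.comp_hasDerivAt 0 hud).neg.add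
      ((hud.norm_sq).const_mul C)
    rw [hinner, hu0, inner_zero_left, mul_zero, mul_zero, add_zero] at e1
    exact e1
  have hf := eventually_le_mul_of_hasDerivAt hfd (by simp [hu0]) hr
  have hsmall : ∀ᶠ δ in 𝓝 (0 : ℝ), ‖u δ‖ < δ₀ := by
    have : Filter.Tendsto (fun δ => ‖u δ‖) (𝓝 0) (𝓝 0) := by
      have := hud.continuousAt.norm
      rwa [ContinuousAt, hu0, norm_zero] at this
    exact this.eventually (gt_mem_nhds hδ₀)
  have hsrc : ∀ᶠ δ in 𝓝 (0 : ℝ), σ δ ∈ (extChartAt (𝓡 n) p).source :=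
    hσ.continuousAt.eventually ((isOpen_extChartAt_source (I := 𝓡 n) p).mem_nhds hσs)
  filter_upwards [hf, nhdsWithin_le_nhds hsmall, nhdsWithin_le_nhds hsrc] with δ hδ1 hδ2 hδ3
  obtain ⟨K, K', hK0, hK⟩ := hu (u δ) hδ2
  set b : ℝ → 𝔼 := fun τ => c τ + (1 - τ / s) • u δ with hb
  have hbd : ∀ τ ∈ Icc 0 s, HasDerivAt b (v τ - s⁻¹ • u δ) τ := fun τ hτ => by
    have h3 := (((hasDerivAt_id τ).div_const s).const_sub 1).smul_const (u δ)
    have h4 := (hK τ hτ).1.pos_deriv.add h3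
    refine HasDerivAt.congr_deriv (f := b) h4 ?_
    simp [neg_smul, sub_eq_add_neg]
  have hγsrc : ∀ τ ∈ Icc 0 s, γ τ ∈ (extChartAt (𝓡 n) p).source := fun τ hτ =>
    (hball (y := τ) (by
      rw [Real.dist_eq, sub_zero, abs_of_nonneg hτ.1]; exact hτ.2.trans_lt hsε)).2.1
  have hbt : ∀ τ ∈ Icc 0 s, b τ ∈ (extChartAt (𝓡 n) p).target := fun τ hτ => (hK τ hτ).2.1
  have hsm : ContMDiffOn 𝓘(ℝ, ℝ) (𝓡 n) 1 (fun τ => (extChartAt (𝓡 n) p).symm (b τ)) (Icc 0 s) := by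
    intro τ hτ
    have h3 : ContMDiffAt 𝓘(ℝ, ℝ) 𝓘(ℝ, 𝔼) ∞ c τ := (contMDiffAt_chart (hγsrc τ hτ)).comp τ (hγ.1 τ)
    have h4 : ContDiffAt ℝ ∞ b τ := by
      have h5 : ContDiffAt ℝ ∞ (fun τ : ℝ => (1 - τ / s) • u δ) τ := by fun_prop
      exact (contMDiffAt_iff_contDiffAt.1 h3).add h5
    exact (((contMDiffAt_chart_symm (hbt τ hτ)).comp τ h4.contMDiffAt).of_le
      (by simp)).contMDiffWithinAt
  have hd := dist_le_of_norm_velocity_le hs0.le hsm (fun τ hτ => (hK τ hτ).2.2.1) (fun τ hτ => by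
    have hτ' := Ioo_subset_Icc_self hτ
    have h3 := (hK τ hτ').2.2.2
    have h4 : ‖velocityVec (n := n) (fun τ => (extChartAt (𝓡 n) p).symm (b τ)) τ‖ ^ 2 =
        (chartLM p).coeff (b τ) (v τ - s⁻¹ • u δ) (v τ - s⁻¹ • u δ) :=
      (congrArg (fun v : TangentBundle (𝓡 n) M => ‖v.2‖ ^ 2)
        (velocity_chart_symm (hbt τ hτ') (hbd τ hτ'))).trans (norm_chartVec_sq ..)
    rw [← h4] at h3
    -- Since (K' - 1)² ≥ 0, the bound 2K' - 1 for the squared speed is at most K'².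
    by_contra! h5
    nlinarith [sq_nonneg (K' τ - 1), norm_nonneg
      (velocityVec (n := n) (fun τ => (extChartAt (𝓡 n) p).symm (b τ)) τ)])
  have e0 : (extChartAt (𝓡 n) p).symm (b 0) = σ δ := by
    simp only [hb, hudef, zero_div, sub_zero, one_smul, add_sub_cancel]
    exact (extChartAt (𝓡 n) p).left_inv hδ3
  have es : (extChartAt (𝓡 n) p).symm (b s) = γ s := by
    simp only [hb, div_self hs0.ne', sub_self, zero_smul, add_zero]
    exact (extChartAt (𝓡 n) p).left_inv (hγsrc s (right_mem_Icc.2 hs0.le))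
  simp only [e0, es] at hd
  have h6 := hγ.dist_le h1 s ℓ
  rw [abs_of_pos (by linarith)] at h6
  have h7 := dist_triangle (σ δ) (γ s) (γ ℓ)
  linarith

variable [CompleteSpace M]

/-- A small sphere around `x` is compact, so the distance to `C` attains its minimum there. Almost
shortest paths to `C` cross the sphere, so the minimum is the distance from `x` minus the radius; a
minimizing geodesic leads from `x` to the minimizer. -/
theorem exists_geodesic_step {C : Set M} (hC : IsClosed C) (hne : C.Nonempty) {x : M} (hx : x ∉ C) :
    ∃ ε > 0, ∃ γ : ℝ → M, IsGeodesic (n := n) γ ∧ ‖velocityVec (n := n) γ 0‖ = 1 ∧ γ 0 = x ∧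
      Metric.infDist (γ ε) C = Metric.infDist x C - ε := by
  have hpos : 0 < Metric.infDist x C := (hC.notMem_iff_infDist_pos hne).1 hx
  obtain ⟨ε₁, hε₁, hmin⟩ := exists_minimizing_geodesic (n := n) x
  have : LocallyCompactSpace M := ChartedSpace.locallyCompactSpace 𝔼 M
  obtain ⟨ε₂, hε₂, hcpt⟩ := Metric.exists_isCompact_closedBall x
  set ε := min (Metric.infDist x C) (min ε₁ ε₂) / 2 with hε
  have hm : 0 < min (Metric.infDist x C) (min ε₁ ε₂) := lt_min hpos (lt_min hε₁ hε₂)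
  have hε0 : 0 < ε := half_pos hm
  have e1 : ε < Metric.infDist x C := (half_lt_self hm).trans_le (min_le_left _ _)
  have e2 : ε < ε₁ := (half_lt_self hm).trans_le ((min_le_right _ _).trans (min_le_left _ _))
  have e3 : ε < ε₂ := (half_lt_self hm).trans_le ((min_le_right _ _).trans (min_le_right _ _))
  have hstep : ∀ η > 0, ∃ z ∈ Metric.sphere x ε, Metric.infDist z C < Metric.infDist x C - ε + η := by
    intro η hη
    obtain ⟨y, hy, hyd⟩ := (Metric.infDist_lt_iff hne).1 (lt_add_of_pos_right (Metric.infDist x C) hη)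
    obtain ⟨z, hz1, hz2⟩ := exists_dist_eq_of_lt (n := n) inferInstance hε0.le
      (e1.le.trans (Metric.infDist_le_dist_of_mem hy)) hyd
    refine ⟨z, by rw [Metric.mem_sphere, dist_comm]; exact hz1, ?_⟩
    have := Metric.infDist_le_dist_of_mem (x := z) hy
    linarith
  have hsc : IsCompact (Metric.sphere x ε) := hcpt.of_isClosed_subset Metric.isClosed_sphere
    (Metric.sphere_subset_closedBall.trans (Metric.closedBall_subset_closedBall e3.le))
  obtain ⟨z₁, hz₁, -⟩ := hstep 1 one_pos
  obtain ⟨z, hz, hzmin⟩ := hsc.exists_isMinOn ⟨z₁, hz₁⟩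
    (Metric.continuous_infDist_pt C).continuousOn
  have hle : Metric.infDist z C ≤ Metric.infDist x C - ε := by
    refine le_of_forall_pos_lt_add fun η hη => ?_
    obtain ⟨z', hz', h⟩ := hstep η hη
    exact lt_of_le_of_lt (hzmin hz') h
  have hd : dist x z = ε := by rw [dist_comm]; exact hz
  obtain ⟨γ, h1, h2, h3, h4⟩ := hmin z (by rw [hd]; exact hε0) (by rw [hd]; exact e2)
  refine ⟨ε, hε0, γ, h1, h2, h3, ?_⟩
  rw [hd] at h4
  rw [h4]
  have := Metric.infDist_le_infDist_add_dist (s := C) (x := x) (y := z)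
  linarith

/-- A minimizing geodesic from a point to a closed set. -/
theorem exists_geodesic_to_closed {C : Set M} (hC : IsClosed C) (hne : C.Nonempty) {x : M}
    (hx : x ∉ C) : ∃ γ : ℝ → M, IsGeodesic (n := n) γ ∧ ‖velocityVec (n := n) γ 0‖ = 1 ∧ γ 0 = x ∧
      ∀ s ∈ Icc 0 (Metric.infDist x C), Metric.infDist (γ s) C = Metric.infDist x C - s := by
  obtain ⟨ε, hε, γ, hγ, h1, h0, hstep⟩ := exists_geodesic_step (n := n) hC hne hx
  set ℓ := Metric.infDist x C with hℓ
  refine ⟨γ, hγ, h1, h0, ?_⟩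
  have hdown : ∀ s, Metric.infDist (γ s) C = ℓ - s → ∀ s' ∈ Icc 0 s,
      Metric.infDist (γ s') C = ℓ - s' := by
    intro s hs s' hs'
    have a1 := Metric.infDist_le_infDist_add_dist (s := C) (x := γ 0) (y := γ s')
    have a2 := Metric.infDist_le_infDist_add_dist (s := C) (x := γ s') (y := γ s)
    have a3 := hγ.dist_le h1 0 s'
    have a4 := hγ.dist_le h1 s' s
    rw [abs_of_nonneg (by linarith [hs'.1])] at a3
    rw [abs_of_nonneg (by linarith [hs'.2])] at a4
    rw [h0, ← hℓ] at a1
    rw [h0] at a3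
    linarith
  have hcont : Continuous fun s => Metric.infDist (γ s) C :=
    (Metric.continuous_infDist_pt C).comp hγ.1.continuous
  have hclosed : IsClosed ({s : ℝ | Metric.infDist (γ s) C = ℓ - s} ∩ Icc 0 ℓ) :=
    (isClosed_eq hcont (by fun_prop)).inter isClosed_Icc
  -- Continuous induction: the set of good times is closed, and each good time before the end is
  -- followed by later ones.
  refine hclosed.Icc_subset_of_forall_exists_gt (by simp [h0, hℓ]) fun s hs y hy => ?_
  have hs1 : Metric.infDist (γ s) C = ℓ - s := hs.1
  rcases hs.2.1.eq_or_lt with hs0 | hs0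
  · subst hs0
    refine ⟨min ε y, hdown ε hstep _ ⟨le_min hε.le (le_of_lt hy), min_le_left _ _⟩,
      lt_min hε hy, min_le_right _ _⟩
  · have hsC : γ s ∉ C := by
      rw [hC.notMem_iff_infDist_pos hne, hs1]
      linarith [hs.2.2]
    obtain ⟨ε', hε', η, hη, hη1, hη0, hηs⟩ := exists_geodesic_step (n := n) hC hne hsC
    set w := velocityVec (n := n) γ s with hw
    have hback := hγ.affine (-1) s
    have hvel : velocity (n := n) (fun t => γ (-1 * t + s)) 0 = scale (-1) (velocity γ s) := by
      rw [hγ.velocity_affine]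
      norm_num
    obtain ⟨w', hw'⟩ : ∃ w' : TangentSpace (𝓡 n) (η 0),
        (⟨η 0, w'⟩ : TangentBundle (𝓡 n) M) = velocity γ s := by
      rw [hη0]
      exact ⟨w, rfl⟩
    have hw'1 : ‖w'‖ = 1 := by
      refine (congrArg (fun v : TangentBundle (𝓡 n) M => ‖v.2‖) hw').trans ?_
      exact (hγ.norm_velocity s 0).trans h1
    -- No corner can occur at `γ s`. Otherwise the first variation, applied to the new piece as its
    -- starting point moves back along γ, would give a shortcut from an earlier point. Thus two unit
    -- vectors have inner product at least 1, hence agree.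
    have hge : 1 ≤ ⟪velocityVec (n := n) η 0, w'⟫ := by
      refine le_of_forall_gt_imp_ge_of_dense fun r hr => ?_
      have hvar := eventually_dist_le_of_variation hη hη1 hε' (σ := fun t => γ (-1 * t + s))
        (w := -w') ((hback.1 0).mdifferentiableAt (by simp)) (by
          rw [hvel, ← hw']
          simp [scale]) (r := r) (by rw [inner_neg_right, neg_neg]; exact hr)
      have hlt : ∀ᶠ δ in 𝓝[>] (0 : ℝ), δ < s := nhdsWithin_le_nhds (gt_mem_nhds hs0)
      obtain ⟨δ, ⟨h2, h3⟩, h4⟩ := ((hvar.and hlt).and self_mem_nhdsWithin).exists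
      have h4' : 0 < δ := h4
      have h5 := hdown s hs1 (-1 * δ + s) ⟨by linarith, by linarith⟩
      have h6 := Metric.infDist_le_infDist_add_dist (s := C) (x := γ (-1 * δ + s)) (y := η ε')
      rw [hηs, hs1, h5] at h6
      by_contra! h7
      nlinarith
    have heq : velocityVec (n := n) η 0 = w' := by
      have h2 := real_inner_le_norm (velocityVec (n := n) η 0) w'
      rw [hη1, hw'1, one_mul] at h2
      exact (inner_eq_one_iff_of_norm_eq_one hη1 hw'1).1 (le_antisymm h2 hge)
    have hvη : velocity (n := n) (fun t => γ (1 * t + s)) 0 = velocity η 0 := by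
      rw [hγ.velocity_affine, scale_one, mul_zero, zero_add, ← hw', ← heq]
      rfl
    have hγη := (hγ.affine 1 s).ext hη hvη
    have hs2 : Metric.infDist (γ (1 * ε' + s)) C = ℓ - (1 * ε' + s) := by
      rw [show γ (1 * ε' + s) = η ε' from congrFun hγη ε', hηs, hs1]
      ring
    refine ⟨min (1 * ε' + s) y, hdown _ hs2 _ ⟨le_min (by linarith) (hs0.le.trans (le_of_lt hy)),
      min_le_left _ _⟩, lt_min (by linarith) hy, min_le_right _ _⟩

end SingularFoliation

/-! ### Equidistance of the leaves -/

namespace SingularFoliation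

set_option maxSynthPendingDepth 3

universe u

variable {n : ℕ} {M : Type u} [MetricSpace M] [ChartedSpace (EuclideanSpace ℝ (Fin n)) M]

local notation "𝔼" => EuclideanSpace ℝ (Fin n)

theorem velocity_comp {k : ℕ} {N : Type*} [TopologicalSpace N]
    [ChartedSpace (EuclideanSpace ℝ (Fin k)) N] {i : N → M} {β : ℝ → N} {t : ℝ}
    (hi : MDifferentiableAt (𝓡 k) (𝓡 n) i (β t))
    {L : ℝ →L[ℝ] TangentSpace (𝓡 k) (β t)} (hβ : HasMFDerivAt 𝓘(ℝ, ℝ) (𝓡 k) β t L) :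
    velocity (n := n) (fun τ => i (β τ)) t =
      (⟨i (β t), mfderiv (𝓡 k) (𝓡 n) i (β t) (L 1)⟩ : TangentBundle (𝓡 n) M) := by
  have h := (hi.hasMFDerivAt.comp t hβ).mfderiv
  exact congrArg (fun K : ℝ →L[ℝ] TangentSpace (𝓡 n) (i (β t)) =>
    (⟨i (β t), K 1⟩ : TangentBundle (𝓡 n) M)) h

variable [IsManifold (𝓡 n) ∞ M] [RiemannianBundle (fun x : M => TangentSpace (𝓡 n) x)]

/-- Equations between velocities live in the total space; this moves inner products between fibres
whose base points are only propositionally equal. -/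
theorem inner_congr (q : M) (a b : TangentSpace (𝓡 n) q) (q' : M) (a' b' : TangentSpace (𝓡 n) q')
    (ha : (⟨q, a⟩ : TangentBundle (𝓡 n) M) = ⟨q', a'⟩)
    (hb : (⟨q, b⟩ : TangentBundle (𝓡 n) M) = ⟨q', b'⟩) : ⟪a, b⟫ = ⟪a', b'⟫ := by
  obtain rfl : q = q' := congrArg TotalSpace.proj ha
  cases ha
  cases hb
  rfl

/-- The leaf through a point. -/
def SRF.leaf (F : SRF n M) (p : M) : Set M := {q | F.leafRel p q}

theorem SRF.mem_leaf_self (F : SRF n M) (p : M) : p ∈ F.leaf p := F.leafRel.refl p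

theorem SRF.leafDim_eq (F : SRF n M) {p q : M} (h : F.leafRel p q) : F.leafDim p = F.leafDim q := by
  obtain ⟨k, N, _, _, _, i, -, -, -, hrange, htan⟩ := F.leaf_immersed p
  have key : ∀ y : N, F.leafDim (i y) = k := by
    intro y
    obtain ⟨hinj, hmem⟩ := htan y
    have h1 : F.tangent (i y) = LinearMap.range
        (mfderiv (𝓡 k) (𝓡 n) i y : TangentSpace (𝓡 k) y →ₗ[ℝ] TangentSpace (𝓡 n) (i y)) := by
      ext w
      rw [hmem w]
      rfl
    unfold SRF.leafDim
    rw [h1, LinearMap.finrank_range_of_inj hinj]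
    exact finrank_euclideanSpace_fin
  have hp : p ∈ range i := by rw [hrange]; exact F.leafRel.refl p
  have hq : q ∈ range i := by rw [hrange]; exact h
  obtain ⟨y, rfl⟩ := hp
  obtain ⟨z, rfl⟩ := hq
  rw [key y, key z]

theorem SRF.isPreconnected_leaf (F : SRF n M) (p : M) : IsPreconnected (F.leaf p) := by
  obtain ⟨k, N, _, _, _, i, hN, hi, -, hrange, -⟩ := F.leaf_immersed p
  have : F.leaf p = range i := hrange.symm
  rw [this]
  exact isPreconnected_range hi.continuous

/-- Leaf dimension is constant on a leaf and leaves are connected, so a leaf meeting `S` stays in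
one component of the minimal locus. -/
theorem SRF.IsMinimalStratum.saturated {F : SRF n M} {S : Set M} (hS : F.IsMinimalStratum S)
    {p q : M} (hp : p ∈ S) (h : F.leafRel p q) : q ∈ S := by
  have hsub : F.leaf p ⊆ F.minLocus := fun z hz w => by
    have h1 : F.leafDim p = F.leafDim z := F.leafDim_eq hz
    rw [← h1]
    exact hS.subset hp w
  exact hS.component p hp ((F.isPreconnected_leaf p).subset_connectedComponentIn
    (F.mem_leaf_self p) hsub h)

/-- A tangent vector of a leaf is the velocity of a curve in the leaf. -/
theorem SRF.exists_curve (F : SRF n M) {p : M} {w : TangentSpace (𝓡 n) p} (hw : w ∈ F.tangent p) :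
    ∃ σ : ℝ → M, MDifferentiableAt 𝓘(ℝ, ℝ) (𝓡 n) σ 0 ∧
      velocity σ 0 = (⟨p, w⟩ : TangentBundle (𝓡 n) M) ∧ ∀ t, F.leafRel p (σ t) := by
  obtain ⟨k, N, _, _, _, i, -, hi, -, hrange, htan⟩ := F.leaf_immersed p
  have hp : p ∈ range i := by rw [hrange]; exact F.leafRel.refl p
  obtain ⟨y, rfl⟩ := hp
  obtain ⟨a, ha⟩ : ∃ a : EuclideanSpace ℝ (Fin k), mfderiv (𝓡 k) (𝓡 n) i y a = w :=
    ((htan y).2 w).1 hw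
  subst ha
  set β : ℝ → N := fun t => (extChartAt (𝓡 k) y).symm
    (extChartAt (𝓡 k) y y + t • a) with hβ
  have hβ0 : β 0 = y := by simp [hβ]
  have h1 : HasMFDerivAt 𝓘(ℝ, EuclideanSpace ℝ (Fin k)) (𝓡 k) (extChartAt (𝓡 k) y).symm
      (extChartAt (𝓡 k) y y + (0 : ℝ) • a)
      (ContinuousLinearMap.id ℝ (EuclideanSpace ℝ (Fin k))) := by
    rw [zero_smul, add_zero]
    have e1 := (mdifferentiableWithinAt_extChartAt_symm (I := 𝓡 k)
      (mem_extChartAt_target (I := 𝓡 k) y)).hasMFDerivWithinAt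
    rw [mfderivWithin_range_extChartAt_symm] at e1
    have e2 : range (𝓡 k) = univ := by simp
    rw [e2] at e1
    exact hasMFDerivWithinAt_univ.1 e1
  have h2 : HasMFDerivAt 𝓘(ℝ, ℝ) 𝓘(ℝ, EuclideanSpace ℝ (Fin k))
      (fun t : ℝ => extChartAt (𝓡 k) y y + t • a) 0
      (ContinuousLinearMap.toSpanSingleton ℝ a) := by
    have : HasDerivAt (fun t : ℝ => extChartAt (𝓡 k) y y + t • a)
        a 0 := by
      have := ((hasDerivAt_id (0 : ℝ)).smul_const a).const_add
        (extChartAt (𝓡 k) y y)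
      rw [one_smul] at this
      exact this
    exact this.hasFDerivAt.hasMFDerivAt
  have h3 := h1.comp (0 : ℝ) h2
  have hid : MDifferentiableAt (𝓡 k) (𝓡 n) i (β 0) := (hi _).mdifferentiableAt (by simp)
  refine ⟨fun t => i (β t), (hid.hasMFDerivAt.comp (0 : ℝ) h3).mdifferentiableAt, ?_, fun t => ?_⟩
  · rw [velocity_comp hid h3]
    have h4 : (((ContinuousLinearMap.id ℝ (EuclideanSpace ℝ (Fin k))).comp
        (ContinuousLinearMap.toSpanSingleton ℝ a)) (1 : ℝ)) =
        a := one_smul ℝ _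
    refine Eq.trans (b := (⟨i (β 0), mfderiv (𝓡 k) (𝓡 n) i (β 0)
      a⟩ : TangentBundle (𝓡 n) M)) ?_ ?_
    · exact congrArg (fun z : EuclideanSpace ℝ (Fin k) =>
        (⟨i (β 0), mfderiv (𝓡 k) (𝓡 n) i (β 0) z⟩ : TangentBundle (𝓡 n) M)) h4
    · exact congrArg (fun y' : N => (⟨i y', mfderiv (𝓡 k) (𝓡 n) i y'
        a⟩ : TangentBundle (𝓡 n) M)) hβ0
  · have : i (β t) ∈ {q | F.leafRel (i y) q} := by rw [← hrange]; exact mem_range_self _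
    exact this

variable [IsContMDiffRiemannianBundle (𝓡 n) ∞ (EuclideanSpace ℝ (Fin n))
    (fun x : M => TangentSpace (𝓡 n) x)]
  [IsRiemannianManifold (𝓡 n) M]

/-- A geodesic that realizes the distance to a set is perpendicular there to the curves in it. -/
theorem inner_velocity_nonneg_of_infDist {γ : ℝ → M} (hγ : IsGeodesic (n := n) γ)
    (h1 : ‖velocityVec (n := n) γ 0‖ = 1) {C : Set M} {ℓ : ℝ} (hℓ : 0 < ℓ)
    (hd : Metric.infDist (γ 0) C = ℓ) {σ : ℝ → M} (hσ : MDifferentiableAt 𝓘(ℝ, ℝ) (𝓡 n) σ 0)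
    {w : TangentSpace (𝓡 n) (γ ℓ)} (hw : velocity σ 0 = (⟨γ ℓ, w⟩ : TangentBundle (𝓡 n) M))
    (hσC : ∃ᶠ t in 𝓝[>] (0 : ℝ), σ t ∈ C) : 0 ≤ ⟪velocityVec (n := n) γ ℓ, w⟫ := by
  have hback := hγ.affine (-1) ℓ
  have hvel : velocity (n := n) (fun t => γ (-1 * t + ℓ)) 0 = scale (-1) (velocity γ ℓ) := by
    rw [hγ.velocity_affine]
    norm_num
  have e0 : γ (-1 * 0 + ℓ) = γ ℓ := by norm_num
  obtain ⟨w', hw'⟩ : ∃ w' : TangentSpace (𝓡 n) (γ (-1 * 0 + ℓ)),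
      (⟨γ (-1 * 0 + ℓ), w'⟩ : TangentBundle (𝓡 n) M) = ⟨γ ℓ, w⟩ := by
    rw [e0]; exact ⟨w, rfl⟩
  have hunit : ‖velocityVec (n := n) (fun t => γ (-1 * t + ℓ)) 0‖ = 1 := by
    refine (congrArg (fun v : TangentBundle (𝓡 n) M => ‖v.2‖) hvel).trans ?_
    change ‖(-1 : ℝ) • velocityVec (n := n) γ ℓ‖ = 1
    rw [norm_smul, hγ.norm_velocity ℓ 0, h1]
    norm_num
  have hinner : -⟪velocityVec (n := n) (fun t => γ (-1 * t + ℓ)) 0, w'⟫ =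
      ⟪velocityVec (n := n) γ ℓ, w⟫ := by
    have := inner_congr _ (velocityVec (n := n) (fun t => γ (-1 * t + ℓ)) 0) w' _
      ((-1 : ℝ) • velocityVec (n := n) γ ℓ) w hvel hw'
    rw [this, inner_smul_left]
    simp
  refine le_of_forall_gt_imp_ge_of_dense fun r hr => ?_
  have hvar := eventually_dist_le_of_variation hback hunit hℓ hσ (hw.trans hw'.symm) (r := r)
    (by rw [hinner]; exact hr)
  obtain ⟨δ, ⟨h2, h3⟩, h4⟩ :=
    ((hσC.and_eventually hvar).and_eventually self_mem_nhdsWithin).exists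
  have h4' : 0 < δ := h4
  have h5 := Metric.infDist_le_dist_of_mem (x := γ 0) h2
  have h6 : -1 * ℓ + ℓ = 0 := by ring
  simp only [h6] at h3
  rw [hd, dist_comm] at h5
  by_contra! h7
  nlinarith

variable [CompleteSpace M]

/-- The distance to a leaf does not increase to first order along curves tangent to the leaves. -/
theorem SRF.eventually_infDist_le (F : SRF n M) (hF : F.HasClosedLeaves) {y : M} {σ : ℝ → M}
    (hσ : MDifferentiableAt 𝓘(ℝ, ℝ) (𝓡 n) σ 0) (hσt : velocityVec (n := n) σ 0 ∈ F.tangent (σ 0))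
    (hy : σ 0 ∉ F.leaf y) {r : ℝ} (hr : 0 < r) :
    ∀ᶠ δ in 𝓝[>] (0 : ℝ), Metric.infDist (σ δ) (F.leaf y) ≤
      Metric.infDist (σ 0) (F.leaf y) + r * δ := by
  have hC : IsClosed (F.leaf y) := hF y
  have hne : (F.leaf y).Nonempty := ⟨y, F.mem_leaf_self y⟩
  obtain ⟨γ, hγ, h1, h0, hγd⟩ := exists_geodesic_to_closed (n := n) hC hne hy
  set ℓ := Metric.infDist (σ 0) (F.leaf y) with hℓ
  have hℓ0 : 0 < ℓ := (hC.notMem_iff_infDist_pos hne).1 hy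
  have hend : γ ℓ ∈ F.leaf y := by
    rw [hC.mem_iff_infDist_zero hne, hγd ℓ (right_mem_Icc.2 hℓ0.le), sub_self]
  have hle : ∀ w ∈ F.tangent (γ ℓ), 0 ≤ ⟪velocityVec (n := n) γ ℓ, w⟫ := fun w hw => by
    obtain ⟨τ, hτ, hτw, hτl⟩ := F.exists_curve hw
    exact inner_velocity_nonneg_of_infDist (C := F.leaf y) hγ h1 hℓ0 (by rw [h0]) hτ hτw
      (Filter.Eventually.frequently (Filter.Eventually.of_forall fun t =>
        F.leafRel.trans hend (hτl t)))
  have hperp : ∀ w ∈ F.tangent (γ ℓ), ⟪velocityVec (n := n) γ ℓ, w⟫ = 0 := fun w hw => by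
    have h2 := hle (-w) (neg_mem hw)
    rw [inner_neg_right] at h2
    exact le_antisymm (by linarith) (hle w hw)
  -- The minimizing geodesic is perpendicular to the leaf at its end; transnormality makes it
  -- perpendicular to the leaf at its start, so the first variation along tangent directions
  -- vanishes.
  have hstart := F.transnormal γ hγ ℓ 0 hperp
  obtain ⟨w, hw, hwt⟩ : ∃ w : TangentSpace (𝓡 n) (γ 0),
      velocity σ 0 = (⟨γ 0, w⟩ : TangentBundle (𝓡 n) M) ∧ w ∈ F.tangent (γ 0) := by
    rw [h0]
    exact ⟨velocityVec σ 0, rfl, hσt⟩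
  have hvar := eventually_dist_le_of_variation hγ h1 hℓ0 hσ hw (r := r)
    (by rw [hstart w hwt, neg_zero]; exact hr)
  filter_upwards [hvar] with δ hδ
  exact (Metric.infDist_le_dist_of_mem hend).trans hδ

/-- Leaves are equidistant. -/
theorem SRF.infDist_leaf_eq (F : SRF n M) (hF : F.HasClosedLeaves) {x x' : M}
    (h : F.leafRel x x') (y : M) :
    Metric.infDist x' (F.leaf y) = Metric.infDist x (F.leaf y) := by
  by_cases hxy : F.leafRel y x
  · rw [Metric.infDist_zero_of_mem (show x ∈ F.leaf y from hxy),
      Metric.infDist_zero_of_mem (show x' ∈ F.leaf y from F.leafRel.trans hxy h)]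
  have hoff : ∀ z, F.leafRel x z → z ∉ F.leaf y := fun z hz hyz =>
    hxy (F.leafRel.trans hyz (F.leafRel.symm hz))
  -- Along curves tangent to the leaves the upper right derivative of the distance is at most every
  -- positive number, so the distance does not increase.
  have hcurve : ∀ c : ℝ → M, (∀ t ∈ Icc (0 : ℝ) 1, MDifferentiableAt 𝓘(ℝ, ℝ) (𝓡 n) c t ∧
      velocityVec (n := n) c t ∈ F.tangent (c t) ∧ F.leafRel x (c t)) →
      Metric.infDist (c 1) (F.leaf y) ≤ Metric.infDist (c 0) (F.leaf y) := by
    intro c hc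
    have hcont : ContinuousOn (fun t => Metric.infDist (c t) (F.leaf y)) (Icc 0 1) := fun t ht =>
      ((Metric.continuous_infDist_pt (F.leaf y)).continuousAt.comp
        (hc t ht).1.continuousAt).continuousWithinAt
    refine image_le_of_liminf_slope_right_le_deriv_boundary
      (B := fun _ => Metric.infDist (c 0) (F.leaf y)) (B' := fun _ => 0) hcont le_rfl
      continuousOn_const (fun t _ => hasDerivWithinAt_const _ _ _) (fun t ht r hr => ?_)
      (right_mem_Icc.2 zero_le_one)
    obtain ⟨h1, h2, h3⟩ := hc t (Ico_subset_Icc_self ht)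
    have e0 : 1 * (0 : ℝ) + t = t := by ring
    have hlin : HasDerivAt (fun τ : ℝ => 1 * τ + t) 1 0 := by
      simpa using ((hasDerivAt_id (0 : ℝ)).const_mul 1).add_const t
    have h1' : MDifferentiableAt 𝓘(ℝ, ℝ) (𝓡 n) c (1 * (0 : ℝ) + t) := by rw [e0]; exact h1
    have hcomp := h1'.hasMFDerivAt.comp (0 : ℝ) (hlin.hasFDerivAt.hasMFDerivAt)
    have h2' : velocityVec (n := n) c (1 * (0 : ℝ) + t) ∈ F.tangent (c (1 * (0 : ℝ) + t)) := by
      rw [e0]; exact h2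
    have hvel : velocityVec (n := n) (fun τ => c (1 * τ + t)) 0 =
        velocityVec (n := n) c (1 * (0 : ℝ) + t) := by
      have h4 := hcomp.mfderiv
      refine (congrArg (fun K : ℝ →L[ℝ] TangentSpace (𝓡 n) (c (1 * (0 : ℝ) + t)) => K 1) h4).trans ?_
      exact congrArg (mfderiv 𝓘(ℝ, ℝ) (𝓡 n) c (1 * (0 : ℝ) + t)) (one_smul ℝ (1 : ℝ))
    have hev := F.eventually_infDist_le hF (y := y) (σ := fun τ => c (1 * τ + t))
      hcomp.mdifferentiableAt (by rw [hvel]; exact h2') (by simp only [e0]; exact hoff _ h3)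
      (half_pos hr)
    refine Filter.Eventually.frequently ?_
    have hmap : Filter.Tendsto (fun z : ℝ => z - t) (𝓝[>] t) (𝓝[>] 0) := by
      refine tendsto_nhdsWithin_of_tendsto_nhds_of_eventually_within _ ?_ ?_
      · have : Filter.Tendsto (fun z : ℝ => z - t) (𝓝 t) (𝓝 (t - t)) := by
          exact (continuous_id.sub continuous_const).continuousAt
        rw [sub_self] at this
        exact this.mono_left nhdsWithin_le_nhds
      · filter_upwards [self_mem_nhdsWithin] with z hz using mem_Ioi.2 (sub_pos.2 (mem_Ioi.1 hz))
    filter_upwards [hmap.eventually hev, self_mem_nhdsWithin] with z hz hzt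
    have hzt' : 0 < z - t := sub_pos.2 (mem_Ioi.1 hzt)
    rw [slope_def_field, div_lt_iff₀ hzt']
    have e1 : 1 * (z - t) + t = z := by ring
    simp only [e1, e0] at hz
    nlinarith
  obtain ⟨k, N, _, _, _, i, hN, hi, -, hrange, htan⟩ := F.leaf_immersed x
  have hmem : ∀ z : N, F.leafRel x (i z) := fun z => by
    have : i z ∈ {q | F.leafRel x q} := by rw [← hrange]; exact mem_range_self z
    exact this
  -- Coordinate segments in the leaf can be run in both directions, so the distance is constant on
  -- small chart balls; connectedness of the leaf does the rest.
  have hloc : IsLocallyConstant fun z : N => Metric.infDist (i z) (F.leaf y) := by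
    rw [IsLocallyConstant.iff_eventually_eq]
    intro z
    obtain ⟨ε, hε, hball⟩ := Metric.isOpen_iff.1 (isOpen_extChartAt_target (I := 𝓡 k) z)
      (extChartAt (𝓡 k) z z) (mem_extChartAt_target (I := 𝓡 k) z)
    have hev : ∀ᶠ z' in 𝓝 z, extChartAt (𝓡 k) z z' ∈ Metric.ball (extChartAt (𝓡 k) z z) ε :=
      (continuousAt_extChartAt z).eventually (Metric.ball_mem_nhds _ hε)
    have hline : ∀ a ∈ Metric.ball (extChartAt (𝓡 k) z z) ε,
        ∀ b ∈ Metric.ball (extChartAt (𝓡 k) z z) ε,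
        Metric.infDist (i ((extChartAt (𝓡 k) z).symm b)) (F.leaf y) ≤
          Metric.infDist (i ((extChartAt (𝓡 k) z).symm a)) (F.leaf y) := by
      intro a ha b hb
      have := hcurve (fun t => i ((extChartAt (𝓡 k) z).symm (AffineMap.lineMap a b t))) ?_
      · simpa using this
      intro t ht
      have hin : AffineMap.lineMap a b t ∈ (extChartAt (𝓡 k) z).target := hball
        ((convex_ball _ _).lineMap_mem ha hb ht)
      have h1 : MDifferentiableAt 𝓘(ℝ, EuclideanSpace ℝ (Fin k)) (𝓡 k) (extChartAt (𝓡 k) z).symm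
          (AffineMap.lineMap a b t) :=
        ((contMDiffOn_extChartAt_symm (n := ∞) z).contMDiffAt
          ((isOpen_extChartAt_target z).mem_nhds hin)).mdifferentiableAt (by simp)
      have h2 : MDifferentiableAt 𝓘(ℝ, ℝ) 𝓘(ℝ, EuclideanSpace ℝ (Fin k))
          (fun t : ℝ => AffineMap.lineMap a b t) t :=
        (AffineMap.hasDerivAt_lineMap).differentiableAt.mdifferentiableAt
      have h3 := h1.hasMFDerivAt.comp t h2.hasMFDerivAt
      have h4 : MDifferentiableAt (𝓡 k) (𝓡 n) i
        ((extChartAt (𝓡 k) z).symm (AffineMap.lineMap a b t)) := (hi _).mdifferentiableAt (by simp)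
      refine ⟨(h4.hasMFDerivAt.comp t h3).mdifferentiableAt, ?_, hmem _⟩
      refine ((htan ((extChartAt (𝓡 k) z).symm (AffineMap.lineMap a b t))).2 _).2
        ⟨mfderiv 𝓘(ℝ, ℝ) (𝓡 k)
          ((extChartAt (𝓡 k) z).symm ∘ fun t : ℝ => AffineMap.lineMap a b t) t (1 : ℝ), ?_⟩
      · exact (congrArg (fun K : ℝ →L[ℝ] TangentSpace (𝓡 n)
          (i ((extChartAt (𝓡 k) z).symm (AffineMap.lineMap a b t))) => K 1)
          (h4.hasMFDerivAt.comp t h3.mdifferentiableAt.hasMFDerivAt).mfderiv).symm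
    filter_upwards [hev, extChartAt_source_mem_nhds (I := 𝓡 k) z] with z' hz' hz's
    have hz0 : extChartAt (𝓡 k) z z ∈ Metric.ball (extChartAt (𝓡 k) z z) ε :=
      Metric.mem_ball_self hε
    have h1 := hline _ hz0 _ hz'
    have h2 := hline _ hz' _ hz0
    rw [(extChartAt (𝓡 k) z).left_inv hz's, extChartAt_to_inv] at h1 h2
    exact le_antisymm h1 h2
  have hp : x ∈ range i := by rw [hrange]; exact F.leafRel.refl x
  have hq : x' ∈ range i := by rw [hrange]; exact h
  obtain ⟨a, rfl⟩ := hp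
  obtain ⟨b, rfl⟩ := hq
  exact hloc.apply_eq_of_preconnectedSpace b a

end SingularFoliation

/-! ### The tube around the stratum -/

namespace SingularFoliation

set_option maxSynthPendingDepth 3

universe u

variable {n : ℕ} {M : Type u} [MetricSpace M] [ChartedSpace (EuclideanSpace ℝ (Fin n)) M]

local notation "𝔼" => EuclideanSpace ℝ (Fin n)

variable [IsManifold (𝓡 n) ∞ M] [RiemannianBundle (fun x : M => TangentSpace (𝓡 n) x)]
  [IsContMDiffRiemannianBundle (𝓡 n) ∞ (EuclideanSpace ℝ (Fin n))
    (fun x : M => TangentSpace (𝓡 n) x)]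

section Bundle

variable {EX HX X : Type*} [NormedAddCommGroup EX] [NormedSpace ℝ EX] [TopologicalSpace HX]
  {IX : ModelWithCorners ℝ EX HX} [TopologicalSpace X] [ChartedSpace HX X]

theorem contMDiffWithinAt_scale {f : X → ℝ} {v : X → TangentBundle (𝓡 n) M} {s : Set X} {x : X}
    (hf : ContMDiffWithinAt IX 𝓘(ℝ, ℝ) ∞ f s x) (hv : ContMDiffWithinAt IX (𝓡 n).tangent ∞ v s x) :
    ContMDiffWithinAt IX (𝓡 n).tangent ∞ (fun z => scale (f z) (v z)) s x := by
  have hv' := contMDiffWithinAt_totalSpace.1 hv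
  refine contMDiffWithinAt_totalSpace.2 ⟨hv'.1, ?_⟩
  have hmem : ∀ᶠ z in 𝓝[s] x, (v z).proj ∈ (trivializationAt 𝔼 (TangentSpace (𝓡 n)) (v x).proj).baseSet :=
    hv'.1.continuousWithinAt.eventually ((trivializationAt 𝔼 (TangentSpace (𝓡 n))
      (v x).proj).open_baseSet.mem_nhds (mem_baseSet_trivializationAt 𝔼 (TangentSpace (𝓡 n)) _))
  have key : ∀ z, (v z).proj ∈ (trivializationAt 𝔼 (TangentSpace (𝓡 n)) (v x).proj).baseSet →
      (trivializationAt 𝔼 (TangentSpace (𝓡 n)) (v x).proj (scale (f z) (v z))).2 =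
        f z • (trivializationAt 𝔼 (TangentSpace (𝓡 n)) (v x).proj (v z)).2 := fun z hz =>
    ((trivializationAt 𝔼 (TangentSpace (𝓡 n)) (v x).proj).linear ℝ hz).map_smul (f z) (v z).2
  refine ((hf.smul hv'.2).congr_of_eventuallyEq ?_ ?_)
  · filter_upwards [hmem] with z hz using key z hz
  · exact key x (mem_baseSet_trivializationAt 𝔼 (TangentSpace (𝓡 n)) _)

theorem contMDiffWithinAt_norm_sq {v : X → TangentBundle (𝓡 n) M} {s : Set X} {x : X}
    (hv : ContMDiffWithinAt IX (𝓡 n).tangent ∞ v s x) :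
    ContMDiffWithinAt IX 𝓘(ℝ, ℝ) ∞ (fun z => ‖(v z).2‖ ^ 2) s x := by
  have h := ContMDiffWithinAt.inner_bundle (IB := 𝓡 n) (F := 𝔼)
    (E := fun x : M => TangentSpace (𝓡 n) x) (b := fun z => (v z).proj)
    (v := fun z => (v z).2) (w := fun z => (v z).2) hv hv
  refine h.congr (fun z _ => ?_) ?_
  · exact (real_inner_self_eq_norm_sq _).symm
  · exact (real_inner_self_eq_norm_sq _).symm

theorem contMDiffWithinAt_norm {v : X → TangentBundle (𝓡 n) M} {s : Set X} {x : X}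
    (hv : ContMDiffWithinAt IX (𝓡 n).tangent ∞ v s x) (h0 : (v x).2 ≠ 0) :
    ContMDiffWithinAt IX 𝓘(ℝ, ℝ) ∞ (fun z => ‖(v z).2‖) s x := by
  have h : ContDiffAt ℝ ∞ Real.sqrt (‖(v x).2‖ ^ 2) := Real.contDiffAt_sqrt (by simpa using h0)
  have h2 := h.contMDiffAt.comp_contMDiffWithinAt x (contMDiffWithinAt_norm_sq hv)
  refine h2.congr (fun z _ => ?_) ?_
  · exact (Real.sqrt_sq (norm_nonneg _)).symm
  · exact (Real.sqrt_sq (norm_nonneg _)).symm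

theorem contMDiffWithinAt_normalize {v : X → TangentBundle (𝓡 n) M} {s : Set X} {x : X}
    (hv : ContMDiffWithinAt IX (𝓡 n).tangent ∞ v s x) (h0 : (v x).2 ≠ 0) :
    ContMDiffWithinAt IX (𝓡 n).tangent ∞ (fun z => scale ‖(v z).2‖⁻¹ (v z)) s x := by
  have h : ContDiffAt ℝ ∞ (fun y : ℝ => y⁻¹) ‖(v x).2‖ := contDiffAt_inv _ (norm_ne_zero_iff.2 h0)
  exact contMDiffWithinAt_scale
    (h.contMDiffAt.comp_contMDiffWithinAt x (contMDiffWithinAt_norm hv h0)) hv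

end Bundle

theorem continuous_norm_tangent : Continuous fun v : TangentBundle (𝓡 n) M => ‖v.2‖ := by
  have h : Continuous fun v : TangentBundle (𝓡 n) M => ‖v.2‖ ^ 2 :=
    continuous_iff_continuousAt.2 fun v =>
      (contMDiffWithinAt_norm_sq (s := univ) (IX := (𝓡 n).tangent) (v := id)
        contMDiffAt_id).continuousWithinAt.continuousAt Filter.univ_mem
  have h2 := Real.continuous_sqrt.comp h
  refine h2.congr fun v => Real.sqrt_sq (norm_nonneg _)

theorem continuous_scale (t : ℝ) : Continuous fun v : TangentBundle (𝓡 n) M => scale t v :=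
  continuous_iff_continuousAt.2 fun _ =>
    (contMDiffWithinAt_scale (s := univ) (IX := (𝓡 n).tangent) (f := fun _ => t) (v := id)
      contMDiffAt_const contMDiffAt_id).continuousWithinAt.continuousAt Filter.univ_mem

theorem norm_scale (t : ℝ) (v : TangentBundle (𝓡 n) M) : ‖(scale t v).2‖ = |t| * ‖v.2‖ := by
  change ‖t • v.2‖ = _
  rw [norm_smul, Real.norm_eq_abs]

theorem IsGeodesic.exp_scale_velocity {γ : ℝ → M} [IsRiemannianManifold (𝓡 n) M] [CompleteSpace M]
    (h : IsGeodesic (n := n) γ) (t s : ℝ) :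
    exp (scale s (velocity (n := n) γ t)) = γ (s + t) := by
  have h1 := (h.affine 1 t).exp_scale s
  have h2 := h.velocity_affine 1 t 0
  rw [h2, scale_one] at h1
  simpa using h1

theorem zero_mem_normalBundle {S : Set M} {q : M} (hq : q ∈ S) :
    (⟨q, 0⟩ : TangentBundle (𝓡 n) M) ∈ normalBundle S := by
  refine ⟨hq, fun c hc hS w hw => ?_⟩
  have hc0 : c 0 = q := congrArg TotalSpace.proj hw
  subst hc0
  have : w = 0 := by simpa using hw
  rw [this, inner_zero_right]

/-! ### The inverse of the normal exponential map. -/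

namespace IsTubularRadius

variable {S : Set M} {r : ℝ}

/-- The inverse of the normal exponential map. -/
noncomputable def log (hr : IsTubularRadius n S r) : M → TangentBundle (𝓡 n) M := hr.inverse.choose

theorem contMDiffOn_log (hr : IsTubularRadius n S r) : ContMDiffOn (𝓡 n) (𝓡 n).tangent ∞ hr.log (Metric.thickening r S) :=
  hr.inverse.choose_spec.1

theorem log_mem (hr : IsTubularRadius n S r) {x : M} (hx : x ∈ Metric.thickening r S) : hr.log x ∈ normalBundle S :=
  (hr.inverse.choose_spec.2.1 x hx).1

theorem norm_log_lt (hr : IsTubularRadius n S r) {x : M} (hx : x ∈ Metric.thickening r S) : ‖(hr.log x).2‖ < r :=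
  (hr.inverse.choose_spec.2.1 x hx).2.1

theorem exp_log (hr : IsTubularRadius n S r) {x : M} (hx : x ∈ Metric.thickening r S) : exp (hr.log x) = x :=
  (hr.inverse.choose_spec.2.1 x hx).2.2

theorem log_exp (hr : IsTubularRadius n S r) {v : TangentBundle (𝓡 n) M} (hv : v ∈ normalBundle S) (h : ‖v.2‖ < r) :
    hr.log (exp v) = v := hr.inverse.choose_spec.2.2 v hv h

theorem subset_tube (hr : IsTubularRadius n S r) : S ⊆ Metric.thickening r S := Metric.self_subset_thickening hr.pos S

variable [IsRiemannianManifold (𝓡 n) M] [CompleteSpace M]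

theorem exp_zero (q : M) : exp (⟨q, 0⟩ : TangentBundle (𝓡 n) M) = q := by
  have h := exp_scale_zero (⟨q, 0⟩ : TangentBundle (𝓡 n) M)
  have h2 : scale 0 (⟨q, 0⟩ : TangentBundle (𝓡 n) M) = ⟨q, 0⟩ := by simp [scale]
  rwa [h2] at h

theorem log_of_mem (hr : IsTubularRadius n S r) {q : M} (hq : q ∈ S) : hr.log q = ⟨q, 0⟩ := by
  have h := hr.log_exp (zero_mem_normalBundle hq) (by simpa using hr.pos)
  rwa [exp_zero] at h

theorem mem_iff_log_eq_zero (hr : IsTubularRadius n S r) {x : M} (hx : x ∈ Metric.thickening r S) :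
    x ∈ S ↔ (hr.log x).2 = 0 := by
  refine ⟨fun h => ?_, fun h => ?_⟩
  · have h1 := congrArg (fun v : TangentBundle (𝓡 n) M => ‖v.2‖) (hr.log_of_mem h)
    simp only [norm_zero, norm_eq_zero] at h1
    exact h1
  · have h1 : hr.log x = ⟨(hr.log x).proj, 0⟩ := by rw [← h]
    have h2 := hr.exp_log hx
    rw [h1, exp_zero] at h2
    rw [← h2]
    exact (hr.log_mem hx).1

/-- Within the tube, which contains the closure of `S`, the stratum is the zero set of the
continuous function ‖log‖. -/
theorem isClosed (hr : IsTubularRadius n S r) : IsClosed S := by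
  refine isClosed_of_closure_subset fun p hp => ?_
  have hpB : p ∈ Metric.thickening r S :=
    Metric.closure_subset_thickening hr.pos S hp
  rw [hr.mem_iff_log_eq_zero hpB, ← norm_eq_zero]
  have hc : ContinuousAt (fun x => ‖(hr.log x).2‖) p :=
    continuous_norm_tangent.continuousAt.comp (f := hr.log)
      (hr.contMDiffOn_log.continuousOn.continuousAt (Metric.isOpen_thickening.mem_nhds hpB))
  have : Filter.Tendsto (fun x => ‖(hr.log x).2‖) (𝓝[S] p) (𝓝 0) := by
    refine tendsto_const_nhds.congr' ?_
    filter_upwards [self_mem_nhdsWithin] with x hx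
    rw [((hr.mem_iff_log_eq_zero (hr.subset_tube hx)).1 hx), norm_zero]
  have hne : (𝓝[S] p).NeBot := mem_closure_iff_nhdsWithin_neBot.1 hp
  exact tendsto_nhds_unique (hc.tendsto.mono_left nhdsWithin_le_nhds) this

end IsTubularRadius

variable [IsRiemannianManifold (𝓡 n) M]

/-- First variation gives an inequality for each curve in `S`; the reversed curve gives the opposite
one. -/
theorem velocity_mem_normalBundle {S : Set M} {γ : ℝ → M} (hγ : IsGeodesic (n := n) γ)
    (h1 : ‖velocityVec (n := n) γ 0‖ = 1) {ℓ : ℝ} (hℓ : 0 < ℓ)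
    (hd : Metric.infDist (γ 0) S = ℓ) (hS : γ ℓ ∈ S) :
    velocity (n := n) γ ℓ ∈ normalBundle S := by
  refine ⟨hS, fun c hc hcS w hw => ?_⟩
  have hw0 : c 0 = γ ℓ := congrArg TotalSpace.proj hw
  have aux : ∀ (σ : ℝ → M) (_ : MDifferentiableAt 𝓘(ℝ, ℝ) (𝓡 n) σ 0) (_ : ∀ t, σ t ∈ S)
      (b : TangentSpace (𝓡 n) (γ ℓ)), velocity σ 0 = (⟨γ ℓ, b⟩ : TangentBundle (𝓡 n) M) →
      0 ≤ ⟪velocityVec (n := n) γ ℓ, b⟫ := fun σ hσ hσS b hb =>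
    inner_velocity_nonneg_of_infDist hγ h1 hℓ hd hσ hb
      (Filter.Eventually.frequently (Filter.Eventually.of_forall hσS))
  obtain ⟨b, hb⟩ : ∃ b : TangentSpace (𝓡 n) (γ ℓ),
      velocity c 0 = (⟨γ ℓ, b⟩ : TangentBundle (𝓡 n) M) := by
    rw [← hw0]; exact ⟨velocityVec c 0, rfl⟩
  have hcd : MDifferentiableAt 𝓘(ℝ, ℝ) (𝓡 n) c 0 := (hc 0).mdifferentiableAt (by simp)
  have hpos := aux c hcd hcS b hb
  have hlin : HasDerivAt (fun τ : ℝ => -τ) (-1) 0 := hasDerivAt_neg' 0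
  have hcd' : MDifferentiableAt 𝓘(ℝ, ℝ) (𝓡 n) c (-0 : ℝ) := by rw [neg_zero]; exact hcd
  have hcomp := hcd'.hasMFDerivAt.comp (0 : ℝ) (hlin.hasFDerivAt.hasMFDerivAt)
  have hvel : velocity (n := n) (fun τ => c (-τ)) 0 = ⟨γ ℓ, -b⟩ := by
    have h4 := hcomp.mfderiv
    have h5 : velocity (n := n) (fun τ => c (-τ)) 0 = scale (-1) (velocity c (-0 : ℝ)) := by
      refine congrArg (fun w => (⟨c (-0 : ℝ), w⟩ : TangentBundle (𝓡 n) M)) ?_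
      refine (congrArg (fun K : ℝ →L[ℝ] TangentSpace (𝓡 n) (c (-0 : ℝ)) => K 1) h4).trans ?_
      have h6 : (ContinuousLinearMap.toSpanSingleton ℝ (-1 : ℝ)) (1 : ℝ) = (-1 : ℝ) • (1 : ℝ) := by
        simp
      refine (congrArg (mfderiv 𝓘(ℝ, ℝ) (𝓡 n) c (-0 : ℝ)) h6).trans ?_
      exact (mfderiv 𝓘(ℝ, ℝ) (𝓡 n) c (-0 : ℝ)).map_smul (-1 : ℝ) (1 : ℝ)
    rw [h5, neg_zero, hb]
    simp [scale]
  have hneg := aux (fun τ => c (-τ)) hcomp.mdifferentiableAt (fun t => hcS _) (-b) hvel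
  rw [inner_neg_right] at hneg
  have h0 : ⟪velocityVec (n := n) γ ℓ, b⟫ = 0 := by linarith
  rw [inner_congr _ (velocityVec (n := n) c 0) w _ b (velocityVec (n := n) γ ℓ) hb hw, real_inner_comm]
  exact h0

variable [CompleteSpace M] {S : Set M} {r : ℝ}

/-- A minimizing geodesic from `x` to `S` arrives perpendicularly; run backwards it is a normal ray
ending at `x`, and by injectivity of the normal exponential map it is the one given by `log`. -/
theorem IsTubularRadius.norm_log (hr : IsTubularRadius n S r) (hne : S.Nonempty) {x : M}
    (hx : x ∈ Metric.thickening r S) : ‖(hr.log x).2‖ = Metric.infDist x S := by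
  by_cases hxS : x ∈ S
  · rw [(hr.mem_iff_log_eq_zero hx).1 hxS, norm_zero, Metric.infDist_zero_of_mem hxS]
  obtain ⟨γ, hγ, h1, h0, hd⟩ := exists_geodesic_to_closed (n := n) hr.isClosed hne hxS
  set ℓ := Metric.infDist x S with hℓ
  have hℓ0 : 0 < ℓ := (hr.isClosed.notMem_iff_infDist_pos hne).1 hxS
  have hℓr : ℓ < r := (Metric.mem_thickening_iff_infDist_lt hne).1 hx
  have hend : γ ℓ ∈ S := by
    rw [hr.isClosed.mem_iff_infDist_zero hne, hd ℓ (right_mem_Icc.2 hℓ0.le), sub_self]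
  have hv := velocity_mem_normalBundle hγ h1 hℓ0 (by rw [h0]) hend
  have hnorm : ‖(scale (-ℓ) (velocity (n := n) γ ℓ)).2‖ = ℓ := by
    rw [norm_scale]
    change |(-ℓ)| * ‖velocityVec (n := n) γ ℓ‖ = ℓ
    rw [hγ.norm_velocity ℓ 0, h1, mul_one, abs_neg, abs_of_pos hℓ0]
  have hlog := hr.log_exp (scale_mem_normalBundle hv (-ℓ)) (by rw [hnorm]; exact hℓr)
  rw [hγ.exp_scale_velocity, neg_add_cancel, h0] at hlog
  rw [hlog, hnorm]

theorem IsTubularRadius.log_exp_scale (hr : IsTubularRadius n S r) {t : ℝ}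
    {ξ : TangentBundle (𝓡 n) M} (hd : (t, ξ) ∈ polarDomain S r) :
    exp (scale t ξ) ∈ Metric.thickening r S ∧ hr.log (exp (scale t ξ)) = scale t ξ := by
  have h1 : ‖(scale t ξ).2‖ < r := by
    rw [norm_scale, hd.2.2, mul_one]; exact hd.1
  exact ⟨hr.mapsTo _ (scale_mem_normalBundle hd.2.1 t) h1,
    hr.log_exp (scale_mem_normalBundle hd.2.1 t) h1⟩

theorem IsTubularRadius.infDist_exp_scale (hr : IsTubularRadius n S r) (hne : S.Nonempty) {t : ℝ}
    {ξ : TangentBundle (𝓡 n) M} (hd : (t, ξ) ∈ polarDomain S r) :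
    Metric.infDist (exp (scale t ξ)) S = |t| := by
  obtain ⟨h1, h2⟩ := hr.log_exp_scale hd
  rw [← hr.norm_log hne h1, h2, norm_scale, hd.2.2, mul_one]

/-- `S` is a union of leaves, and the distance to each leaf is constant along leaves. -/
theorem SRF.IsMinimalStratum.infDist_eq {F : SRF n M} (hF : F.HasClosedLeaves)
    (hS : F.IsMinimalStratum S) {x x' : M} (h : F.leafRel x x') :
    Metric.infDist x S = Metric.infDist x' S := by
  have key : ∀ x x' : M, F.leafRel x x' → Metric.infDist x' S ≤ Metric.infDist x S := by
    intro x x' h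
    refine (Metric.le_infDist hS.nonempty).2 fun {p} hp => ?_
    have h1 : F.leaf p ⊆ S := fun z hz => hS.saturated hp hz
    calc Metric.infDist x' S ≤ Metric.infDist x' (F.leaf p) :=
          Metric.infDist_le_infDist_of_subset h1 ⟨p, F.mem_leaf_self p⟩
      _ = Metric.infDist x (F.leaf p) := F.infDist_leaf_eq hF h p
      _ ≤ dist x p := Metric.infDist_le_dist_of_mem (F.mem_leaf_self p)
  exact le_antisymm (key _ _ (F.leafRel.symm h)) (key _ _ h)

theorem SRF.IsMinimalStratum.mem_thickening {F : SRF n M} (hF : F.HasClosedLeaves)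
    (hS : F.IsMinimalStratum S) {x x' : M} (h : F.leafRel x x')
    (hx : x ∈ Metric.thickening r S) : x' ∈ Metric.thickening r S := by
  rw [Metric.mem_thickening_iff_infDist_lt hS.nonempty] at hx ⊢
  rwa [← hS.infDist_eq hF h]

end SingularFoliation

/-! ### The normal bundle of the stratum -/

namespace SingularFoliation

set_option maxSynthPendingDepth 3

universe u

variable {n : ℕ} {M : Type u} [MetricSpace M] [ChartedSpace (EuclideanSpace ℝ (Fin n)) M]

local notation "𝔼" => EuclideanSpace ℝ (Fin n)

variable [IsManifold (𝓡 n) ∞ M] [RiemannianBundle (fun x : M => TangentSpace (𝓡 n) x)]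
  [IsContMDiffRiemannianBundle (𝓡 n) ∞ (EuclideanSpace ℝ (Fin n))
    (fun x : M => TangentSpace (𝓡 n) x)]
  [IsRiemannianManifold (𝓡 n) M] [CompleteSpace M] {S : Set M} {r : ℝ}

/-- Unit normal vectors whose foot points converge in `S` accumulate at a unit normal vector. -/
theorem IsTubularRadius.exists_tendsto (hr : IsTubularRadius n S r) {ι : Type*} (𝒰 : Ultrafilter ι)
    {ξ : ι → TangentBundle (𝓡 n) M} (hξ : ∀ᶠ i in (𝒰 : Filter ι), ξ i ∈ normalBundle S ∧ ‖(ξ i).2‖ = 1)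
    {q : M} (hqS : q ∈ S) (hq : Filter.Tendsto (fun i => (ξ i).proj) 𝒰 (𝓝 q)) :
    ∃ ξ₀ : TangentBundle (𝓡 n) M, ξ₀ ∈ normalBundle S ∧ ‖ξ₀.2‖ = 1 ∧ ξ₀.proj = q ∧
      Filter.Tendsto ξ 𝒰 (𝓝 ξ₀) := by
  have : LocallyCompactSpace M := ChartedSpace.locallyCompactSpace 𝔼 M
  obtain ⟨ε₀, hε₀, hK⟩ := Metric.exists_isCompact_closedBall q
  obtain ⟨ε, hε, hε1, hε2⟩ : ∃ ε : ℝ, 0 < ε ∧ 2 * ε ≤ ε₀ ∧ 2 * ε < r := by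
    refine ⟨min (ε₀ / 2) (r / 4), lt_min (by linarith) (by linarith [hr.pos]), ?_, ?_⟩
    · linarith [min_le_left (ε₀ / 2) (r / 4)]
    · linarith [min_le_right (ε₀ / 2) (r / 4), hr.pos]
  -- Compactness is taken from `M`: the points exp(εξ) lie in a compact ball around `q` inside the
  -- tube, and `log` recovers ξ continuously from them.
  set y : ι → M := fun i => exp (scale ε (ξ i)) with hy
  have hyK : ∀ᶠ i in (𝒰 : Filter ι), y i ∈ Metric.closedBall q (2 * ε) := by
    filter_upwards [hξ, hq.eventually (Metric.closedBall_mem_nhds q hε)] with i hi hqi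
    have h1 := (isGeodesic_exp (ξ i)).1.dist_le (?_) 0 ε
    · rw [exp_scale_zero, sub_zero, abs_of_pos hε] at h1
      rw [Metric.mem_closedBall]
      calc dist (y i) q ≤ dist (y i) (ξ i).proj + dist (ξ i).proj q := dist_triangle _ _ _
        _ ≤ ε + ε := by
          rw [dist_comm (y i)]
          exact add_le_add h1 hqi
        _ = 2 * ε := by ring
    · exact (congrArg (fun v : TangentBundle (𝓡 n) M => ‖v.2‖) (isGeodesic_exp (ξ i)).2).trans hi.2
  obtain ⟨x, hx, hlim⟩ := isCompact_iff_ultrafilter_le_nhds.1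
    (hK.of_isClosed_subset Metric.isClosed_closedBall (Metric.closedBall_subset_closedBall hε1))
    (𝒰.map y) (Filter.le_principal_iff.2 hyK)
  have hxB : x ∈ Metric.thickening r S :=
    Metric.mem_thickening_iff.2 ⟨q, hqS, lt_of_le_of_lt hx hε2⟩
  have hlog : Filter.Tendsto (fun i => hr.log (y i)) 𝒰 (𝓝 (hr.log x)) :=
    (hr.contMDiffOn_log.continuousOn.continuousAt
      (Metric.isOpen_thickening.mem_nhds hxB)).tendsto.comp hlim
  have hlim2 : Filter.Tendsto ξ 𝒰 (𝓝 (scale ε⁻¹ (hr.log x))) := by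
    refine (((continuous_scale ε⁻¹).tendsto (hr.log x)).comp hlog).congr' ?_
    filter_upwards [hξ] with i hi
    have hd : (ε, ξ i) ∈ polarDomain S r := ⟨by rw [abs_of_pos hε]; linarith, hi.1, hi.2⟩
    simp only [Function.comp_apply, hy]
    rw [(hr.log_exp_scale hd).2, scale_scale, inv_mul_cancel₀ hε.ne', scale_one]
  refine ⟨scale ε⁻¹ (hr.log x), scale_mem_normalBundle (hr.log_mem hxB) _, ?_, ?_, hlim2⟩
  · refine tendsto_nhds_unique ((continuous_norm_tangent.tendsto _).comp hlim2)
      (tendsto_const_nhds.congr' ?_)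
    filter_upwards [hξ] with i hi using hi.2.symm
  · exact tendsto_nhds_unique
      (((FiberBundle.continuous_proj 𝔼 (TangentSpace (𝓡 n))).tendsto _).comp hlim2) hq

namespace IsTubularRadius

/-- The foot point projection of the tube, in the preferred chart around `p`. -/
noncomputable def chartFoot (hr : IsTubularRadius n S r) (p : M) (y : 𝔼) : 𝔼 :=
  extChartAt (𝓡 n) p (hr.log ((extChartAt (𝓡 n) p).symm y)).proj

theorem foot_eq (hr : IsTubularRadius n S r) {q : M} (hq : q ∈ S) : (hr.log q).proj = q :=
  congrArg TotalSpace.proj (hr.log_of_mem hq)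

theorem contMDiffAt_foot (hr : IsTubularRadius n S r) {x : M} (hx : x ∈ Metric.thickening r S) :
    ContMDiffAt (𝓡 n) (𝓡 n) ∞ (fun x => (hr.log x).proj) x :=
  (contMDiffAt_totalSpace.1 (hr.contMDiffOn_log.contMDiffAt
    (Metric.isOpen_thickening.mem_nhds hx))).1

theorem chartFoot_chart (hr : IsTubularRadius n S r) {p q : M} (hq : q ∈ S)
    (hp : q ∈ (extChartAt (𝓡 n) p).source) :
    hr.chartFoot p (extChartAt (𝓡 n) p q) = extChartAt (𝓡 n) p q := by
  rw [chartFoot, (extChartAt (𝓡 n) p).left_inv hp, hr.foot_eq hq]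

theorem contDiffAt_chartFoot (hr : IsTubularRadius n S r) {p q : M} (hq : q ∈ S)
    (hp : q ∈ (extChartAt (𝓡 n) p).source) :
    ContDiffAt ℝ ∞ (hr.chartFoot p) (extChartAt (𝓡 n) p q) := by
  rw [← contMDiffAt_iff_contDiffAt]
  have h1 := contMDiffAt_chart_symm ((extChartAt (𝓡 n) p).map_source hp)
  have e1 := (extChartAt (𝓡 n) p).left_inv hp
  have h2 : ContMDiffAt (𝓡 n) (𝓡 n) ∞ (fun x => (hr.log x).proj)
      ((extChartAt (𝓡 n) p).symm (extChartAt (𝓡 n) p q)) := by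
    rw [e1]; exact hr.contMDiffAt_foot (hr.subset_tube hq)
  have h3 : ContMDiffAt (𝓡 n) 𝓘(ℝ, 𝔼) ∞ (extChartAt (𝓡 n) p)
      (hr.log ((extChartAt (𝓡 n) p).symm (extChartAt (𝓡 n) p q))).proj := by
    rw [e1, hr.foot_eq hq]; exact contMDiffAt_chart hp
  have h4 := ContMDiffAt.comp (g := extChartAt (𝓡 n) p) (f := fun x => (hr.log x).proj) _ h3 h2
  exact h4.comp (f := (extChartAt (𝓡 n) p).symm) _ h1

theorem hasFDerivAt_chartFoot (hr : IsTubularRadius n S r) {p q : M} (hq : q ∈ S)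
    (hp : q ∈ (extChartAt (𝓡 n) p).source) :
    HasFDerivAt (hr.chartFoot p) (fderiv ℝ (hr.chartFoot p) (extChartAt (𝓡 n) p q))
      (extChartAt (𝓡 n) p q) :=
  ((hr.contDiffAt_chartFoot hq hp).differentiableAt (by simp)).hasFDerivAt

theorem contDiffAt_fderiv_chartFoot (hr : IsTubularRadius n S r) {p : M} (hp : p ∈ S) :
    ContDiffAt ℝ ∞ (fderiv ℝ (hr.chartFoot p)) (extChartAt (𝓡 n) p p) :=
  (hr.contDiffAt_chartFoot hp (mem_extChartAt_source p)).fderiv_right (by simp)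

/-- The foot point map is a retraction that fixes `S` pointwise, so its differential fixes vectors
tangent to `S`. -/
theorem fderiv_chartFoot_velocity (hr : IsTubularRadius n S r) {p : M} {c : ℝ → M}
    (hc : MDifferentiableAt 𝓘(ℝ, ℝ) (𝓡 n) c 0) (hcS : ∀ t, c t ∈ S)
    (hp : c 0 ∈ (extChartAt (𝓡 n) p).source) :
    fderiv ℝ (hr.chartFoot p) (extChartAt (𝓡 n) p (c 0))
      (tangentCoord p (c 0) (velocityVec c 0)) = tangentCoord p (c 0) (velocityVec c 0) := by
  have h1 := hasDerivAt_chart_comp hc hp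
  have h2 := (hr.hasFDerivAt_chartFoot (hcS 0) hp).comp_hasDerivAt (0 : ℝ) h1
  refine (h2.congr_of_eventuallyEq ?_).unique h1
  filter_upwards [hc.continuousAt.eventually ((isOpen_extChartAt_source p).mem_nhds hp)] with t ht
  exact (hr.chartFoot_chart (hcS t) ht).symm

/-- The foot point map takes values in `S`; if its differential at `p` is the identity, it is open
at `p`, so `S` contains a neighbourhood of `p`. -/
theorem mem_interior_of_fderiv_eq (hr : IsTubularRadius n S r) {p : M} (hp : p ∈ S)
    (h : fderiv ℝ (hr.chartFoot p) (extChartAt (𝓡 n) p p) = ContinuousLinearMap.id ℝ 𝔼) :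
    p ∈ interior S := by
  have hps := mem_extChartAt_source (I := 𝓡 n) p
  have h1 : HasStrictFDerivAt (hr.chartFoot p) (ContinuousLinearMap.id ℝ 𝔼)
      (extChartAt (𝓡 n) p p) := by
    rw [← h]
    exact (hr.contDiffAt_chartFoot hp hps).hasStrictFDerivAt (by simp)
  have h2 := h1.map_nhds_eq_of_surj (LinearMap.range_eq_top.2 fun x => ⟨x, rfl⟩)
  rw [hr.chartFoot_chart hp hps] at h2
  have h3 : {z | (extChartAt (𝓡 n) p).symm z ∈ S} ∈ 𝓝 (extChartAt (𝓡 n) p p) := by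
    rw [← h2, Filter.mem_map]
    have hcont : ContinuousAt (fun y => (hr.log ((extChartAt (𝓡 n) p).symm y)).proj)
        (extChartAt (𝓡 n) p p) := by
      refine ContinuousAt.comp (f := (extChartAt (𝓡 n) p).symm) (g := fun x => (hr.log x).proj) ?_
        (continuousAt_extChartAt_symm p)
      rw [extChartAt_to_inv]
      exact (hr.contMDiffAt_foot (hr.subset_tube hp)).continuousAt
    have hB : ∀ᶠ y in 𝓝 (extChartAt (𝓡 n) p p),
        (extChartAt (𝓡 n) p).symm y ∈ Metric.thickening r S := by
      refine (continuousAt_extChartAt_symm p).eventually (Metric.isOpen_thickening.mem_nhds ?_)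
      rw [extChartAt_to_inv]
      exact hr.subset_tube hp
    have hsrc : ∀ᶠ y in 𝓝 (extChartAt (𝓡 n) p p),
        (hr.log ((extChartAt (𝓡 n) p).symm y)).proj ∈ (extChartAt (𝓡 n) p).source := by
      refine hcont.eventually ((isOpen_extChartAt_source p).mem_nhds ?_)
      beta_reduce
      rw [extChartAt_to_inv, hr.foot_eq hp]
      exact hps
    filter_upwards [hB, hsrc] with y hy hy'
    change (extChartAt (𝓡 n) p).symm (hr.chartFoot p y) ∈ S
    rw [chartFoot, (extChartAt (𝓡 n) p).left_inv hy']
    exact (hr.log_mem hy).1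
  rw [mem_interior_iff_mem_nhds]
  filter_upwards [(continuousAt_extChartAt p).eventually h3, (isOpen_extChartAt_source p).mem_nhds hps]
    with q hq hq'
  have hq2 : (extChartAt (𝓡 n) p).symm (extChartAt (𝓡 n) p q) ∈ S := hq
  rwa [(extChartAt (𝓡 n) p).left_inv hq'] at hq2

/-- On the interior of `S` the retraction is the identity, so its differential is too. By continuity
this persists at closure points, which are then interior by `mem_interior_of_fderiv_eq`. -/
theorem isClosed_interior (hr : IsTubularRadius n S r) : IsClosed (interior S) := by
  refine isClosed_of_closure_subset fun p hp => ?_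
  have hpS : p ∈ S := hr.isClosed.closure_subset_iff.2 interior_subset hp
  refine hr.mem_interior_of_fderiv_eq hpS ?_
  have hne : (𝓝[interior S] p).NeBot := mem_closure_iff_nhdsWithin_neBot.1 hp
  have h1 : Filter.Tendsto (fun q => fderiv ℝ (hr.chartFoot p) (extChartAt (𝓡 n) p q))
      (𝓝[interior S] p) (𝓝 (fderiv ℝ (hr.chartFoot p) (extChartAt (𝓡 n) p p))) :=
    ((hr.contDiffAt_fderiv_chartFoot hpS).continuousAt.tendsto.comp
      (continuousAt_extChartAt p)).mono_left nhdsWithin_le_nhds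
  refine tendsto_nhds_unique h1 (tendsto_const_nhds.congr' ?_)
  filter_upwards [self_mem_nhdsWithin, nhdsWithin_le_nhds
    ((isOpen_extChartAt_source (I := 𝓡 n) p).mem_nhds (mem_extChartAt_source p))] with q hq hqs
  refine ((hasFDerivAt_id (𝕜 := ℝ) (extChartAt (𝓡 n) p q)).congr_of_eventuallyEq ?_).fderiv.symm
  have h2 : ∀ᶠ y in 𝓝 (extChartAt (𝓡 n) p q), (extChartAt (𝓡 n) p).symm y ∈ interior S := by
    refine (continuousAt_extChartAt_symm'' ((extChartAt (𝓡 n) p).map_source hqs)).eventually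
      (isOpen_interior.mem_nhds ?_)
    rwa [(extChartAt (𝓡 n) p).left_inv hqs]
  filter_upwards [h2, (isOpen_extChartAt_target p).mem_nhds ((extChartAt (𝓡 n) p).map_source hqs)]
    with y hy hyt
  rw [chartFoot, hr.foot_eq (interior_subset hy), (extChartAt (𝓡 n) p).right_inv hyt]
  rfl

/-- The interior is open and closed. A geodesic from a point outside to a nonempty interior would
split the real line, so the existence of such geodesics plays the role of connectedness of `M`. -/
theorem interior_eq_empty (hr : IsTubularRadius n S r) (hne : S ≠ univ) : interior S = ∅ := by
  by_contra h0
  rw [← ne_eq, ← nonempty_iff_ne_empty] at h0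
  refine hne (univ_subset_iff.1 fun x _ => ?_)
  by_contra hx
  have hx' : x ∉ interior S := fun h => hx (interior_subset h)
  obtain ⟨γ, hγ, -, hγ0, hd⟩ := exists_geodesic_to_closed (n := n) hr.isClosed_interior h0 hx'
  have hclopen : IsClopen (γ ⁻¹' interior S) :=
    ⟨hr.isClosed_interior.preimage hγ.1.continuous, isOpen_interior.preimage hγ.1.continuous⟩
  have hend : Metric.infDist x (interior S) ∈ γ ⁻¹' interior S := by
    rw [mem_preimage, hr.isClosed_interior.mem_iff_infDist_zero h0,
      hd _ (right_mem_Icc.2 Metric.infDist_nonneg), sub_self]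
  rcases isClopen_iff.1 hclopen with h | h
  · rw [h] at hend; exact hend
  · have : (0 : ℝ) ∈ γ ⁻¹' interior S := by rw [h]; trivial
    rw [mem_preimage, hγ0] at this
    exact hx' this

/-- Around each point of `S` there is a smooth field of unit normal vectors. -/
theorem exists_unit_normal_field (hr : IsTubularRadius n S r) (hne : S ≠ univ) {p : M} (hp : p ∈ S) :
    ∃ ξ : M → TangentBundle (𝓡 n) M, ContMDiffAt (𝓡 n) (𝓡 n).tangent ∞ ξ p ∧
      ∀ᶠ q in 𝓝 p, q ∈ S → ξ q ∈ normalBundle S ∧ ‖(ξ q).2‖ = 1 ∧ (ξ q).proj = q := by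
  have hps := mem_extChartAt_source (I := 𝓡 n) p
  have hpt := mem_extChartAt_target (I := 𝓡 n) p
  have hP : fderiv ℝ (hr.chartFoot p) (extChartAt (𝓡 n) p p) ≠ ContinuousLinearMap.id ℝ 𝔼 :=
    fun h => by
      have := hr.mem_interior_of_fderiv_eq hp h
      rw [hr.interior_eq_empty hne] at this
      exact this
  obtain ⟨b, hb⟩ : ∃ b, fderiv ℝ (hr.chartFoot p) (extChartAt (𝓡 n) p p) b ≠ b := by
    by_contra! h
    exact hP (ContinuousLinearMap.ext h)
  set β := b - fderiv ℝ (hr.chartFoot p) (extChartAt (𝓡 n) p p) b with hβ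
  have hβ0 : β ≠ 0 := sub_ne_zero.2 (Ne.symm hb)
  -- With P the differential of the retraction, the covector ⟨β, (1 - P) ·⟩ kills vectors tangent to
  -- `S`, so its metric dual is normal at points of `S`. Its value on `b` at `p` is ‖β‖², hence it
  -- is nonzero.
  set α : 𝔼 → 𝔼 →L[ℝ] ℝ := fun y => (innerSL ℝ β).comp
    (ContinuousLinearMap.id ℝ 𝔼 - fderiv ℝ (hr.chartFoot p) y) with hα
  set a : 𝔼 → 𝔼 := fun y => ((chartLM p).coeff y).inverse (α y) with ha
  have haD : ContDiffAt ℝ ∞ a (extChartAt (𝓡 n) p p) :=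
    ((chartLM p).contDiffAt_inverse hpt).clm_apply
      (contDiffAt_const.clm_comp (contDiffAt_const.sub (hr.contDiffAt_fderiv_chartFoot hp)))
  have haα : ∀ y ∈ (extChartAt (𝓡 n) p).target, (chartLM p).coeff y (a y) = α y := fun y hy =>
    (chartLM p).coeff_inverse hy (α y)
  have ha0 : a (extChartAt (𝓡 n) p p) ≠ 0 := fun h0 => by
    have h1 := haα _ hpt
    rw [h0, map_zero] at h1
    have h2 := congrArg (fun L : 𝔼 →L[ℝ] ℝ => L b) h1
    have h3 : (0 : ℝ) = ⟪β, β⟫ := h2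
    rw [real_inner_self_eq_norm_sq] at h3
    exact hβ0 (norm_eq_zero.1 (pow_eq_zero_iff two_ne_zero |>.1 h3.symm))
  set N : M → TangentBundle (𝓡 n) M := fun q =>
    chartVec p (extChartAt (𝓡 n) p q) (a (extChartAt (𝓡 n) p q)) with hN
  have hND : ContMDiffAt (𝓡 n) (𝓡 n).tangent ∞ N p := by
    have h1 : ContMDiffAt (𝓘(ℝ, 𝔼).prod 𝓘(ℝ, 𝔼)) (𝓡 n).tangent ∞
        (fun z : 𝔼 × 𝔼 => chartVec p z.1 z.2) (extChartAt (𝓡 n) p p, a (extChartAt (𝓡 n) p p)) :=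
      (contMDiffOn_chartVec p).contMDiffAt
        (((isOpen_extChartAt_target p).prod isOpen_univ).mem_nhds ⟨hpt, trivial⟩)
    have h2 : ContMDiffAt (𝓡 n) 𝓘(ℝ, 𝔼) ∞ (fun q => a (extChartAt (𝓡 n) p q)) p :=
      haD.contMDiffAt.comp p (contMDiffAt_chart hps)
    exact ContMDiffAt.comp (g := fun z : 𝔼 × 𝔼 => chartVec p z.1 z.2)
      (f := fun q => (extChartAt (𝓡 n) p q, a (extChartAt (𝓡 n) p q))) p h1
      ((contMDiffAt_chart hps).prodMk h2)
  have hN0 : (N p).2 ≠ 0 := fun h => ha0 (mfderiv_chart_symm_injective hpt h)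
  refine ⟨fun q => scale ‖(N q).2‖⁻¹ (N q), contMDiffWithinAt_normalize hND hN0, ?_⟩
  have hev : ∀ᶠ q in 𝓝 p, ‖(N q).2‖ ≠ 0 :=
    (continuous_norm_tangent.continuousAt.comp (f := N) hND.continuousAt).eventually_ne
      (norm_ne_zero_iff.2 hN0)
  filter_upwards [hev, (isOpen_extChartAt_source p).mem_nhds hps] with q hq hqs hqS
  have hqt := (extChartAt (𝓡 n) p).map_source hqs
  have hproj : (N q).proj = q := (extChartAt (𝓡 n) p).left_inv hqs
  refine ⟨scale_mem_normalBundle ⟨hproj.symm ▸ hqS, fun c hc hcS w hw => ?_⟩ _, ?_, hproj⟩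
  · have hcq : c 0 = q := (congrArg TotalSpace.proj hw).trans hproj
    have hcs : c 0 ∈ (extChartAt (𝓡 n) p).source := by rw [hcq]; exact hqs
    have hcd : MDifferentiableAt 𝓘(ℝ, ℝ) (𝓡 n) c 0 := (hc 0).mdifferentiableAt (by simp)
    have hwc : tangentCoord p (c 0) w = a (extChartAt (𝓡 n) p q) :=
      (congrArg (fun v : TangentBundle (𝓡 n) M => tangentCoord p v.proj v.2) hw).trans
        (tangentCoord_chartVec hqt _)
    have hfix := hr.fderiv_chartFoot_velocity hcd hcS hcs
    rw [inner_eq_coeff hcs, hwc, (chartLM p).symm _ ((extChartAt (𝓡 n) p).map_source hcs), hcq,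
      haα _ hqt]
    rw [← hcq]
    change ⟪β, tangentCoord p (c 0) (velocityVec c 0) -
      fderiv ℝ (hr.chartFoot p) (extChartAt (𝓡 n) p (c 0))
        (tangentCoord p (c 0) (velocityVec c 0))⟫ = 0
    rw [hfix, sub_self, inner_zero_right]
  · rw [norm_scale, abs_inv, abs_norm, inv_mul_cancel₀ hq]

end IsTubularRadius

end SingularFoliation

/-! ### Functions with a smooth lift to the blow-up -/

namespace SingularFoliation

set_option maxSynthPendingDepth 3

universe u

variable {n : ℕ} {M : Type u} [MetricSpace M] [ChartedSpace (EuclideanSpace ℝ (Fin n)) M]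

local notation "𝔼" => EuclideanSpace ℝ (Fin n)

/-- `K` is arbitrary, so derivatives within K × J need not be unique. Smoothness still provides,
near each point, some differentiable family of derivatives `f'`; its value on (0, 1) is the partial
derivative, which is unique because `J` is a neighbourhood of 0. -/
theorem contDiffOn_deriv_param {E : Type*} [NormedAddCommGroup E] [NormedSpace ℝ E] {f : E × ℝ → ℝ}
    {K : Set E} {J : Set ℝ} (hJ : J ∈ 𝓝 (0 : ℝ)) (hf : ContDiffOn ℝ ∞ f (K ×ˢ J)) :
    ContDiffOn ℝ ∞ (fun x => deriv (fun z => f (x, z)) 0) K := by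
  rw [contDiffOn_infty]
  intro m x hx
  have h1 : ContDiffWithinAt ℝ ((m : ℕ∞ω) + 1) f (K ×ˢ J) (x, 0) :=
    (hf (x, 0) ⟨hx, mem_of_mem_nhds hJ⟩).of_le (by exact_mod_cast le_top)
  obtain ⟨u, hu, -, f', hf', hf'm⟩ :=
    (contDiffWithinAt_succ_iff_hasFDerivWithinAt (by simp)).1 h1
  rw [insert_eq_of_mem (show (x, (0 : ℝ)) ∈ K ×ˢ J from ⟨hx, mem_of_mem_nhds hJ⟩),
    nhdsWithin_prod_eq, nhdsWithin_eq_nhds.2 hJ, Filter.mem_prod_iff] at hu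
  obtain ⟨K', hK', J', hJ', hKJ⟩ := hu
  have h2 : ContDiffWithinAt ℝ m (fun y => f' (y, 0) (0, 1)) K' x := by
    have h3 : ContDiffWithinAt ℝ m (fun y : E => f' (y, 0)) K' x :=
      ContDiffWithinAt.comp (g := f') (f := fun y : E => (y, (0 : ℝ))) x hf'm
        (contDiffWithinAt_id.prodMk contDiffWithinAt_const)
        (fun y hy => hKJ ⟨hy, mem_of_mem_nhds hJ'⟩)
    exact h3.clm_apply contDiffWithinAt_const
  have h4 : ∀ y ∈ K', deriv (fun z => f (y, z)) 0 = f' (y, 0) (0, 1) := by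
    intro y hy
    have h5 := hf' (y, 0) (hKJ ⟨hy, mem_of_mem_nhds hJ'⟩)
    have h6 : HasDerivWithinAt (fun z : ℝ => (y, z)) ((0 : E), (1 : ℝ)) J' 0 :=
      ((hasDerivAt_const (0 : ℝ) y).prodMk (hasDerivAt_id (0 : ℝ))).hasDerivWithinAt
    have h7 := h5.comp_hasDerivWithinAt (f := fun z : ℝ => (y, z)) (0 : ℝ) h6
      (fun z hz => hKJ ⟨hy, hz⟩)
    exact (h7.hasDerivAt hJ').deriv
  exact (h2.congr_of_eventuallyEq (Filter.eventuallyEq_of_mem self_mem_nhdsWithin h4)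
    (h4 x (mem_of_mem_nhdsWithin hx hK'))).mono_of_mem_nhdsWithin hK'

theorem contMDiffOn_deriv_param {E H X : Type*} [NormedAddCommGroup E] [NormedSpace ℝ E]
    [TopologicalSpace H] {I : ModelWithCorners ℝ E H} [TopologicalSpace X] [ChartedSpace H X]
    [IsManifold I ∞ X] {f : X × ℝ → ℝ} {K : Set X} {J : Set ℝ} (hJ : J ∈ 𝓝 (0 : ℝ))
    (hf : ContMDiffOn (I.prod 𝓘(ℝ, ℝ)) 𝓘(ℝ, ℝ) ∞ f (K ×ˢ J)) :
    ContMDiffOn I 𝓘(ℝ, ℝ) ∞ (fun x => deriv (fun z => f (x, z)) 0) K := by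
  intro x hx
  set K' := (extChartAt I x).target ∩ (extChartAt I x).symm ⁻¹' K with hK'
  have h1 : ContMDiffOn (𝓘(ℝ, E).prod 𝓘(ℝ, ℝ)) 𝓘(ℝ, ℝ) ∞
      (fun z : E × ℝ => f ((extChartAt I x).symm z.1, z.2)) (K' ×ˢ J) := by
    refine hf.comp (f := fun z : E × ℝ => ((extChartAt I x).symm z.1, z.2)) ?_
      (fun z hz => ⟨hz.1.2, hz.2⟩)
    refine ContMDiffOn.prodMk ?_ contMDiffOn_snd
    exact (contMDiffOn_extChartAt_symm x).comp contMDiffOn_fst (fun z hz => hz.1.1)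
  rw [← modelWithCornersSelf_prod] at h1
  erw [chartedSpaceSelf_prod] at h1
  have h2 := (contDiffOn_deriv_param hJ (contMDiffOn_iff_contDiffOn.1 h1)).contMDiffOn
  have h3 : ContMDiffWithinAt I 𝓘(ℝ, E) ∞ (extChartAt I x) ((extChartAt I x).source ∩ K) x :=
    contMDiffAt_extChartAt.contMDiffWithinAt
  have hmaps : MapsTo (extChartAt I x) ((extChartAt I x).source ∩ K) K' := fun y hy =>
    ⟨(extChartAt I x).map_source hy.1, by
      rw [mem_preimage, (extChartAt I x).left_inv hy.1]; exact hy.2⟩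
  have hxm : x ∈ (extChartAt I x).source ∩ K := ⟨mem_extChartAt_source x, hx⟩
  have h4 := (h2 _ (hmaps hxm)).comp x h3 hmaps
  have h5 : ContMDiffWithinAt I 𝓘(ℝ, ℝ) ∞ (fun x => deriv (fun z => f (x, z)) 0)
      ((extChartAt I x).source ∩ K) x := by
    refine h4.congr (fun y hy => ?_) ?_
    · simp only [Function.comp_apply, (extChartAt I x).left_inv hy.1]
    · simp only [Function.comp_apply, extChartAt_to_inv]
  refine h5.mono_of_mem_nhdsWithin ?_
  exact Filter.inter_mem (nhdsWithin_le_nhds (extChartAt_source_mem_nhds x)) self_mem_nhdsWithin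

variable [IsManifold (𝓡 n) ∞ M] [RiemannianBundle (fun x : M => TangentSpace (𝓡 n) x)]
  [IsContMDiffRiemannianBundle (𝓡 n) ∞ (EuclideanSpace ℝ (Fin n))
    (fun x : M => TangentSpace (𝓡 n) x)]
  {S : Set M} {r : ℝ}

theorem SRF.polarFun_apply (F : SRF n M) (f : F.HatLeafSpace S r → ℝ)
    {d : ℝ × TangentBundle (𝓡 n) M} (hd : d ∈ polarDomain S r) :
    F.polarFun S r f d = f (Quotient.mk _ (polar ⟨d, hd⟩)) :=
  Subtype.val_injective.extend_apply _ _ (⟨d, hd⟩ : polarDomain (n := n) S r)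

theorem SRF.basicFun_apply (F : SRF n M) (k : F.LeafSpace S r → ℝ) {x : M}
    (hx : x ∈ Metric.thickening r S) : F.basicFun S r k x = k (Quotient.mk _ ⟨x, hx⟩) :=
  Subtype.val_injective.extend_apply _ _ (⟨x, hx⟩ : Metric.thickening r S)

theorem SRF.polarFun_lift (F : SRF n M) (hr : IsTubularRadius n S r) (k : F.LeafSpace S r → ℝ)
    {d : ℝ × TangentBundle (𝓡 n) M} (hd : d ∈ polarDomain S r) :
    F.polarFun S r (fun a => k (F.leafBlowDown hr a)) d = F.basicFun S r k (exp (scale d.1 d.2)) := by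
  rw [F.polarFun_apply _ hd]
  exact (F.basicFun_apply k (blowDown hr (polar ⟨d, hd⟩)).2).symm

variable [IsRiemannianManifold (𝓡 n) M] [CompleteSpace M]

/-! ### Polar coordinates and surjectivity of the blow-up map. -/

namespace IsTubularRadius

/-- Polar coordinates on the complement of `S` in the tube. -/
noncomputable def polarCoord (hr : IsTubularRadius n S r) (x : M) : ℝ × TangentBundle (𝓡 n) M :=
  (‖(hr.log x).2‖, scale ‖(hr.log x).2‖⁻¹ (hr.log x))

theorem norm_log_ne_zero (hr : IsTubularRadius n S r) {x : M} (hx : x ∈ Metric.thickening r S \ S) :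
    (hr.log x).2 ≠ 0 := fun h => hx.2 ((hr.mem_iff_log_eq_zero hx.1).2 h)

theorem polarCoord_mem (hr : IsTubularRadius n S r) {x : M} (hx : x ∈ Metric.thickening r S \ S) :
    hr.polarCoord x ∈ polarDomain S r := by
  refine ⟨?_, scale_mem_normalBundle (hr.log_mem hx.1) _, ?_⟩
  · simpa [polarCoord] using hr.norm_log_lt hx.1
  · change ‖(scale ‖(hr.log x).2‖⁻¹ (hr.log x)).2‖ = 1
    rw [norm_scale, abs_inv, abs_norm, inv_mul_cancel₀ (norm_ne_zero_iff.2 (hr.norm_log_ne_zero hx))]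

theorem exp_polarCoord (hr : IsTubularRadius n S r) {x : M} (hx : x ∈ Metric.thickening r S \ S) :
    exp (scale (hr.polarCoord x).1 (hr.polarCoord x).2) = x := by
  simp only [polarCoord]
  rw [scale_scale, mul_inv_cancel₀ (norm_ne_zero_iff.2 (hr.norm_log_ne_zero hx)), scale_one,
    hr.exp_log hx.1]

theorem contMDiffOn_polarCoord (hr : IsTubularRadius n S r) :
    ContMDiffOn (𝓡 n) (𝓘(ℝ, ℝ).prod (𝓡 n).tangent) ∞ hr.polarCoord (Metric.thickening r S \ S) := by
  intro x hx
  have h1 := (hr.contMDiffOn_log x hx.1).mono (sdiff_subset (t := S))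
  exact (contMDiffWithinAt_norm h1 (hr.norm_log_ne_zero hx)).prodMk
    (contMDiffWithinAt_normalize h1 (hr.norm_log_ne_zero hx))

/-- The blow-up map is surjective. -/
theorem exists_polar_eq (hr : IsTubularRadius n S r) (hne : S ≠ univ) {x : M}
    (hx : x ∈ Metric.thickening r S) : ∃ d ∈ polarDomain (n := n) S r, exp (scale d.1 d.2) = x := by
  by_cases hxS : x ∈ S
  · obtain ⟨ξ, -, hξ⟩ := hr.exists_unit_normal_field hne hxS
    obtain ⟨h1, h2, h3⟩ := hξ.self_of_nhds hxS
    refine ⟨(0, ξ x), ⟨by simpa using hr.pos, h1, h2⟩, ?_⟩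
    rw [exp_scale_zero, h3]
  · exact ⟨hr.polarCoord x, hr.polarCoord_mem ⟨hx, hxS⟩, hr.exp_polarCoord ⟨hx, hxS⟩⟩

end IsTubularRadius

/-! ### Regularity of a function read off its lift. -/

section Lift

variable {F : SRF n M} {k : F.LeafSpace S r → ℝ}

/-- Polar coordinates are a smooth section of the blow-up map off `S`. -/
theorem SRF.contMDiffOn_compl_of_lift (hr : IsTubularRadius n S r)
    (hk : F.IsHatSmooth S r (fun a => k (F.leafBlowDown hr a))) :
    ContMDiffOn (𝓡 n) 𝓘(ℝ, ℝ) ∞ (F.basicFun S r k) (Metric.thickening r S \ S) := by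
  have h1 := ContMDiffOn.comp hk hr.contMDiffOn_polarCoord (fun x hx => hr.polarCoord_mem hx)
  refine h1.congr fun x hx => ?_
  rw [Function.comp_apply, F.polarFun_lift hr k (hr.polarCoord_mem hx), hr.exp_polarCoord hx]

/-- A local unit normal field ξ gives a smooth section q ↦ (0, ξ q) of the blow-up map over `S`. -/
theorem SRF.contMDiffOn_stratum_of_lift (hr : IsTubularRadius n S r) (hne : S ≠ univ)
    (hk : F.IsHatSmooth S r (fun a => k (F.leafBlowDown hr a))) :
    ContMDiffOn (𝓡 n) 𝓘(ℝ, ℝ) ∞ (F.basicFun S r k) S := by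
  intro p hp
  obtain ⟨ξ, hξ, hξn⟩ := hr.exists_unit_normal_field hne hp
  have hmem : ∀ q, q ∈ S → (q ∈ S → ξ q ∈ normalBundle S ∧ ‖(ξ q).2‖ = 1 ∧ (ξ q).proj = q) →
      ((0 : ℝ), ξ q) ∈ polarDomain S r := fun q hq h =>
    ⟨by simpa using hr.pos, (h hq).1, (h hq).2.1⟩
  have heq : ∀ q, q ∈ S → (q ∈ S → ξ q ∈ normalBundle S ∧ ‖(ξ q).2‖ = 1 ∧ (ξ q).proj = q) →
      F.basicFun S r k q = F.polarFun S r (fun a => k (F.leafBlowDown hr a)) (0, ξ q) := by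
    intro q hq h
    rw [F.polarFun_lift hr k (hmem q hq h), exp_scale_zero, (h hq).2.2]
  have h1 : ContMDiffWithinAt (𝓡 n) (𝓘(ℝ, ℝ).prod (𝓡 n).tangent) ∞ (fun q => ((0 : ℝ), ξ q)) S p :=
    contMDiffWithinAt_const.prodMk hξ.contMDiffWithinAt
  have h2 := (ContMDiffWithinAt.comp' (f := fun q => ((0 : ℝ), ξ q)) p
    (hk (0, ξ p) (hmem p hp hξn.self_of_nhds)) h1).mono_of_mem_nhdsWithin (by
      filter_upwards [self_mem_nhdsWithin, nhdsWithin_le_nhds hξn] with q hq hq'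
        using ⟨hq, hmem q hq hq'⟩)
  refine h2.congr_of_eventuallyEq ?_ (heq p hp hξn.self_of_nhds)
  filter_upwards [self_mem_nhdsWithin, nhdsWithin_le_nhds hξn] with q hq hq' using heq q hq hq'

/-- Only limits at points of `S` taken from outside are delicate: the directions in polar
coordinates need not converge there. -/
theorem SRF.continuousOn_of_lift (hr : IsTubularRadius n S r) (hne : S ≠ univ)
    (hk : F.IsHatSmooth S r (fun a => k (F.leafBlowDown hr a))) :
    ContinuousOn (F.basicFun S r k) (Metric.thickening r S) := by
  intro x hx
  refine ContinuousAt.continuousWithinAt ?_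
  have hopen : IsOpen (Metric.thickening r S \ S) := Metric.isOpen_thickening.sdiff hr.isClosed
  by_cases hxS : x ∈ S
  · have hsup : 𝓝 x = 𝓝[S] x ⊔ 𝓝[Sᶜ] x := by
      rw [← nhdsWithin_union, union_compl_self, nhdsWithin_univ]
    rw [ContinuousAt, hsup]
    refine Filter.Tendsto.sup (F.contMDiffOn_stratum_of_lift hr hne hk x hxS).continuousWithinAt ?_
    -- Along an ultrafilter the unit directions do converge, to some ξ₀, by compactness. The limit
    -- of the lift at (0, ξ₀) is the value at `x`, whichever ξ₀ arises.
    rw [Filter.tendsto_iff_ultrafilter]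
    intro 𝒰 h𝒰
    have hle : (𝒰 : Filter M) ≤ 𝓝 x := h𝒰.trans nhdsWithin_le_nhds
    have hB : ∀ᶠ y in (𝒰 : Filter M), y ∈ Metric.thickening r S \ S := by
      filter_upwards [hle (Metric.isOpen_thickening.mem_nhds hx), h𝒰 self_mem_nhdsWithin]
        with y h1 h2 using ⟨h1, h2⟩
    have hlog : Filter.Tendsto hr.log 𝒰 (𝓝 (hr.log x)) :=
      (hr.contMDiffOn_log.continuousOn.continuousAt
        (Metric.isOpen_thickening.mem_nhds hx)).tendsto.mono_left hle
    obtain ⟨ξ₀, h1, h2, h3, h4⟩ := hr.exists_tendsto 𝒰 (ξ := fun y => (hr.polarCoord y).2)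
      (hB.mono fun y hy => (hr.polarCoord_mem hy).2) hxS (by
        have := ((FiberBundle.continuous_proj 𝔼 (TangentSpace (𝓡 n))).tendsto _).comp hlog
        rw [hr.foot_eq hxS] at this
        exact this)
    have h5 : Filter.Tendsto (fun y => (hr.polarCoord y).1) 𝒰 (𝓝 0) := by
      have := (continuous_norm_tangent.tendsto _).comp hlog
      rw [(hr.mem_iff_log_eq_zero hx).1 hxS, norm_zero] at this
      exact this
    have hd0 : ((0 : ℝ), ξ₀) ∈ polarDomain S r := ⟨by simpa using hr.pos, h1, h2⟩
    have h6 : Filter.Tendsto hr.polarCoord 𝒰 (𝓝[polarDomain S r] (0, ξ₀)) :=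
      tendsto_nhdsWithin_iff.2 ⟨h5.prodMk_nhds h4, hB.mono fun y hy => hr.polarCoord_mem hy⟩
    have h7 := (hk (0, ξ₀) hd0).continuousWithinAt.tendsto.comp h6
    rw [F.polarFun_lift hr k hd0, exp_scale_zero, h3] at h7
    refine h7.congr' ?_
    filter_upwards [hB] with y hy
    rw [Function.comp_apply, F.polarFun_lift hr k (hr.polarCoord_mem hy), hr.exp_polarCoord hy]
  · exact (F.contMDiffOn_compl_of_lift hr hk).continuousOn.continuousAt (hopen.mem_nhds ⟨hx, hxS⟩)

/-- A function on the leaf space with a smooth lift and vanishing normal derivatives is a blow-up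
function. -/
theorem SRF.isBlowUpFunction_of_lift (hr : IsTubularRadius n S r) (hne : S ≠ univ)
    (hk : F.IsHatSmooth S r (fun a => k (F.leafBlowDown hr a)))
    (hnd : ∀ v ∈ normalBundle (n := n) S,
      HasDerivAt (fun t : ℝ => F.basicFun S r k (exp (scale t v))) 0 0) :
    F.IsBlowUpFunction hr k where
  continuous := by
    refine isQuotientMap_quotient_mk'.continuous_iff.2 ?_
    refine (continuousOn_iff_continuous_domRestrict.1 (F.continuousOn_of_lift hr hne hk)).congr ?_
    rintro ⟨x, hx⟩
    exact F.basicFun_apply k hx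
  smooth_lift := hk
  smooth_stratum := F.contMDiffOn_stratum_of_lift hr hne hk
  smooth_compl := F.contMDiffOn_compl_of_lift hr hk
  normal_deriv := hnd

theorem mem_polarDomain {t : ℝ} {ξ : TangentBundle (𝓡 n) M} (hξ : ξ ∈ normalBundle S)
    (h1 : ‖ξ.2‖ = 1) (ht : t ∈ Ioo (-r) r) : (t, ξ) ∈ polarDomain S r :=
  ⟨abs_lt.2 ht, hξ, h1⟩

theorem SRF.contDiffOn_radial {f : F.HatLeafSpace S r → ℝ} (hf : F.IsHatSmooth S r f)
    {ξ : TangentBundle (𝓡 n) M} (hξ : ξ ∈ normalBundle S) (h1 : ‖ξ.2‖ = 1) :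
    ContDiffOn ℝ ∞ (fun t => F.polarFun S r f (t, ξ)) (Ioo (-r) r) :=
  (ContMDiffOn.comp hf (f := fun t : ℝ => (t, ξ)) (contMDiffOn_id.prodMk contMDiffOn_const)
    (fun _ ht => mem_polarDomain hξ h1 ht)).contDiffOn

/-- The derivative in t is the derivative at 0 of a translate; the radius is halved to leave room
for the translation. -/
theorem SRF.contMDiffOn_radial_deriv (hr : IsTubularRadius n S r) {f : F.HatLeafSpace S r → ℝ}
    (hf : F.IsHatSmooth S r f) :
    ContMDiffOn (𝓘(ℝ, ℝ).prod (𝓡 n).tangent) 𝓘(ℝ, ℝ) ∞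
      (fun d => deriv (fun t => F.polarFun S r f (t, d.2)) d.1) (polarDomain S (r / 2)) := by
  have hJ : Ioo (-(r / 2)) (r / 2) ∈ 𝓝 (0 : ℝ) :=
    Ioo_mem_nhds (by linarith [hr.pos]) (by linarith [hr.pos])
  have h1 : ContMDiffOn ((𝓘(ℝ, ℝ).prod (𝓡 n).tangent).prod 𝓘(ℝ, ℝ)) 𝓘(ℝ, ℝ) ∞
      (fun z : (ℝ × TangentBundle (𝓡 n) M) × ℝ => F.polarFun S r f (z.1.1 + z.2, z.1.2))
      (polarDomain S (r / 2) ×ˢ Ioo (-(r / 2)) (r / 2)) := by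
    refine ContMDiffOn.comp hf (f := fun z : (ℝ × TangentBundle (𝓡 n) M) × ℝ =>
      (z.1.1 + z.2, z.1.2)) ?_ ?_
    · refine ContMDiffOn.prodMk ?_ ?_
      · exact ((contMDiff_fst.comp contMDiff_fst).add contMDiff_snd).contMDiffOn
      · exact (contMDiff_snd.comp contMDiff_fst).contMDiffOn
    · rintro ⟨d, z⟩ ⟨⟨h1, h2, h3⟩, hz⟩
      refine ⟨?_, h2, h3⟩
      have h4 := abs_lt.2 hz
      have h5 := abs_add_le d.1 z
      simp only at h1 h4 ⊢
      linarith
  refine (contMDiffOn_deriv_param hJ h1).congr fun d _ => ?_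
  have h2 := deriv_comp_const_add (fun t => F.polarFun S r f (t, d.2)) d.1 0
  simp only [add_zero] at h2
  exact h2.symm

/-- The normal derivatives vanish uniformly along the unit normal vectors at a point. -/
theorem SRF.eventually_abs_sub_le (hr : IsTubularRadius n S r)
    (hk : F.IsHatSmooth S r (fun a => k (F.leafBlowDown hr a)))
    (hnd : ∀ v ∈ normalBundle (n := n) S,
      HasDerivAt (fun t : ℝ => F.basicFun S r k (exp (scale t v))) 0 0)
    {q : M} (hq : q ∈ S) {ε : ℝ} (hε : 0 < ε) :
    ∃ δ > 0, ∀ ξ : TangentBundle (𝓡 n) M, ξ ∈ normalBundle S → ‖ξ.2‖ = 1 → ξ.proj = q →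
      ∀ t, 0 < t → t < δ → |F.basicFun S r k (exp (scale t ξ)) - F.basicFun S r k q| ≤ ε * t := by
  by_contra! hcon
  have hr0 := hr.pos
  set P := F.polarFun S r (fun a => k (F.leafBlowDown hr a)) with hP
  -- If uniformity fails, the mean value theorem yields points (s, ξ) with s → 0, over the fixed
  -- foot point `q`, at which the radial derivative exceeds ε in absolute value.
  have hstep : ∀ m : ℕ, ∃ d : ℝ × TangentBundle (𝓡 n) M, d ∈ polarDomain S (r / 2) ∧
      |d.1| < 1 / ((m : ℝ) + 1) ∧ d.2.proj = q ∧ ε < |deriv (fun t => P (t, d.2)) d.1| := by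
    intro m
    have hm : 0 < 1 / ((m : ℝ) + 1) := Nat.one_div_pos_of_nat
    obtain ⟨ξ, h1, h2, h3, t, ht0, htδ, hlt⟩ := hcon (min (1 / ((m : ℝ) + 1)) (r / 2))
      (lt_min hm (by linarith))
    have htr : t < r / 2 := htδ.trans_le (min_le_right _ _)
    have hsub : Icc 0 t ⊆ Ioo (-r) r := fun s hs => ⟨by linarith [hs.1], by linarith [hs.2]⟩
    have hD := F.contDiffOn_radial hk h1 h2
    obtain ⟨s, hs, hsd⟩ := exists_deriv_eq_slope (fun t => P (t, ξ)) ht0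
      (hD.continuousOn.mono hsub)
      (((hD.differentiableOn (by simp)).mono (Ioo_subset_Icc_self.trans hsub)))
    have hPt : P (t, ξ) = F.basicFun S r k (exp (scale t ξ)) :=
      F.polarFun_lift hr k (mem_polarDomain h1 h2 (hsub (right_mem_Icc.2 ht0.le)))
    have hP0 : P (0, ξ) = F.basicFun S r k q := by
      rw [hP, F.polarFun_lift hr k (mem_polarDomain h1 h2 (hsub (left_mem_Icc.2 ht0.le))),
        exp_scale_zero, h3]
    refine ⟨(s, ξ), ⟨?_, h1, h2⟩, ?_, h3, ?_⟩
    · simp only [abs_of_pos hs.1]; linarith [hs.2]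
    · simp only [abs_of_pos hs.1]; exact (hs.2.trans htδ).trans_le (min_le_left _ _)
    · simp only [hsd, hPt, hP0, sub_zero, abs_div, abs_of_pos ht0]
      rwa [lt_div_iff₀ ht0]
  choose d hd1 hd2 hd3 hd4 using hstep
  have hu : (Filter.hyperfilter ℕ : Filter ℕ) ≤ Filter.atTop := Nat.hyperfilter_le_atTop
  -- In the limit the radial derivative at (0, ξ₀) would be at least ε in absolute value by
  -- continuity, whereas it is zero.
  obtain ⟨ξ₀, h1, h2, h3, h4⟩ := hr.exists_tendsto (Filter.hyperfilter ℕ) (ξ := fun m => (d m).2)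
    (Filter.Eventually.of_forall fun m => (hd1 m).2) hq
    (tendsto_const_nhds.congr fun m => (hd3 m).symm)
  have h5 : Filter.Tendsto (fun m => (d m).1) (Filter.hyperfilter ℕ) (𝓝 0) :=
    (squeeze_zero_norm (fun m => (hd2 m).le) tendsto_one_div_add_atTop_nhds_zero_nat).mono_left hu
  have hd0 : ((0 : ℝ), ξ₀) ∈ polarDomain S (r / 2) := ⟨by simpa using hr0, h1, h2⟩
  have h6 : Filter.Tendsto d (Filter.hyperfilter ℕ) (𝓝[polarDomain S (r / 2)] (0, ξ₀)) :=
    tendsto_nhdsWithin_iff.2 ⟨h5.prodMk_nhds h4, Filter.Eventually.of_forall hd1⟩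
  have h7 := ((F.contMDiffOn_radial_deriv hr hk _ hd0).continuousWithinAt.tendsto.comp h6).abs
  have h8 : deriv (fun t => P (t, ξ₀)) 0 = 0 := by
    refine HasDerivAt.deriv ((hnd ξ₀ h1).congr_of_eventuallyEq ?_)
    filter_upwards [Ioo_mem_nhds (neg_lt_zero.2 hr0) hr0] with t ht
    exact F.polarFun_lift hr k (mem_polarDomain h1 h2 ht)
  have h9 : ε ≤ |deriv (fun t => P (t, ξ₀)) 0| :=
    ge_of_tendsto h7 (Filter.Eventually.of_forall fun m => (hd4 m).le)
  rw [h8, abs_zero] at h9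
  linarith

end Lift

end SingularFoliation

/-! ### Isometric flows of the leaf space -/

namespace SingularFoliation

set_option maxSynthPendingDepth 3

universe u

variable {n : ℕ} {M : Type u} [MetricSpace M] [ChartedSpace (EuclideanSpace ℝ (Fin n)) M]

local notation "𝔼" => EuclideanSpace ℝ (Fin n)

variable [IsManifold (𝓡 n) ∞ M] [RiemannianBundle (fun x : M => TangentSpace (𝓡 n) x)]
  [IsContMDiffRiemannianBundle (𝓡 n) ∞ (EuclideanSpace ℝ (Fin n))
    (fun x : M => TangentSpace (𝓡 n) x)]
  [IsRiemannianManifold (𝓡 n) M] [CompleteSpace M] {S : Set M} {r : ℝ}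

section Leaf

variable {F : SRF n M}

/-- The leaf through a point of the tube, as a point of the leaf space. -/
def SRF.toLeaf (F : SRF n M) (x : Metric.thickening r S) : F.LeafSpace S r :=
  Quotient.mk (F.tubeSetoid S r) x

theorem SRF.toLeaf_eq {x y : Metric.thickening r S} :
    F.toLeaf x = F.toLeaf y ↔ F.leafRel (x : M) (y : M) := Quotient.eq

theorem SRF.exists_toLeaf (p : F.LeafSpace S r) : ∃ x : Metric.thickening r S, F.toLeaf x = p :=
  Quotient.exists_rep p

/-- Equidistance lets the quotient distance be measured from the prescribed representative `x`; the
tube is a union of leaves, so the new endpoint stays in it. -/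
theorem SRF.exists_dist_lt (hF : F.HasClosedLeaves) (hS : F.IsMinimalStratum S)
    {x y : Metric.thickening r S} {ℓ : ℝ}
    (h : F.leafEDist S r (F.toLeaf x) (F.toLeaf y) < ENNReal.ofReal ℓ) :
    ∃ y' : Metric.thickening r S, F.toLeaf y' = F.toLeaf y ∧ dist (x : M) (y' : M) < ℓ := by
  simp only [SRF.leafEDist, intrinsicEDist, iInf_lt_iff] at h
  obtain ⟨x₁, y₁, hx₁, hy₁, c, hc, -, hc0, hc1, hlt⟩ := h
  have h1 : edist (x₁ : M) (y₁ : M) < ENNReal.ofReal ℓ := by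
    rw [IsRiemannianManifold.out (I := 𝓡 n) (x₁ : M) (y₁ : M)]
    exact (Manifold.riemannianEDist_le_pathELength hc hc0 hc1 zero_le_one).trans_lt hlt
  have h2 : dist (x₁ : M) (y₁ : M) < ℓ := by
    rw [edist_dist] at h1
    exact (ENNReal.ofReal_lt_ofReal_iff_of_nonneg dist_nonneg).1 h1
  have hxx : F.leafRel (x₁ : M) (x : M) := SRF.toLeaf_eq.1 hx₁
  have hyy : F.leafRel (y₁ : M) (y : M) := SRF.toLeaf_eq.1 hy₁
  have h3 : Metric.infDist (x : M) (F.leaf y₁) < ℓ := by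
    rw [F.infDist_leaf_eq hF hxx]
    exact (Metric.infDist_le_dist_of_mem (F.mem_leaf_self _)).trans_lt h2
  obtain ⟨y', hy', hd⟩ := (Metric.infDist_lt_iff ⟨_, F.mem_leaf_self _⟩).1 h3
  have hyy' : F.leafRel (y₁ : M) y' := hy'
  exact ⟨⟨y', hS.mem_thickening hF hyy' y₁.2⟩,
    SRF.toLeaf_eq.2 (F.leafRel.trans (F.leafRel.symm hyy') hyy), hd⟩

theorem SRF.infDist_leaf_le (hF : F.HasClosedLeaves) (hS : F.IsMinimalStratum S)
    {x y : Metric.thickening r S} {ℓ : ℝ} (hℓ : 0 ≤ ℓ)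
    (h : F.leafEDist S r (F.toLeaf x) (F.toLeaf y) ≤ ENNReal.ofReal ℓ) :
    Metric.infDist (x : M) (F.leaf y) ≤ ℓ := by
  refine le_of_forall_pos_le_add fun ε hε => ?_
  obtain ⟨y', hy', hd⟩ := SRF.exists_dist_lt hF hS (ℓ := ℓ + ε)
    (h.trans_lt ((ENNReal.ofReal_lt_ofReal_iff (by linarith)).2 (by linarith)))
  exact (Metric.infDist_le_dist_of_mem (show (y' : M) ∈ F.leaf y from
    SRF.toLeaf_eq.1 hy'.symm)).trans hd.le

theorem SRF.infDist_stratum_le (hF : F.HasClosedLeaves) (hS : F.IsMinimalStratum S)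
    {x y : Metric.thickening r S} {ℓ : ℝ} (hℓ : 0 ≤ ℓ)
    (h : F.leafEDist S r (F.toLeaf x) (F.toLeaf y) ≤ ENNReal.ofReal ℓ) :
    Metric.infDist (y : M) S ≤ Metric.infDist (x : M) S + ℓ := by
  refine le_of_forall_pos_le_add fun ε hε => ?_
  obtain ⟨y', hy', hd⟩ := SRF.exists_dist_lt hF hS (ℓ := ℓ + ε)
    (h.trans_lt ((ENNReal.ofReal_lt_ofReal_iff (by linarith)).2 (by linarith)))
  rw [← hS.infDist_eq hF (SRF.toLeaf_eq.1 hy')]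
  have := Metric.infDist_le_infDist_add_dist (s := S) (x := (y' : M)) (y := (x : M))
  rw [dist_comm] at this
  linarith

/-- The point `exp (t ξ)` of the tube. -/
noncomputable def IsTubularRadius.point (hr : IsTubularRadius n S r) {t : ℝ} {ξ : TangentBundle (𝓡 n) M}
    (hd : (t, ξ) ∈ polarDomain S r) : Metric.thickening r S :=
  ⟨exp (scale t ξ), (hr.log_exp_scale hd).1⟩

theorem intrinsicEDist_le {B : Set M} {x y : M} {c : ℝ → M}
    (hc : ContMDiffOn 𝓘(ℝ, ℝ) (𝓡 n) 1 c (Icc 0 1)) (hB : ∀ t ∈ Icc (0 : ℝ) 1, c t ∈ B)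
    (h0 : c 0 = x) (h1 : c 1 = y) :
    intrinsicEDist n B x y ≤ Manifold.pathELength (𝓡 n) c 0 1 :=
  iInf_le_of_le c (iInf_le_of_le hc (iInf_le_of_le hB (iInf_le_of_le h0 (iInf_le _ h1))))

/-- The segment of the normal ray stays in the tube and has length |t' - t|. -/
theorem SRF.leafEDist_radial_le (hr : IsTubularRadius n S r) {t t' : ℝ}
    {ξ : TangentBundle (𝓡 n) M} (hd : (t, ξ) ∈ polarDomain S r) (hd' : (t', ξ) ∈ polarDomain S r) :
    F.leafEDist S r (F.toLeaf (hr.point hd)) (F.toLeaf (hr.point hd')) ≤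
      ENNReal.ofReal |t' - t| := by
  obtain ⟨hγ, hγv⟩ := isGeodesic_exp ξ
  have hc := hγ.affine (t' - t) t
  refine (iInf_le_of_le (hr.point hd) (iInf_le_of_le (hr.point hd') (iInf_le_of_le rfl
    (iInf_le_of_le rfl le_rfl)))).trans ?_
  refine (intrinsicEDist_le (hc.1.of_le (show (1 : ℕ∞ω) ≤ ∞ by simp)).contMDiffOn ?_ ?_ ?_).trans ?_
  · intro s hs
    have h1 := abs_lt.1 hd.1
    have h2 := abs_lt.1 hd'.1
    have h3 : (t' - t) * s + t ∈ Ioo (-r) r := by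
      have := (convex_Ioo (-r) r) ⟨h1.1, h1.2⟩ ⟨h2.1, h2.2⟩ (sub_nonneg.2 hs.2) hs.1 (by ring)
      simp only [smul_eq_mul] at this
      convert this using 1
      ring
    exact (hr.log_exp_scale (mem_polarDomain hd.2.1 hd.2.2 h3)).1
  · simp [IsTubularRadius.point]
  · simp [IsTubularRadius.point]
  · refine (pathELength_le zero_le_one (K := fun s => |t' - t| * s) (K' := fun _ => |t' - t|)
      (fun s _ => by simpa using (hasDerivAt_id s).const_mul |t' - t|) (fun s _ => ?_)).trans ?_
    · refine (congrArg (fun v : TangentBundle (𝓡 n) M => ‖v.2‖)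
        (hγ.velocity_affine (t' - t) t s)).le.trans ?_
      rw [norm_scale]
      have h1 : ‖velocityVec (n := n) (fun t => exp (scale t ξ)) 0‖ = 1 :=
        (congrArg (fun v : TangentBundle (𝓡 n) M => ‖v.2‖) hγv).trans hd.2.2
      have h2 := (hγ.norm_velocity ((t' - t) * s + t) 0).trans h1
      exact (mul_le_of_le_one_right (abs_nonneg _) h2.le)
    · simp

variable {J : Set ℝ} {φ : F.LeafSpace S r → ℝ → F.LeafSpace S r}

theorem SRF.IsIsometricFlow.neg_apply (hφ : F.IsIsometricFlow S r J φ) {z : ℝ} (hz : z ∈ J)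
    (hz' : -z ∈ J) (h0 : (0 : ℝ) ∈ J) (p : F.LeafSpace S r) : φ (φ p z) (-z) = p := by
  rw [hφ.localGroup.comp_time p z hz (-z) hz' (by rwa [add_neg_cancel]), add_neg_cancel,
    hφ.localGroup.zero_time]

/-- Suppose a point of `S` went to `y` at distance ρ > 0 from `S`. The normal ray through `y` leaves
the tube after a further length r - ρ. Its pullback starts in `S` and stays within r - ρ < r of it,
so it converges inside the tube, and by continuity of the flow the image of the limit would be a
leaf of the tube at distance r from `S`. -/
theorem SRF.IsIsometricFlow.mem_stratum (hφ : F.IsIsometricFlow S r J φ) (hF : F.HasClosedLeaves)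
    (hS : F.IsMinimalStratum S) (hr : IsTubularRadius n S r) {z : ℝ} (hz : z ∈ J) (hz' : -z ∈ J)
    (h0 : (0 : ℝ) ∈ J) {x y : Metric.thickening r S} (hx : (x : M) ∈ S)
    (hxy : φ (F.toLeaf x) z = F.toLeaf y) : (y : M) ∈ S := by
  by_contra hyS
  set ξ := (hr.polarCoord (y : M)).2 with hξ
  set ρ := (hr.polarCoord (y : M)).1 with hρ
  have hdρ : (ρ, ξ) ∈ polarDomain S r := hr.polarCoord_mem ⟨y.2, hyS⟩
  have hρ0 : 0 < ρ := norm_pos_iff.2 (hr.norm_log_ne_zero ⟨y.2, hyS⟩)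
  have hρr : ρ < r := hr.norm_log_lt y.2
  have hyρ : hr.point hdρ = y := Subtype.ext (hr.exp_polarCoord ⟨y.2, hyS⟩)
  -- Radii increasing from ρ to r in steps that halve, so that the pulled back points form a Cauchy
  -- sequence.
  set τ : ℕ → ℝ := fun m => r - (r - ρ) / 2 ^ m with hτ
  have hpow : ∀ m : ℕ, (1 : ℝ) ≤ 2 ^ m := fun m => one_le_pow₀ one_le_two
  have hτr : ∀ m, τ m < r := fun m => sub_lt_self _ (div_pos (by linarith) (by positivity))
  have hτρ : ∀ m, ρ ≤ τ m := fun m => by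
    have : (r - ρ) / 2 ^ m ≤ r - ρ := div_le_self (by linarith) (hpow m)
    simp only [hτ]; linarith
  have hd : ∀ m, (τ m, ξ) ∈ polarDomain S r := fun m =>
    ⟨abs_lt.2 ⟨by linarith [hτρ m], hτr m⟩, hdρ.2⟩
  have hτ0 : τ 0 = ρ := by simp [hτ]
  have hτs : ∀ m, τ (m + 1) - τ m = (r - ρ) / 2 / 2 ^ m := fun m => by
    simp only [hτ, pow_succ]
    field_simp
    ring
  set c : ℕ → F.LeafSpace S r := fun m => F.toLeaf (hr.point (hd m)) with hc
  have hc0 : c 0 = F.toLeaf y := by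
    rw [← hyρ]
    simp only [hc]
    congr 2
  -- Doubling the length of a step provides the strict inequality needed to choose the next
  -- representative, and the shape of the bound fits `cauchySeq_of_le_geometric_two`.
  have hstep : ∀ m (a : Metric.thickening r S), F.toLeaf a = φ (c m) (-z) →
      ∃ b : Metric.thickening r S, F.toLeaf b = φ (c (m + 1)) (-z) ∧
        dist (a : M) (b : M) < (2 * (r - ρ)) / 2 / 2 ^ m := by
    intro m a ha
    obtain ⟨b₀, hb₀⟩ := F.exists_toLeaf (φ (c (m + 1)) (-z))
    have h1 : F.leafEDist S r (F.toLeaf a) (F.toLeaf b₀) < ENNReal.ofReal ((2 * (r - ρ)) / 2 / 2 ^ m) := by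
      rw [ha, hb₀, hφ.isometry _ _ _ hz']
      have hpos : 0 < (r - ρ) / 2 / 2 ^ m := div_pos (by linarith) (by positivity)
      have h2 := SRF.leafEDist_radial_le (F := F) hr (hd m) (hd (m + 1))
      rw [hτs, abs_of_pos hpos] at h2
      have h3 : (2 * (r - ρ)) / 2 / 2 ^ m = 2 * ((r - ρ) / 2 / 2 ^ m) := by ring
      refine h2.trans_lt ((ENNReal.ofReal_lt_ofReal_iff ?_).2 ?_) <;> rw [h3] <;> linarith
    obtain ⟨b, hb, hd⟩ := SRF.exists_dist_lt hF hS h1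
    exact ⟨b, hb.trans hb₀, hd⟩
  choose step hstep1 hstep2 using hstep
  have hx0 : F.toLeaf x = φ (c 0) (-z) := by
    rw [hc0, ← hxy, hφ.neg_apply hz hz' h0]
  let X : ∀ m : ℕ, {a : Metric.thickening r S // F.toLeaf a = φ (c m) (-z)} := fun m =>
    Nat.rec ⟨x, hx0⟩ (fun m a => ⟨step m a.1 a.2, hstep1 m a.1 a.2⟩) m
  have hXd : ∀ m, dist ((X m).1 : M) ((X (m + 1)).1 : M) ≤ (2 * (r - ρ)) / 2 / 2 ^ m := fun m =>
    (hstep2 m (X m).1 (X m).2).le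
  obtain ⟨w, hw⟩ := cauchySeq_tendsto_of_complete (cauchySeq_of_le_geometric_two hXd)
  have hXS : ∀ m, Metric.infDist ((X m).1 : M) S ≤ r - ρ := fun m => by
    have h1 : F.leafEDist S r (F.toLeaf x) (F.toLeaf (X m).1) ≤ ENNReal.ofReal (τ m - τ 0) := by
      rw [hx0, (X m).2, hφ.isometry _ _ _ hz']
      refine (SRF.leafEDist_radial_le (F := F) hr (hd 0) (hd m)).trans (le_of_eq ?_)
      rw [abs_of_nonneg (by rw [hτ0]; linarith [hτρ m])]
    have h2 := SRF.infDist_stratum_le hF hS (by rw [hτ0]; linarith [hτρ m]) h1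
    rw [Metric.infDist_zero_of_mem hx, hτ0] at h2
    linarith [hτr m]
  have hwB : w ∈ Metric.thickening r S := by
    rw [Metric.mem_thickening_iff_infDist_lt hS.nonempty]
    have := le_of_tendsto ((Metric.continuous_infDist_pt S).continuousAt.tendsto.comp hw)
      (Filter.Eventually.of_forall hXS)
    linarith
  have hw' : Filter.Tendsto (fun m => (X m).1) Filter.atTop (𝓝 (⟨w, hwB⟩ : Metric.thickening r S)) :=
    tendsto_subtype_rng.2 hw
  -- The distance to `S` as a continuous function on the leaf space; it detects that the images
  -- approach the boundary of the tube.
  let R : F.LeafSpace S r → ℝ := Quotient.lift (fun x : Metric.thickening r S =>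
    Metric.infDist (x : M) S) fun a b hab => hS.infDist_eq hF hab
  have hR : Continuous R :=
    ((Metric.continuous_infDist_pt S).comp continuous_subtype_val).quotient_lift _
  have hflow : Continuous fun p => φ p z :=
    hφ.localGroup.continuousOn.comp_continuous (continuous_id.prodMk continuous_const)
      (fun p => ⟨trivial, hz⟩)
  have hmk : Continuous (F.toLeaf : Metric.thickening r S → F.LeafSpace S r) := continuous_quotient_mk'
  have hlim := ((hR.comp (hflow.comp hmk)).tendsto _).comp hw'
  have hRc : ∀ m, R (φ (F.toLeaf (X m).1) z) = τ m := fun m => by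
    have h1 : φ (φ (c m) (-z)) (- -z) = c m := hφ.neg_apply hz' (by rwa [neg_neg]) h0 (c m)
    rw [neg_neg] at h1
    rw [(X m).2, h1]
    exact (hr.infDist_exp_scale hS.nonempty (hd m)).trans (abs_of_pos (hρ0.trans_le (hτρ m)))
  have hτlim : Filter.Tendsto τ Filter.atTop (𝓝 (r - 0)) := by
    refine tendsto_const_nhds.sub ?_
    have h1 : Filter.Tendsto (fun m : ℕ => (r - ρ) * (1 / 2 : ℝ) ^ m) Filter.atTop
        (𝓝 ((r - ρ) * 0)) :=
      (tendsto_pow_atTop_nhds_zero_of_lt_one (by norm_num) (by norm_num)).const_mul _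
    rw [mul_zero] at h1
    refine h1.congr fun m => ?_
    rw [one_div, inv_pow, div_eq_mul_inv]
  obtain ⟨u, hu⟩ := F.exists_toLeaf (φ (F.toLeaf ⟨w, hwB⟩) z)
  have heq := tendsto_nhds_unique (hlim.congr hRc) hτlim
  have hur : Metric.infDist (u : M) S < r :=
    (Metric.mem_thickening_iff_infDist_lt hS.nonempty).1 u.2
  have : R (F.toLeaf u) = r := by
    rw [hu]
    simpa using heq
  exact absurd (this : Metric.infDist (u : M) S = r) hur.ne

/-- The foot point of a normal ray is carried into `S`, and its distance to the other point of the
ray is kept; the inverse time gives the reverse inequality. -/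
theorem SRF.IsIsometricFlow.infDist_eq (hφ : F.IsIsometricFlow S r J φ) (hF : F.HasClosedLeaves)
    (hS : F.IsMinimalStratum S) (hne : S ≠ univ) (hr : IsTubularRadius n S r) {z : ℝ} (hz : z ∈ J)
    (hz' : -z ∈ J) (h0 : (0 : ℝ) ∈ J) {x y : Metric.thickening r S}
    (hxy : φ (F.toLeaf x) z = F.toLeaf y) : Metric.infDist (y : M) S = Metric.infDist (x : M) S := by
  have key : ∀ z ∈ J, -z ∈ J → ∀ x y : Metric.thickening r S, φ (F.toLeaf x) z = F.toLeaf y →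
      Metric.infDist (y : M) S ≤ Metric.infDist (x : M) S := by
    intro z hz hz' x y hxy
    obtain ⟨⟨t, ξ⟩, hd, hdx⟩ := hr.exists_polar_eq hne x.2
    have hd0 : ((0 : ℝ), ξ) ∈ polarDomain S r := ⟨by simpa using hr.pos, hd.2⟩
    have hx : hr.point hd = x := Subtype.ext hdx
    have hR : Metric.infDist (x : M) S = |t| := by
      rw [← hx]; exact hr.infDist_exp_scale hS.nonempty hd
    have hpS : (hr.point hd0 : M) ∈ S := by
      simp only [IsTubularRadius.point]
      rw [exp_scale_zero]
      exact hd.2.1.1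
    obtain ⟨q, hq⟩ := F.exists_toLeaf (φ (F.toLeaf (hr.point hd0)) z)
    have hqS := hφ.mem_stratum hF hS hr hz hz' h0 hpS hq.symm
    have h1 : F.leafEDist S r (F.toLeaf q) (F.toLeaf y) ≤ ENNReal.ofReal |t| := by
      rw [hq, ← hxy, hφ.isometry _ _ _ hz, ← hx]
      simpa using SRF.leafEDist_radial_le (F := F) hr hd0 hd
    have h2 := SRF.infDist_stratum_le hF hS (abs_nonneg t) h1
    rwa [Metric.infDist_zero_of_mem hqS, zero_add, ← hR] at h2
  refine le_antisymm (key z hz hz' x y hxy) (key (-z) hz' (by rwa [neg_neg]) y x ?_)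
  rw [← hxy, hφ.neg_apply hz hz' h0]

/-- The flow maps the normal geodesic rays at a point of the stratum to such rays. -/
theorem SRF.IsIsometricFlow.exists_ray (hφ : F.IsIsometricFlow S r J φ) (hF : F.HasClosedLeaves)
    (hS : F.IsMinimalStratum S) (hne : S ≠ univ) (hr : IsTubularRadius n S r) {z : ℝ} (hz : z ∈ J)
    (hz' : -z ∈ J) (h0 : (0 : ℝ) ∈ J) {p q : Metric.thickening r S} (hq : (q : M) ∈ S)
    (hpq : φ (F.toLeaf p) z = F.toLeaf q) {t : ℝ} {ξ : TangentBundle (𝓡 n) M}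
    (hd : (t, ξ) ∈ polarDomain S r) (hp : ξ.proj = p) (ht : 0 < t) :
    ∃ (η : TangentBundle (𝓡 n) M) (hη : (t, η) ∈ polarDomain S r), η.proj = q ∧
      φ (F.toLeaf (hr.point hd)) z = F.toLeaf (hr.point hη) := by
  obtain ⟨y, hy⟩ := F.exists_toLeaf (φ (F.toLeaf (hr.point hd)) z)
  have hyS : Metric.infDist (y : M) S = t := by
    rw [hφ.infDist_eq hF hS hne hr hz hz' h0 hy.symm]
    exact (hr.infDist_exp_scale hS.nonempty hd).trans (abs_of_pos ht)
  have hd0 : ((0 : ℝ), ξ) ∈ polarDomain S r := ⟨by simpa using hr.pos, hd.2⟩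
  have hp0 : hr.point hd0 = p := Subtype.ext ((exp_scale_zero ξ).trans hp)
  have h1 : F.leafEDist S r (F.toLeaf q) (F.toLeaf y) ≤ ENNReal.ofReal t := by
    rw [hy, ← hpq, hφ.isometry _ _ _ hz, ← hp0]
    simpa [abs_of_pos ht] using SRF.leafEDist_radial_le (F := F) hr hd0 hd
  have hle := SRF.infDist_leaf_le hF hS ht.le h1
  have hleaf : ∀ x, F.leafRel (y : M) x → Metric.infDist x S = t := fun x hx => by
    rw [← hS.infDist_eq hF hx, hyS]
  have hqy : (q : M) ∉ F.leaf y := fun h => by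
    have := hleaf _ h
    rw [Metric.infDist_zero_of_mem hq] at this
    exact ht.ne this
  have hC : IsClosed (F.leaf (y : M)) := hF y
  have hne' : (F.leaf (y : M)).Nonempty := ⟨y, F.mem_leaf_self _⟩
  obtain ⟨γ, hγ, hγ1, hγ0, hγd⟩ := exists_geodesic_to_closed (n := n) hC hne' hqy
  have hend : γ (Metric.infDist (q : M) (F.leaf y)) ∈ F.leaf y := by
    rw [hC.mem_iff_infDist_zero hne', hγd _ (right_mem_Icc.2 Metric.infDist_nonneg), sub_self]
  -- The isometry gives at most t; conversely every point of the leaf of `y` has distance t from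
  -- `S`, which contains `q`.
  have hℓ : Metric.infDist (q : M) (F.leaf y) = t := by
    refine le_antisymm hle ?_
    have h2 := hγ.dist_le hγ1 (Metric.infDist (q : M) (F.leaf y)) 0
    rw [zero_sub, abs_neg, abs_of_nonneg Metric.infDist_nonneg, hγ0] at h2
    rw [← hleaf _ hend]
    exact (Metric.infDist_le_dist_of_mem hq).trans h2
  rw [hℓ] at hend
  -- Read from its far end, the geodesic has length t and ends at `q` in `S`, so it realizes the
  -- distance to `S` and is therefore normal to `S` at `q`.
  have hback := hγ.affine (-1) t
  have hback1 : ‖velocityVec (n := n) (fun s => γ (-1 * s + t)) 0‖ = 1 := by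
    refine (congrArg (fun v : TangentBundle (𝓡 n) M => ‖v.2‖) (hγ.velocity_affine (-1) t 0)).trans ?_
    rw [norm_scale]
    change |(-1 : ℝ)| * ‖velocityVec (n := n) γ (-1 * 0 + t)‖ = 1
    rw [hγ.norm_velocity _ 0, hγ1]
    simp
  have e1 : -1 * (0 : ℝ) + t = t := by ring
  have e2 : -1 * t + t = 0 := by ring
  have hmem := velocity_mem_normalBundle hback hback1 ht (S := S)
    (by simp only [e1]; exact hleaf _ hend) (by simp only [e2, hγ0]; exact hq)
  rw [hγ.velocity_affine, e2] at hmem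
  have hmem2 := scale_mem_normalBundle hmem (-1)
  rw [scale_scale, neg_one_mul, neg_neg, scale_one] at hmem2
  refine ⟨velocity γ 0, ⟨hd.1, hmem2, hγ1⟩, hγ0, ?_⟩
  rw [← hy]
  refine SRF.toLeaf_eq.2 ?_
  simp only [IsTubularRadius.point]
  rw [hγ.exp_scale]
  exact hend

/-- The local group maps the stratum to itself and normal geodesic rays to such rays. -/
def SRF.PreservesRays (F : SRF n M) (hr : IsTubularRadius n S r)
    (φ : F.LeafSpace S r → ℝ → F.LeafSpace S r) (z : ℝ) : Prop :=
  (∀ p q : Metric.thickening r S, (p : M) ∈ S → φ (F.toLeaf p) z = F.toLeaf q → (q : M) ∈ S) ∧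
  ∀ p q : Metric.thickening r S, (p : M) ∈ S → (q : M) ∈ S → φ (F.toLeaf p) z = F.toLeaf q →
    ∀ (t : ℝ) (ξ : TangentBundle (𝓡 n) M) (hd : (t, ξ) ∈ polarDomain S r), ξ.proj = p → 0 < t →
      ∃ (η : TangentBundle (𝓡 n) M) (hη : (t, η) ∈ polarDomain S r), η.proj = q ∧
        φ (F.toLeaf (hr.point hd)) z = F.toLeaf (hr.point hη)

theorem SRF.IsIsometricFlow.preservesRays_add (hφ : F.IsIsometricFlow S r J φ)
    (hr : IsTubularRadius n S r) {a b : ℝ} (ha : a ∈ J) (hb : b ∈ J) (hab : a + b ∈ J)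
    (h₁ : F.PreservesRays hr φ a) (h₂ : F.PreservesRays hr φ b) :
    F.PreservesRays hr φ (a + b) := by
  refine ⟨fun p q hp hpq => ?_, fun p q hp hq hpq t ξ hd hξ ht => ?_⟩
  · rw [← hφ.localGroup.comp_time _ a ha b hb hab] at hpq
    obtain ⟨x, hx⟩ := F.exists_toLeaf (φ (F.toLeaf p) a)
    rw [← hx] at hpq
    exact h₂.1 x q (h₁.1 p x hp hx.symm) hpq
  · rw [← hφ.localGroup.comp_time _ a ha b hb hab] at hpq
    obtain ⟨x, hx⟩ := F.exists_toLeaf (φ (F.toLeaf p) a)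
    rw [← hx] at hpq
    have hxS := h₁.1 p x hp hx.symm
    obtain ⟨η, hη, hηx, hη'⟩ := h₁.2 p x hp hxS hx.symm t ξ hd hξ ht
    obtain ⟨ζ, hζ, hζq, hζ'⟩ := h₂.2 x q hxS hq hpq t η hη hηx ht
    exact ⟨ζ, hζ, hζq, by rw [← hφ.localGroup.comp_time _ a ha b hb hab, hη', hζ']⟩

/-- The time -s need not lie in `J`, while the preceding arguments use the inverse flow. So s is cut
into equal pieces so small that both signs are available, and the pieces are composed. -/
theorem SRF.IsIsometricFlow.preservesRays (hφ : F.IsIsometricFlow S r J φ) (hF : F.HasClosedLeaves)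
    (hS : F.IsMinimalStratum S) (hne : S ≠ univ) (hr : IsTubularRadius n S r) (hJ : J.OrdConnected)
    (hJ0 : J ∈ 𝓝 (0 : ℝ)) {s : ℝ} (hs : s ∈ J) : F.PreservesRays hr φ s := by
  have h0 : (0 : ℝ) ∈ J := mem_of_mem_nhds hJ0
  have hsmall : ∀ z ∈ J, -z ∈ J → F.PreservesRays hr φ z := fun z hz hz' =>
    ⟨fun p q hp hpq => hφ.mem_stratum hF hS hr hz hz' h0 hp hpq,
      fun p q _ hq hpq t ξ hd hξ ht => hφ.exists_ray hF hS hne hr hz hz' h0 hq hpq hd hξ ht⟩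
  have hlim : Filter.Tendsto (fun N : ℕ => s / ((N : ℝ) + 1)) Filter.atTop (𝓝 0) := by
    have := (tendsto_one_div_add_atTop_nhds_zero_nat (𝕜 := ℝ)).const_mul s
    rw [mul_zero] at this
    exact this.congr fun N => mul_one_div _ _
  have hlim' : Filter.Tendsto (fun N : ℕ => -(s / ((N : ℝ) + 1))) Filter.atTop (𝓝 0) := by
    simpa using hlim.neg
  obtain ⟨N, hN, hN'⟩ := ((hlim.eventually hJ0).and (hlim'.eventually hJ0)).exists
  have hN0 : (0 : ℝ) < (N : ℝ) + 1 := by positivity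
  have hmem : ∀ m : ℕ, m ≤ N + 1 → (m : ℝ) * (s / ((N : ℝ) + 1)) ∈ J := by
    intro m hm
    have hm1 : (m : ℝ) / ((N : ℝ) + 1) ≤ 1 := by
      rw [div_le_one hN0]
      exact_mod_cast hm
    have hm0 : 0 ≤ (m : ℝ) / ((N : ℝ) + 1) := by positivity
    have := hJ.convex h0 hs (sub_nonneg.2 hm1) hm0 (by ring)
    simp only [smul_eq_mul, mul_zero, zero_add] at this
    convert this using 1
    ring
  have hind : ∀ m : ℕ, m ≤ N + 1 → F.PreservesRays hr φ ((m : ℝ) * (s / ((N : ℝ) + 1))) := by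
    intro m
    induction m with
    | zero => intro _; simpa using hsmall 0 h0 (by simpa using h0)
    | succ m ih =>
      intro hm
      have h1 := hmem (m + 1) hm
      have e : ((m + 1 : ℕ) : ℝ) * (s / ((N : ℝ) + 1)) =
          (m : ℝ) * (s / ((N : ℝ) + 1)) + s / ((N : ℝ) + 1) := by push_cast; ring
      rw [e] at h1 ⊢
      exact hφ.preservesRays_add hr (hmem m (by omega)) hN h1 (ih (by omega)) (hsmall _ hN hN')
  have hlast := hind (N + 1) le_rfl
  have e : ((N + 1 : ℕ) : ℝ) * (s / ((N : ℝ) + 1)) = s := by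
    push_cast
    field_simp
  rwa [e] at hlast

end Leaf

end SingularFoliation

/-! ### Blow-up functions along the flow -/

namespace SingularFoliation

set_option maxSynthPendingDepth 3

universe u

variable {n : ℕ} {M : Type u} [MetricSpace M] [ChartedSpace (EuclideanSpace ℝ (Fin n)) M]

local notation "𝔼" => EuclideanSpace ℝ (Fin n)

/-- The t-derivative vanishes along t = 0, so ∂_z ∂_t U does at the origin, and symmetry of the
second derivative transfers this to ∂_t ∂_z U. -/
theorem hasDerivAt_deriv_of_symm {U : ℝ × ℝ → ℝ} (hU : ContDiffAt ℝ ∞ U 0)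
    (h : ∀ᶠ z in 𝓝 (0 : ℝ), deriv (fun t => U (t, z)) 0 = 0) :
    HasDerivAt (fun t => deriv (fun z => U (t, z)) 0) 0 0 := by
  have hd : ∀ᶠ p in 𝓝 (0 : ℝ × ℝ), DifferentiableAt ℝ U p := by
    have h1 := hU.of_le (show (1 : ℕ∞ω) ≤ ∞ by simp)
    filter_upwards [h1.eventually (by simp)] with p hp using hp.differentiableAt (by simp)
  have h2 : HasFDerivAt (fderiv ℝ U) (fderiv ℝ (fderiv ℝ U) 0) 0 :=
    ((hU.fderiv_right (m := ∞) (by simp)).differentiableAt (by simp)).hasFDerivAt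
  have hc1 : HasDerivAt (fun t : ℝ => (t, (0 : ℝ))) ((1 : ℝ), (0 : ℝ)) 0 :=
    (hasDerivAt_id (0 : ℝ)).prodMk (hasDerivAt_const (0 : ℝ) (0 : ℝ))
  have hc2 : HasDerivAt (fun z : ℝ => ((0 : ℝ), z)) ((0 : ℝ), (1 : ℝ)) 0 :=
    (hasDerivAt_const (0 : ℝ) (0 : ℝ)).prodMk (hasDerivAt_id (0 : ℝ))
  have h3 : HasDerivAt (fun t : ℝ => fderiv ℝ U (t, 0) (0, 1))
      (fderiv ℝ (fderiv ℝ U) 0 (1, 0) (0, 1)) 0 := by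
    have := (HasFDerivAt.comp_hasDerivAt (f := fun t : ℝ => (t, (0 : ℝ))) (0 : ℝ) h2 hc1).clm_apply
      (hasDerivAt_const (0 : ℝ) ((0 : ℝ), (1 : ℝ)))
    exact this.congr_deriv (by simp)
  have h4 : HasDerivAt (fun z : ℝ => fderiv ℝ U (0, z) (1, 0))
      (fderiv ℝ (fderiv ℝ U) 0 (0, 1) (1, 0)) 0 := by
    have := (HasFDerivAt.comp_hasDerivAt (f := fun z : ℝ => ((0 : ℝ), z)) (0 : ℝ) h2 hc2).clm_apply
      (hasDerivAt_const (0 : ℝ) ((1 : ℝ), (0 : ℝ)))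
    exact this.congr_deriv (by simp)
  have h5 : ∀ᶠ z in 𝓝 (0 : ℝ), fderiv ℝ U (0, z) (1, 0) = 0 := by
    filter_upwards [h, hc2.continuousAt.eventually hd] with z hz hdz
    have h6 : HasDerivAt (fun t : ℝ => (t, z)) ((1 : ℝ), (0 : ℝ)) 0 :=
      (hasDerivAt_id (0 : ℝ)).prodMk (hasDerivAt_const (0 : ℝ) z)
    have := HasFDerivAt.comp_hasDerivAt (f := fun t : ℝ => (t, z)) (0 : ℝ) hdz.hasFDerivAt h6
    exact this.deriv.symm.trans hz
  have h7 : fderiv ℝ (fderiv ℝ U) 0 (0, 1) (1, 0) = 0 :=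
    h4.unique ((hasDerivAt_const (0 : ℝ) (0 : ℝ)).congr_of_eventuallyEq h5)
  have hsymm : IsSymmSndFDerivAt ℝ U 0 := hU.isSymmSndFDerivAt (by
    rw [minSmoothness_of_isRCLikeNormedField]
    exact ENat.LEInfty.out)
  rw [hsymm (1, 0) (0, 1), h7] at h3
  refine h3.congr_of_eventuallyEq ?_
  filter_upwards [hc1.continuousAt.eventually hd] with t hdt
  have h6 : HasDerivAt (fun z : ℝ => (t, z)) ((0 : ℝ), (1 : ℝ)) 0 :=
    (hasDerivAt_const (0 : ℝ) t).prodMk (hasDerivAt_id (0 : ℝ))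
  exact (HasFDerivAt.comp_hasDerivAt (f := fun z : ℝ => (t, z)) (0 : ℝ) hdt.hasFDerivAt h6).deriv

variable [IsManifold (𝓡 n) ∞ M] [RiemannianBundle (fun x : M => TangentSpace (𝓡 n) x)]
  [IsContMDiffRiemannianBundle (𝓡 n) ∞ (EuclideanSpace ℝ (Fin n))
    (fun x : M => TangentSpace (𝓡 n) x)]
  [IsRiemannianManifold (𝓡 n) M] [CompleteSpace M] {S : Set M} {r : ℝ}
  {F : SRF n M} {J : Set ℝ} {φ : F.LeafSpace S r → ℝ → F.LeafSpace S r}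
  {ψ : F.HatLeafSpace S r → ℝ → F.HatLeafSpace S r} {k : F.LeafSpace S r → ℝ}

theorem exp_scale_of_zero {v : TangentBundle (𝓡 n) M} (h : v.2 = 0) (t : ℝ) :
    exp (scale t v) = v.proj := by
  have : scale t v = scale 0 v := by simp [scale, h]
  rw [this, exp_scale_zero]

theorem SRF.IsLift.isHatSmooth_comp {hr : IsTubularRadius n S r} (hψ : F.IsLift hr J φ ψ)
    (hsmooth : F.IsHatSmoothFlow S r J ψ) (hk : F.IsHatSmooth S r (fun a => k (F.leafBlowDown hr a)))
    {s : ℝ} (hs : s ∈ J) : F.IsHatSmooth S r (fun a => k (φ (F.leafBlowDown hr a) s)) := by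
  have h1 := ContMDiffOn.comp (hsmooth _ hk) (f := fun d : ℝ × TangentBundle (𝓡 n) M => (d, s))
    (s := polarDomain S r) (contMDiffOn_id.prodMk contMDiffOn_const) (fun d hd => ⟨hd, hs⟩)
  refine h1.congr fun d hd => ?_
  have h2 : (fun a => k (φ (F.leafBlowDown hr a) s)) =
      fun a => k (F.leafBlowDown hr (ψ a s)) := funext fun a => by rw [hψ.equivariant a s hs]
  rw [h2]
  rfl

/-- The flow preserves the vanishing of the normal derivatives. -/
theorem SRF.IsIsometricFlow.normal_deriv_comp (hφ : F.IsIsometricFlow S r J φ)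
    (hF : F.HasClosedLeaves) (hS : F.IsMinimalStratum S) (hne : S ≠ univ)
    (hr : IsTubularRadius n S r) (hJ : J.OrdConnected) (hJ0 : J ∈ 𝓝 (0 : ℝ))
    (hk : F.IsHatSmooth S r (fun a => k (F.leafBlowDown hr a)))
    (hnd : ∀ v ∈ normalBundle (n := n) S,
      HasDerivAt (fun t : ℝ => F.basicFun S r k (exp (scale t v))) 0 0)
    {s : ℝ} (hs : s ∈ J) {v : TangentBundle (𝓡 n) M} (hv : v ∈ normalBundle S) :
    HasDerivAt (fun t : ℝ => F.basicFun S r (fun p => k (φ p s)) (exp (scale t v))) 0 0 := by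
  by_cases hv0 : v.2 = 0
  · simp only [exp_scale_of_zero hv0]
    exact hasDerivAt_const _ _
  have hN : 0 < ‖v.2‖ := norm_pos_iff.2 hv0
  obtain ⟨hrays1, hrays2⟩ := hφ.preservesRays hF hS hne hr hJ hJ0 hs
  set p : Metric.thickening r S := ⟨v.proj, hr.subset_tube hv.1⟩ with hp
  obtain ⟨q, hq⟩ := F.exists_toLeaf (φ (F.toLeaf p) s)
  have hqS := hrays1 p q hv.1 hq.symm
  have happ : ∀ x : Metric.thickening r S, F.basicFun S r (fun p => k (φ p s)) (x : M) =
      k (φ (F.toLeaf x) s) := fun x => F.basicFun_apply _ x.2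
  have happ' : ∀ x : Metric.thickening r S, F.basicFun S r k (x : M) = k (F.toLeaf x) :=
    fun x => F.basicFun_apply _ x.2
  rw [hasDerivAt_iff_isLittleO_nhds_zero, Asymptotics.isLittleO_iff]
  intro c hc
  -- The image direction η found below depends on t, so a bound uniform over all unit normal vectors
  -- at `q` is required.
  obtain ⟨δ, hδ, hbound⟩ := F.eventually_abs_sub_le hr hk hnd hqS (div_pos hc hN)
  have hev : ∀ᶠ t in 𝓝 (0 : ℝ), |t| * ‖v.2‖ < min δ r := by
    have h1 : Continuous fun t : ℝ => |t| * ‖v.2‖ := continuous_abs.mul continuous_const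
    have h2 := h1.tendsto 0
    rw [abs_zero, zero_mul] at h2
    exact h2.eventually_lt_const (lt_min hδ hr.pos)
  filter_upwards [hev] with t ht
  simp only [zero_add, smul_zero, sub_zero]
  rw [exp_scale_zero]
  by_cases ht0 : t = 0
  · subst ht0
    rw [exp_scale_zero, sub_self, norm_zero, mul_zero]
  have ht0' : 0 < |t| := abs_pos.2 ht0
  set τ := |t| * ‖v.2‖ with hτ
  have hτ0 : 0 < τ := mul_pos ht0' hN
  -- The sign of t is absorbed into the unit vector, since the flow is known to preserve rays only
  -- for positive parameters.
  set ξ := scale (t / τ) v with hξ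
  have hξ1 : ‖ξ.2‖ = 1 := by
    rw [hξ, norm_scale, abs_div, abs_of_pos hτ0, hτ]
    field_simp
  have hξt : scale τ ξ = scale t v := by
    rw [hξ, scale_scale, mul_div_cancel₀ _ hτ0.ne']
  have hd : (τ, ξ) ∈ polarDomain S r :=
    ⟨by simp only [abs_of_pos hτ0]; exact ht.trans_le (min_le_right _ _),
      scale_mem_normalBundle hv _, hξ1⟩
  obtain ⟨η, hη, hηq, hη'⟩ := hrays2 p q hv.1 hqS hq.symm τ ξ hd rfl hτ0
  have h3 := hbound η hη.2.1 hη.2.2 hηq τ hτ0 (ht.trans_le (min_le_left _ _))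
  have e1 : F.basicFun S r (fun p => k (φ p s)) (exp (scale t v)) =
      F.basicFun S r k (exp (scale τ η)) := by
    rw [← hξt]
    exact (happ (hr.point hd)).trans ((congrArg k hη').trans (happ' (hr.point hη)).symm)
  have e2 : F.basicFun S r (fun p => k (φ p s)) v.proj = F.basicFun S r k q :=
    (happ p).trans ((congrArg k hq.symm).trans (happ' q).symm)
  rw [e1, e2, Real.norm_eq_abs, Real.norm_eq_abs]
  refine h3.trans (le_of_eq ?_)
  rw [hτ]
  field_simp

theorem SRF.IsLift.polarFun_eq {hr : IsTubularRadius n S r} (hψ : F.IsLift hr J φ ψ)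
    {d : ℝ × TangentBundle (𝓡 n) M} (hd : d ∈ polarDomain S r) {z : ℝ} (hz : z ∈ J) :
    F.polarFun S r (fun a => k (F.leafBlowDown hr (ψ a z))) d =
      k (φ (F.toLeaf (hr.point (t := d.1) (ξ := d.2) hd)) z) := by
  rw [F.polarFun_apply _ hd]
  rw [hψ.equivariant _ z hz]
  rfl

/-- Each leaf has a point above it in the blow-up, where the lifted flow is smooth in time. -/
theorem SRF.IsLift.differentiableAt {hr : IsTubularRadius n S r} (hψ : F.IsLift hr J φ ψ)
    (hsmooth : F.IsHatSmoothFlow S r J ψ) (hne : S ≠ univ) (hJ0 : J ∈ 𝓝 (0 : ℝ))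
    (hk : F.IsHatSmooth S r (fun a => k (F.leafBlowDown hr a))) (p : F.LeafSpace S r) :
    DifferentiableAt ℝ (fun z : ℝ => k (φ p z)) 0 := by
  obtain ⟨x, rfl⟩ := F.exists_toLeaf p
  obtain ⟨d, hd, hdx⟩ := hr.exists_polar_eq hne x.2
  have hx : hr.point (t := d.1) (ξ := d.2) hd = x := Subtype.ext hdx
  have h1 := ContMDiffOn.comp (hsmooth _ hk) (f := fun z : ℝ => (d, z)) (s := J)
    (contMDiffOn_const.prodMk contMDiffOn_id) (fun z hz => ⟨hd, hz⟩)
  have h2 := (h1.contDiffOn.contDiffAt hJ0).differentiableAt (by simp)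
  refine h2.congr_of_eventuallyEq ?_
  filter_upwards [hJ0] with z hz
  rw [← hx]
  exact (hψ.polarFun_eq hd hz).symm

theorem SRF.IsLift.isHatSmooth_flowDeriv {hr : IsTubularRadius n S r} (hψ : F.IsLift hr J φ ψ)
    (hsmooth : F.IsHatSmoothFlow S r J ψ) (hJ0 : J ∈ 𝓝 (0 : ℝ))
    (hk : F.IsHatSmooth S r (fun a => k (F.leafBlowDown hr a))) :
    F.IsHatSmooth S r (fun a => F.flowDeriv S r φ k (F.leafBlowDown hr a)) := by
  refine (contMDiffOn_deriv_param hJ0 (hsmooth _ hk)).congr fun d hd => ?_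
  rw [F.polarFun_apply _ hd]
  refine Filter.EventuallyEq.deriv_eq ?_
  filter_upwards [hJ0] with z hz
  exact (hψ.polarFun_eq hd hz).symm

theorem SRF.IsLift.normal_deriv_flowDeriv {hr : IsTubularRadius n S r} (hψ : F.IsLift hr J φ ψ)
    (hsmooth : F.IsHatSmoothFlow S r J ψ) (hφ : F.IsIsometricFlow S r J φ)
    (hF : F.HasClosedLeaves) (hS : F.IsMinimalStratum S) (hne : S ≠ univ)
    (hJ : J.OrdConnected) (hJ0 : J ∈ 𝓝 (0 : ℝ))
    (hk : F.IsHatSmooth S r (fun a => k (F.leafBlowDown hr a)))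
    (hnd : ∀ v ∈ normalBundle (n := n) S,
      HasDerivAt (fun t : ℝ => F.basicFun S r k (exp (scale t v))) 0 0)
    {v : TangentBundle (𝓡 n) M} (hv : v ∈ normalBundle S) :
    HasDerivAt (fun t : ℝ => F.basicFun S r (F.flowDeriv S r φ k) (exp (scale t v))) 0 0 := by
  by_cases hv0 : v.2 = 0
  · simp only [exp_scale_of_zero hv0]
    exact hasDerivAt_const _ _
  have hN : 0 < ‖v.2‖ := norm_pos_iff.2 hv0
  have hr0 := hr.pos
  set ξ := scale ‖v.2‖⁻¹ v with hξ
  have hξν : ξ ∈ normalBundle S := scale_mem_normalBundle hv _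
  have hξ1 : ‖ξ.2‖ = 1 := by
    rw [hξ, norm_scale, abs_inv, abs_norm, inv_mul_cancel₀ hN.ne']
  set U : ℝ × ℝ → ℝ := fun w =>
    F.polarFun S r (fun a => k (F.leafBlowDown hr (ψ a w.2))) (w.1, ξ) with hU
  have hIoo : Ioo (-r) r ∈ 𝓝 (0 : ℝ) := Ioo_mem_nhds (neg_lt_zero.2 hr0) hr0
  have hUeq : ∀ t (ht : t ∈ Ioo (-r) r), ∀ z ∈ J,
      U (t, z) = k (φ (F.toLeaf (hr.point (mem_polarDomain hξν hξ1 ht))) z) := fun t ht z hz =>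
    hψ.polarFun_eq (d := (t, ξ)) (mem_polarDomain hξν hξ1 ht) hz
  have hUD : ContDiffAt ℝ ∞ U 0 := by
    have h1 := ContMDiffOn.comp (hsmooth _ hk)
      (f := fun w : ℝ × ℝ => (((w.1, ξ) : ℝ × TangentBundle (𝓡 n) M), w.2))
      (I := 𝓘(ℝ, ℝ × ℝ)) (s := Ioo (-r) r ×ˢ J)
      (((contDiff_fst.contMDiff.contMDiffOn).prodMk contMDiffOn_const).prodMk
        contDiff_snd.contMDiff.contMDiffOn)
      (fun w hw => ⟨mem_polarDomain hξν hξ1 hw.1, hw.2⟩)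
    exact h1.contDiffOn.contDiffAt (prod_mem_nhds hIoo hJ0)
  have hbasic : ∀ (f : F.LeafSpace S r → ℝ) t (ht : t ∈ Ioo (-r) r),
      F.basicFun S r f (exp (scale t ξ)) =
        f (F.toLeaf (hr.point (mem_polarDomain hξν hξ1 ht))) := fun f t ht =>
    F.basicFun_apply f (hr.point (mem_polarDomain hξν hξ1 ht)).2
  -- The hypothesis on the t-derivative holds for every small z because each `φ_z` preserves the
  -- vanishing of normal derivatives.
  have hmixed := hasDerivAt_deriv_of_symm hUD (by
    filter_upwards [hJ0] with z hz
    refine HasDerivAt.deriv ((hφ.normal_deriv_comp hF hS hne hr hJ hJ0 hk hnd hz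
      hξν).congr_of_eventuallyEq ?_)
    filter_upwards [hIoo] with t ht
    rw [hUeq t ht z hz, hbasic _ t ht])
  have hG : HasDerivAt (fun t : ℝ => F.basicFun S r (F.flowDeriv S r φ k) (exp (scale t ξ))) 0 0 := by
    refine hmixed.congr_of_eventuallyEq ?_
    filter_upwards [hIoo] with t ht
    rw [hbasic _ t ht]
    refine Filter.EventuallyEq.deriv_eq ?_
    filter_upwards [hJ0] with z hz
    exact (hUeq t ht z hz).symm
  have hlin : HasDerivAt (fun t : ℝ => t * ‖v.2‖) ‖v.2‖ 0 := by
    simpa using (hasDerivAt_id (0 : ℝ)).mul_const ‖v.2‖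
  have hG' : HasDerivAt (fun t : ℝ => F.basicFun S r (F.flowDeriv S r φ k) (exp (scale t ξ))) 0
      ((0 : ℝ) * ‖v.2‖) := by rw [zero_mul]; exact hG
  have h2 := hG'.comp (0 : ℝ) hlin
  rw [zero_mul] at h2
  refine h2.congr_of_eventuallyEq (Filter.Eventually.of_forall fun t => ?_)
  simp only [Function.comp_apply]
  rw [hξ, scale_scale, mul_assoc, mul_inv_cancel₀ hN.ne', mul_one]

end SingularFoliation

theorem mainTheorem6 {n : ℕ} {M : Type*} [MetricSpace M]
    [ChartedSpace (EuclideanSpace ℝ (Fin n)) M] [IsManifold (𝓡 n) ∞ M]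
    [Bundle.RiemannianBundle (fun x : M => TangentSpace (𝓡 n) x)]
    [IsContMDiffRiemannianBundle (𝓡 n) ∞ (EuclideanSpace ℝ (Fin n))
      (fun x : M => TangentSpace (𝓡 n) x)]
    [IsRiemannianManifold (𝓡 n) M] [CompleteSpace M]
    (F : SingularFoliation.SRF n M) (hF : F.HasClosedLeaves)
    (S : Set M) (hS : F.IsMinimalStratum S) (hne : S ≠ Set.univ)
    (r : ℝ) (hr : SingularFoliation.IsTubularRadius n S r)
    (J : Set ℝ) (hJ : J.OrdConnected) (hJ0 : J ∈ 𝓝 (0 : ℝ))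
    (φ : F.LeafSpace S r → ℝ → F.LeafSpace S r) (hφ : F.IsIsometricFlow S r J φ)
    (ψ : F.HatLeafSpace S r → ℝ → F.HatLeafSpace S r) (hψ : F.IsLift hr J φ ψ)
    (hsmooth : F.IsHatSmoothFlow S r J ψ)
    (h : F.LeafSpace S r → ℝ) (hh : F.IsBlowUpFunction hr h) :
    (∀ p, DifferentiableAt ℝ (fun z : ℝ => h (φ p z)) 0) ∧
    ∀ s ∈ J, F.IsBlowUpFunction hr (fun p => F.flowDeriv S r φ h (φ p s)) := by
  refine ⟨fun p => hψ.differentiableAt hsmooth hne hJ0 hh.smooth_lift p, fun s hs => ?_⟩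
  have hg := hψ.isHatSmooth_flowDeriv hsmooth hJ0 hh.smooth_lift
  -- The flow invariance of vanishing normal derivatives is used a second time, now for the function
  -- Ȳ·h and the time `s`.
  exact SingularFoliation.SRF.isBlowUpFunction_of_lift hr hne (hψ.isHatSmooth_comp hsmooth hg hs)
    fun v hv => hφ.normal_deriv_comp hF hS hne hr hJ hJ0 hg
      (fun w hw => hψ.normal_deriv_flowDeriv hsmooth hφ hF hS hne hJ hJ0 hh.smooth_lift
        hh.normal_deriv hw) hs hv
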